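/- **Setting.** Let $d\ge 1$, $\beta\ge 2$, $L>0$, $M,p_{\max}\in\mathbb R$, $p_{\min}>0$, $\sigma>0$; let $\Theta\subset\mathbb R^d$ be compact and convex, $\Theta'=\{x+y: x\in\Theta,\ \|y\|\le 1\}$ ($\|\cdot\|$ Euclidean), and let $K:\mathbb R^d\to[0,\infty)$ be a bounded Lipschitz kernel with $\int K=1$ whose (compact) support is contained in the closed unit ball. Let $\ell$ be the biggest integer strictly smaller than $\beta$. *Function class.* $f:\mathbb R^d\to\mathbb R$ is $\ell$ times differentiable with $\bigl|f(x')-\sum_{|m|\le \ell}\frac{1}{m!}D^mf(x)(x'-x)^m\bigr|\le L\|x'-x\|^\beta$ for all $x,x'\in\mathbb R^d$; $f$ attains its minimum over $\Theta$ at $x^*\in\Theta$, with $f^*=f(x^*)$; for some $\alpha>0$, $f(y)\ge f(x)+\langle\nabla f(x),y-x\rangle+\frac{\alpha}{2}\|x-y\|^2$ for all $x,y\in\Theta$; and $|f|\le M$ on $\Theta'$. *Data.* $n$ is an even positive integer and $y_i=f(x_i)+\xi_i$, $i=1,\dots,n$. The $x_i$ are i.i.d. random vectors with a Lebesgue density $p$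 satisfying $p_{\min}\le p\le p_{\max}$ on $\Theta'$. The $\xi_i$ are mutually independent, the family $(\xi_i)_{i\le n}$ is independent of the family $(x_i)_{i\le n}$, $\mathbf E\xi_i=0$, and $\mathbf E\exp(|\xi_i|/\sigma)\le 2$. *Estimators.* Let $U(u)=(u^m/m!)_{|m|\le \ell}$. For $h,\lambda>0$, a nonempty set $s$ of indices and $z\in\mathbb R^d$ put $$B_s(z)=\frac1{|s|h^d}\sum_{i\in s}U\Bigl(\frac{x_i-z}h\Bigr)U^\top\Bigl(\frac{x_i-z}h\Bigr)K\Bigl(\frac{x_i-z}h\Bigr),\quad D_s(z)=\frac1{|s|h^d}\sum_{i\in s}y_iU\Bigl(\frac{x_i-z}h\Bigr)K\Bigl(\frac{x_i-z}h\Bigr),$$ and $\hat\theta_s(z)=(B_s(z)+\lambda I)^{-1}D_s(z)$. Algorithm 1 (projected gradient descent): start from any $z_1\in\Theta$ and set $z_{k+1}=\mathrm{Proj}_\Theta\bigl(z_k-\frac{2}{\alpha k}g_k(z_k)\bigr)$, where $\mathrm{Proj}_\Theta$ is the Euclidean projection onto $\Theta$, and $g_k(z)=h_k^{-1}A\hat\theta_s(z)$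 with $s=\{1,\dots,k\}$, $h=h_k=(\log(k+1)/k)^{1/(2\beta+d)}$, $\lambda=\lambda_k=(\log(k+1)/k)^{\beta/(2\beta+d)}$, the matrix $A$ extracting the $d$ coordinates with $|m|=1$. Algorithm 2: with $m=n/2$, let $\bar z_m=\frac1m\sum_{k=1}^m z_k$ be the averaged iterate of Algorithm 1 run on the first half $(x_i,y_i)_{i\le m}$ of the data, and let $\tilde f_n(z)=U^\top(0)\hat\theta_s(z)$ be built on the second half $s=\{m+1,\dots,n\}$ with $h=n^{-1/(2\beta+d)}$, $\lambda=n^{-\beta/(2\beta+d)}$. The estimator of $f^*$ is $\hat f_n=\tilde f_n(\bar z_m)$. **Theorem.** There is a constant $C>0$ depending only on $d,\Theta,\beta,L,M,p_{\min},p_{\max},K,\sigma$ such that, in the above setting, for every even $n\ge 2$, every $\alpha>0$, every $f$ in the class, every $z_1\in\Theta$ and every joint law of the data as above, $|\hat f_n-f^*|$ is integrable and $$\mathbf E|\hat f_n-f^*|\le C\max(1,\alpha^{-1})\cdot\begin{cases}(\log(n)/n)^{\frac{2}{4+d}}&\text{if }\beta=2,\\ n^{-\frac{\beta}{2\beta+d}}&\text{if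 }\beta>2.\end{cases}$$ Furthermore, if $\alpha\ge n^{-\frac{\beta-2}{2\beta+d}}\log(n)^{\frac{2(\beta-1)}{2\beta+d}}$, then $\mathbf E|\hat f_n-f^*|\le C\,n^{-\frac{\beta}{2\beta+d}}$. -/

import Mathlib

open MeasureTheory ProbabilityTheory
open scoped Gradient

noncomputable section

namespace PassiveDesign

/-- The space `ℝ^d` with the Euclidean norm. -/
abbrev E (d : ℕ) : Type := EuclideanSpace ℝ (Fin d)

/-- The biggest integer strictly smaller than `β` (for `β > 0`). -/
def strictFloor (β : ℝ) : ℕ := ⌈β⌉₊ - 1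

/-- The finite set of `d`-dimensional multi-indices `m` with `|m| ≤ ℓ`
(every entry of such a multi-index is at most `ℓ`). -/
abbrev MultiIndex (d ℓ : ℕ) : Type :=
  {m : Fin d → Fin (ℓ + 1) // ∑ i, (m i : ℕ) ≤ ℓ}

/-- The entries of a multi-index, as natural numbers. -/
def MultiIndex.entry {d ℓ : ℕ} (m : MultiIndex d ℓ) : Fin d → ℕ := fun i => (m.1 i : ℕ)

/-- The scaled monomial `u^m / m!`. -/
def scaledMonomial {d : ℕ} (m : Fin d → ℕ) (u : E d) : ℝ :=
  (∏ i, u i ^ m i) / (∏ i, ((m i).factorial : ℝ))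

/-- The partial derivative of `g` in the `i`-th coordinate. -/
def partialDeriv {d : ℕ} (i : Fin d) (g : E d → ℝ) : E d → ℝ :=
  fun x => lineDeriv ℝ g x (EuclideanSpace.single i (1 : ℝ))

/-- The differentiation operator `D^m = ∂_1^{m_1} ⋯ ∂_d^{m_d}`. -/
def mixedPartial {d : ℕ} (m : Fin d → ℕ) (f : E d → ℝ) : E d → ℝ :=
  (List.finRange d).foldr (fun i g => (partialDeriv i)^[m i] g) f

/-- The Hölder class `F_β(L)`: `f` is `ℓ` times (Fréchet) differentiable on `ℝ^d`, where `ℓ` is the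
biggest integer strictly smaller than `β`, and is approximated by its Taylor polynomials of
degree `ℓ` up to `L ‖x' - x‖^β`. -/
structure HolderClass {d : ℕ} (β L : ℝ) (f : E d → ℝ) : Prop where
  differentiable : ∀ k : ℕ, k < strictFloor β → Differentiable ℝ (iteratedFDeriv ℝ k f)
  taylor : ∀ x x' : E d,
    |f x' - ∑ m : MultiIndex d (strictFloor β),
        mixedPartial m.entry f x * scaledMonomial m.entry (x' - x)| ≤ L * ‖x' - x‖ ^ β

/-- The conditions on the kernel. -/
structure IsKernel {d : ℕ} (K : E d → ℝ) : Prop where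
  compact_support : HasCompactSupport K
  support_subset : tsupport K ⊆ Metric.closedBall 0 1
  nonneg : ∀ u, 0 ≤ K u
  integral_eq_one : ∫ u, K u = 1
  bounded : BddAbove (Set.range K)
  lipschitz : ∃ LK : NNReal, LipschitzWith LK K

/-- The set of all `x + y` with `x ∈ Θ` and `‖y‖ ≤ 1`. -/
def enlarge {d : ℕ} (Θ : Set (E d)) : Set (E d) :=
  {w | ∃ x ∈ Θ, ∃ y : E d, ‖y‖ ≤ 1 ∧ w = x + y}

/-- The class `F_{β,α}(L)` of regression functions on `Θ` with the bound `M`, together with the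
point `xstar` at which the minimum over `Θ` is attained. -/
structure RegressionClass {d : ℕ} (Θ : Set (E d)) (β L M α : ℝ) (f : E d → ℝ) (xstar : E d) :
    Prop where
  xstar_mem : xstar ∈ Θ
  xstar_min : ∀ x ∈ Θ, f xstar ≤ f x
  holder : HolderClass β L f
  strongly_convex : ∀ x ∈ Θ, ∀ y ∈ Θ,
    f x + inner ℝ (∇ f x) (y - x) + α / 2 * ‖x - y‖ ^ 2 ≤ f y
  bounded : ∀ x ∈ enlarge Θ, |f x| ≤ M

/-- The conditions on the design: i.i.d. random vectors having a Lebesgue density `p` with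
`pmin ≤ p ≤ pmax` on the enlargement of `Θ`. -/
structure IsDesign {d n : ℕ} {Ω : Type*} [MeasurableSpace Ω] (μ : Measure Ω)
    (Θ : Set (E d)) (pmin pmax : ℝ) (X : Fin n → Ω → E d) : Prop where
  measurable : ∀ i, Measurable (X i)
  independent : iIndepFun X μ
  density : ∃ p : E d → ℝ, Measurable p ∧ (∀ x, 0 ≤ p x) ∧
    (∀ i, μ.map (X i) = volume.withDensity (fun x => ENNReal.ofReal (p x))) ∧
    ∀ x ∈ enlarge Θ, pmin ≤ p x ∧ p x ≤ pmax

/-- The conditions on the noise: independent zero mean sub-exponential errors with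
parameter `σ`, independent of the design. -/
structure IsNoise {d n : ℕ} {Ω : Type*} [MeasurableSpace Ω] (μ : Measure Ω)
    (σ : ℝ) (X : Fin n → Ω → E d) (ξ : Fin n → Ω → ℝ) : Prop where
  measurable : ∀ i, Measurable (ξ i)
  independent : iIndepFun ξ μ
  indep_design : IndepFun (fun ω i => ξ i ω) (fun ω i => X i ω) μ
  integrable : ∀ i, Integrable (ξ i) μ
  mean_zero : ∀ i, ∫ ω, ξ i ω ∂μ = 0
  integrable_exp : ∀ i, Integrable (fun ω => Real.exp (|ξ i ω| / σ)) μ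
  exp_moment : ∀ i, ∫ ω, Real.exp (|ξ i ω| / σ) ∂μ ≤ 2

/-- The vector `U(u)` of all scaled monomials of degree at most `ℓ`. -/
def monomialVec {d : ℕ} (ℓ : ℕ) (u : E d) : MultiIndex d ℓ → ℝ :=
  fun m => scaledMonomial m.entry u

/-- The matrix `(1 / (|s| h^d)) ∑_{i ∈ s} U((x_i - z)/h) U((x_i - z)/h)ᵀ K((x_i - z)/h)`, built on
the observations with index in `s`. -/
def gramMatrix {d n : ℕ} (ℓ : ℕ) (K : E d → ℝ) (h : ℝ) (s : Finset (Fin n)) (x : Fin n → E d)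
    (z : E d) : Matrix (MultiIndex d ℓ) (MultiIndex d ℓ) ℝ :=
  (1 / ((s.card : ℝ) * h ^ d)) •
    ∑ i ∈ s, K (h⁻¹ • (x i - z)) •
      Matrix.vecMulVec (monomialVec ℓ (h⁻¹ • (x i - z))) (monomialVec ℓ (h⁻¹ • (x i - z)))

/-- The vector `(1 / (|s| h^d)) ∑_{i ∈ s} y_i U((x_i - z)/h) K((x_i - z)/h)`. -/
def responseVec {d n : ℕ} (ℓ : ℕ) (K : E d → ℝ) (h : ℝ) (s : Finset (Fin n)) (x : Fin n → E d)
    (y : Fin n → ℝ) (z : E d) : MultiIndex d ℓ → ℝ :=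
  (1 / ((s.card : ℝ) * h ^ d)) •
    ∑ i ∈ s, (y i * K (h⁻¹ • (x i - z))) • monomialVec ℓ (h⁻¹ • (x i - z))

/-- The regularized local polynomial coefficients `(B + λ I)⁻¹ D`. -/
def localPolyCoeff {d n : ℕ} (ℓ : ℕ) (K : E d → ℝ) (h lam : ℝ) (s : Finset (Fin n))
    (x : Fin n → E d) (y : Fin n → ℝ) (z : E d) : MultiIndex d ℓ → ℝ :=
  Matrix.mulVec (gramMatrix ℓ K h s x z + lam • (1 : Matrix _ _ ℝ))⁻¹ (responseVec ℓ K h s x y z)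

/-- The matrix `A` selecting the `d` coefficients of the first order monomials. -/
def gradSelector (d ℓ : ℕ) : Matrix (Fin d) (MultiIndex d ℓ) ℝ :=
  fun j m => if m.entry = Pi.single j 1 then 1 else 0

/-- The regularized local polynomial estimator `h⁻¹ A (B + λ I)⁻¹ D` of the gradient at `z`. -/
def gradEstimator {d n : ℕ} (ℓ : ℕ) (K : E d → ℝ) (h lam : ℝ) (s : Finset (Fin n))
    (x : Fin n → E d) (y : Fin n → ℝ) (z : E d) : E d :=
  WithLp.toLp 2 (h⁻¹ • Matrix.mulVec (gradSelector d ℓ) (localPolyCoeff ℓ K h lam s x y z))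

/-- The regularized local polynomial estimator `U(0)ᵀ (B + λ I)⁻¹ D` of the function at `z`. -/
def funEstimator {d n : ℕ} (ℓ : ℕ) (K : E d → ℝ) (h lam : ℝ) (s : Finset (Fin n))
    (x : Fin n → E d) (y : Fin n → ℝ) (z : E d) : ℝ :=
  dotProduct (monomialVec ℓ (0 : E d)) (localPolyCoeff ℓ K h lam s x y z)

/-- The Euclidean projection of `x` onto `Θ`: the point of `Θ` nearest to `x`
(it exists and is unique when `Θ` is nonempty, closed and convex). -/
def proj {d : ℕ} (Θ : Set (E d)) (x : E d) : E d :=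
  Classical.epsilon (fun p => p ∈ Θ ∧ ∀ q ∈ Θ, ‖x - p‖ ≤ ‖x - q‖)

/-- The bandwidth `h_k` of the gradient descent. -/
def bandwidth (d : ℕ) (β : ℝ) (k : ℕ) : ℝ :=
  (Real.log (k + 1) / k) ^ (1 / (2 * β + d))

/-- The regularization parameter `λ_k` of the gradient descent. -/
def regularization (d : ℕ) (β : ℝ) (k : ℕ) : ℝ :=
  (Real.log (k + 1) / k) ^ (β / (2 * β + d))

/-- The first `k` observations. -/
def firstObs (n k : ℕ) : Finset (Fin n) := Finset.univ.filter (fun i => (i : ℕ) < k)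

/-- The observations with number `m + 1, …, n`. -/
def lastObs (n m : ℕ) : Finset (Fin n) := Finset.univ.filter (fun i => m ≤ (i : ℕ))

/-- The iterates of the passive zero-order projected gradient descent started at `z1`, with step
sizes `2 / (α k)`. The value at `k` is the iterate with number `k + 1`, so that it
equals `z1` at `0`, and round `k + 1` (which uses the first `k + 1` observations) produces the
value at `k + 1`. -/
def iterate {d n : ℕ} (Θ : Set (E d)) (β α : ℝ) (K : E d → ℝ) (z1 : E d)
    (x : Fin n → E d) (y : Fin n → ℝ) : ℕ → E d
  | 0 => z1
  | k + 1 =>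
    proj Θ (iterate Θ β α K z1 x y k -
      (2 / (α * ((k + 1 : ℕ) : ℝ))) •
        gradEstimator (strictFloor β) K (bandwidth d β (k + 1)) (regularization d β (k + 1))
          (firstObs n (k + 1)) x y (iterate Θ β α K z1 x y k))

/-- The average of the iterates with numbers `1, …, m`. -/
def averagedIterate {d n : ℕ} (Θ : Set (E d)) (β α : ℝ) (K : E d → ℝ) (z1 : E d)
    (x : Fin n → E d) (y : Fin n → ℝ) (m : ℕ) : E d :=
  (1 / (m : ℝ)) • ∑ k ∈ Finset.range m, iterate Θ β α K z1 x y k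

/-- The two-stage estimator of the minimum value: the local polynomial estimator built on the
second half of the data, with `h = n^{-1/(2β+d)}` and `λ = n^{-β/(2β+d)}`, evaluated at the averaged
iterate built on the first half. -/
def minValueEstimator {d n : ℕ} (Θ : Set (E d)) (β α : ℝ) (K : E d → ℝ) (z1 : E d)
    (x : Fin n → E d) (y : Fin n → ℝ) : ℝ :=
  funEstimator (strictFloor β) K ((n : ℝ) ^ (-(1 / (2 * β + d)))) ((n : ℝ) ^ (-(β / (2 * β + d))))
    (lastObs n (n / 2)) x y (averagedIterate Θ β α K z1 x y (n / 2))

end PassiveDesign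

end

open PassiveDesign

/-!
Write `η = h ^ β = λ` and let `c_m = D^m f(z)`. The local polynomial estimator solves
`(B_s(z) + λ I) θ̂ = D_s(z)`, and inserting the Taylor expansion of `f` at `z` gives

  `(B_s(z) + λ I) (θ̂ - θ) = -λ θ + (average of Taylor remainders) + (average of noise)`,

where the averages are weighted by the kernel and `θ_m = h^|m| c_m`. The first two terms on the
right are of order `η`, so the error is governed by the noise average as soon as the quadratic form
of `B_s(z)` is bounded below (`sum_sq_localPolyCoeff_sub_le`).

The expectation of `B_s(z)` is bounded below by `p_min ∫ (vᵀ U)² K`, a positive definite form,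
because a polynomial vanishing on an open set is zero (`IsKernel.exists_coercive`). Up to the
factor `h^(-d)` its entries are averages of independent bounded variables of variance of order
`h^d`, so the probability that `B_s(z)` is far from its expectation is at most `exp (-c |s| h^d)`,
with `|s| h^d = Λ / η²` and `Λ ≥ 1 / 2`. This is smaller than every power of `h`, whereas on that
event the regularization still bounds the error by a power of `1 / h`. The noise average has
exponential moments at scale `η` because `E exp (|ξ| / σ) ≤ 2`. Everything is Lipschitz in `z` with
constants polynomial in `1 / h`, so suprema over `z ∈ T` may be replaced by sums over a net of
polynomial size, and each probability bound enters as the expectation of a sum of exponentials. The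
outcome (`exists_uniform_error_bound`) is an integrable majorant of the squared error over `T`, of
mean `O(η²)`, whenever the net has at most `C exp (a Λ)` points. For `T = Θ` this is the bandwidth
of the gradient descent, where `Λ = log (k + 1)`; for a single point it is the bandwidth of the
second stage, where `Λ = 1 / 2`.

At step `k` of the gradient descent the gradient estimate has mean squared error `O(η² / h²) =
O((log (k + 1) / k)^γ)`, `γ = 2 (β - 1) / (2 β + d)`, uniformly over `Θ`. The uniformity is
essential as the iterate depends on the same data. With steps `2 / (α k)` the distances to the
minimizer telescope with weights `k` (`value_average_sub_le`), and the averaged iterate satisfies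
`E [f z̄ - f*] = O(α⁻¹ (log n / n)^γ)`. The second stage is built on data independent of `z̄`, so
the pointwise bound applies at `z̄` (`meanLE_of_indepFun`) and its error is `O(n ^ (-β / (2 β +
d)))`. The sum of both errors is `exists_risk_bound`; since `n^(-γ) = n^(-β / (2 β + d)) n^(-(β -
2) / (2 β + d))`, a comparison of exponents finishes the proof.
-/

noncomputable section

namespace PassiveDesign

/-! ### Scaled monomials -/

lemma scaledMonomial_smul {d : ℕ} (m : Fin d → ℕ) (c : ℝ) (u : E d) :
    scaledMonomial m (c • u) = c ^ (∑ i, m i) * scaledMonomial m u := by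
  simp only [scaledMonomial, PiLp.smul_apply, smul_eq_mul, mul_pow, Finset.prod_mul_distrib,
    Finset.prod_pow_eq_pow_sum, mul_div_assoc]

lemma abs_scaledMonomial_le_one {d : ℕ} (m : Fin d → ℕ) {u : E d} (hu : ‖u‖ ≤ 1) :
    |scaledMonomial m u| ≤ 1 := by
  have hfac : (1 : ℝ) ≤ ∏ i, ((m i).factorial : ℝ) :=
    Finset.one_le_prod fun i _ => by exact_mod_cast Nat.one_le_of_lt (m i).factorial_pos
  rw [scaledMonomial, abs_div, abs_of_pos (lt_of_lt_of_le one_pos hfac),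
    div_le_one (lt_of_lt_of_le one_pos hfac)]
  refine le_trans ?_ hfac
  rw [Finset.abs_prod]
  refine Finset.prod_le_one (fun i _ => abs_nonneg _) fun i _ => ?_
  rw [abs_pow]
  exact pow_le_one₀ (abs_nonneg _) ((Real.norm_eq_abs (u i) ▸ PiLp.norm_apply_le u i).trans hu)

lemma contDiff_scaledMonomial {d : ℕ} (m : Fin d → ℕ) :
    ContDiff ℝ 1 (scaledMonomial m : E d → ℝ) := by
  unfold scaledMonomial
  refine ContDiff.div_const (contDiff_prod fun i _ => ?_) _
  exact ContDiff.pow (by fun_prop) _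

@[fun_prop]
lemma continuous_scaledMonomial {d : ℕ} (m : Fin d → ℕ) :
    Continuous (scaledMonomial m : E d → ℝ) :=
  (contDiff_scaledMonomial m).continuous

lemma scaledMonomial_zero_index {d : ℕ} (u : E d) :
    scaledMonomial (0 : Fin d → ℕ) u = 1 := by
  simp [scaledMonomial]

lemma scaledMonomial_at_zero {d : ℕ} {m : Fin d → ℕ} (hm : m ≠ 0) :
    scaledMonomial m (0 : E d) = 0 := by
  obtain ⟨i, hi⟩ := Function.ne_iff.mp hm
  rw [scaledMonomial, Finset.prod_eq_zero (Finset.mem_univ i), zero_div]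
  simpa using hi

lemma MultiIndex.entry_injective {d ℓ : ℕ} :
    Function.Injective (MultiIndex.entry : MultiIndex d ℓ → Fin d → ℕ) := by
  intro m m' h
  apply Subtype.ext
  funext i
  exact Fin.ext (congrFun h i)

lemma MultiIndex.exists_entry_eq {d ℓ : ℕ} {a : Fin d → ℕ} (ha : ∑ i, a i ≤ ℓ) :
    ∃ m : MultiIndex d ℓ, m.entry = a :=
  ⟨⟨fun i => ⟨a i, Nat.lt_succ_of_le
    ((Finset.single_le_sum (fun _ _ => Nat.zero_le _) (Finset.mem_univ i)).trans ha)⟩, ha⟩, rfl⟩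

/-- The multi-index `(0, …, 0)`. -/
def zeroIndex (d ℓ : ℕ) : MultiIndex d ℓ := ⟨fun _ => 0, by simp⟩

lemma entry_zeroIndex (d ℓ : ℕ) : (zeroIndex d ℓ).entry = 0 := by
  funext i; simp [zeroIndex, MultiIndex.entry]

/-- A polynomial of degree at most `ℓ` that vanishes on a nonempty open set has only zero
coefficients in the basis of scaled monomials. -/
lemma coeff_eq_zero_of_vanishing {d ℓ : ℕ} {O : Set (E d)} (hO : IsOpen O) (hne : O.Nonempty)
    (v : MultiIndex d ℓ → ℝ)
    (hv : ∀ u ∈ O, ∑ m, v m * scaledMonomial m.entry u = 0) : v = 0 := by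
  classical
  set p : MvPolynomial (Fin d) ℝ := ∑ m : MultiIndex d ℓ,
    MvPolynomial.monomial (Finsupp.equivFunOnFinite.symm m.entry)
      (v m / ∏ i, ((m.entry i).factorial : ℝ)) with hp
  have heval : ∀ u : E d, MvPolynomial.eval (fun i => u i) p
      = ∑ m, v m * scaledMonomial m.entry u := by
    intro u
    simp only [hp, map_sum, MvPolynomial.eval_monomial, scaledMonomial]
    refine Finset.sum_congr rfl fun m _ => ?_
    rw [Finsupp.prod_fintype _ _ (by simp)]
    simp only [Finsupp.equivFunOnFinite_symm_apply_apply]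
    ring
  obtain ⟨u0, hu0⟩ := hne
  -- a box around `u0` inside the open set
  have hO' : IsOpen ((WithLp.toLp 2 : (Fin d → ℝ) → E d) ⁻¹' O) :=
    hO.preimage (PiLp.continuous_toLp 2 _)
  have hmem : (fun i => u0 i) ∈ ((WithLp.toLp 2 : (Fin d → ℝ) → E d) ⁻¹' O) := by
    simpa using hu0
  obtain ⟨r, hr, hball⟩ := Metric.isOpen_iff.mp hO' _ hmem
  have hp0 : p = 0 := by
    refine MvPolynomial.funext_set (fun i => Set.Ioo (u0 i - r) (u0 i + r))
      (fun i => Set.Ioo_infinite (by linarith)) fun x hx => ?_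
    have hxO : WithLp.toLp 2 x ∈ O := by
      refine hball ?_
      rw [Metric.mem_ball, dist_pi_lt_iff hr]
      intro i
      have := hx i (Set.mem_univ i)
      rw [Real.dist_eq, abs_lt]
      constructor <;> linarith [this.1, this.2]
    have := heval (WithLp.toLp 2 x)
    rw [hv _ hxO] at this
    simpa using this
  funext m
  have hc := congrArg (MvPolynomial.coeff (Finsupp.equivFunOnFinite.symm m.entry)) hp0
  simp only [hp, MvPolynomial.coeff_sum, MvPolynomial.coeff_monomial, MvPolynomial.coeff_zero,
    Finsupp.equivFunOnFinite.symm.injective.eq_iff, MultiIndex.entry_injective.eq_iff,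
    Finset.sum_ite_eq', Finset.mem_univ, if_true] at hc
  rcases div_eq_zero_iff.mp hc with h | h
  · exact h
  · exact absurd h (Finset.prod_ne_zero_iff.mpr fun i _ => by
      exact_mod_cast (m.entry i).factorial_ne_zero)

/-! ### Kernel-weighted polynomials -/

lemma IsKernel.continuous {d : ℕ} {K : E d → ℝ} (hK : IsKernel K) : Continuous K := by
  obtain ⟨LK, h⟩ := hK.lipschitz
  exact h.continuous

lemma IsKernel.eq_zero {d : ℕ} {K : E d → ℝ} (hK : IsKernel K) {u : E d} (hu : 1 < ‖u‖) :
    K u = 0 := by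
  by_contra h
  have := hK.support_subset (subset_tsupport K h)
  simp at this
  linarith

lemma IsKernel.integrable {d : ℕ} {K : E d → ℝ} (hK : IsKernel K) : Integrable K :=
  hK.continuous.integrable_of_hasCompactSupport hK.compact_support

/-- The product of a `C¹` function with the kernel is Lipschitz on the whole space, even though the
function alone need not be, because the kernel vanishes off the unit ball. -/
lemma IsKernel.exists_lipschitz_mul {d : ℕ} {K : E d → ℝ} (hK : IsKernel K) {g : E d → ℝ}
    (hg : ContDiff ℝ 1 g) :
    ∃ A : ℝ, 0 ≤ A ∧ ∀ u v, |g u * K u - g v * K v| ≤ A * ‖u - v‖ := by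
  obtain ⟨LK, hLK⟩ := hK.lipschitz
  obtain ⟨Kb, hKb⟩ := hK.bounded
  have hKb' : ∀ u, |K u| ≤ Kb := fun u => by
    rw [abs_of_nonneg (hK.nonneg u)]; exact hKb ⟨u, rfl⟩
  have hc : IsCompact (Metric.closedBall (0 : E d) 1) := isCompact_closedBall 0 1
  obtain ⟨Lg, hLg⟩ := (hg.locallyLipschitz.locallyLipschitzOn).exists_lipschitzOnWith_of_compact hc
  obtain ⟨G, hG⟩ := hc.exists_bound_of_continuousOn hg.continuous.continuousOn
  have hG0 : 0 ≤ G := (norm_nonneg _).trans (hG 0 (by simp))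
  have hKb0 : 0 ≤ Kb := (abs_nonneg _).trans (hKb' 0)
  have hKl : ∀ u v, |K u - K v| ≤ LK * ‖u - v‖ := fun u v => by
    have := hLK.dist_le_mul u v
    rwa [Real.dist_eq, dist_eq_norm] at this
  have main : ∀ u v, ‖u‖ ≤ 1 → |g u * K u - g v * K v| ≤ (G * LK + Kb * Lg) * ‖u - v‖ := by
    intro u v hu
    have hgu : |g u| ≤ G := hG u (by simpa using hu)
    by_cases hv : ‖v‖ ≤ 1
    · have h1 : |g u - g v| ≤ Lg * ‖u - v‖ := by
        have := hLg.dist_le_mul u (by simpa using hu) v (by simpa using hv)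
        rwa [Real.dist_eq, dist_eq_norm] at this
      calc |g u * K u - g v * K v| = |g u * (K u - K v) + K v * (g u - g v)| := by ring_nf
        _ ≤ |g u * (K u - K v)| + |K v * (g u - g v)| := abs_add_le _ _
        _ = |g u| * |K u - K v| + |K v| * |g u - g v| := by rw [abs_mul, abs_mul]
        _ ≤ G * (LK * ‖u - v‖) + Kb * (Lg * ‖u - v‖) := by
            gcongr
            exacts [hKl u v, hKb' v]
        _ = _ := by ring
    · have hv0 : K v = 0 := hK.eq_zero (not_le.mp hv)
      calc |g u * K u - g v * K v| = |g u * (K u - K v)| := by rw [hv0]; ring_nf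
        _ = |g u| * |K u - K v| := abs_mul _ _
        _ ≤ G * (LK * ‖u - v‖) := by
            gcongr
            exact hKl u v
        _ ≤ (G * LK + Kb * Lg) * ‖u - v‖ := by
            have : 0 ≤ Kb * Lg * ‖u - v‖ := by positivity
            linarith
  refine ⟨G * LK + Kb * Lg, by positivity, fun u v => ?_⟩
  by_cases hu : ‖u‖ ≤ 1
  · exact main u v hu
  by_cases hv : ‖v‖ ≤ 1
  · rw [abs_sub_comm, norm_sub_rev]
    exact main v u hv
  rw [hK.eq_zero (not_le.mp hu), hK.eq_zero (not_le.mp hv)]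
  simp only [mul_zero, sub_zero, abs_zero]
  positivity

/-- The quadratic form `v ↦ ∫ (vᵀ U)² K` is positive definite: `K` is positive on a nonempty open
set, and the constant `c` is the minimum of the form on the unit sphere. -/
lemma IsKernel.exists_coercive {d : ℕ} {K : E d → ℝ} (hK : IsKernel K) (ℓ : ℕ) :
    ∃ c : ℝ, 0 < c ∧ ∀ v : MultiIndex d ℓ → ℝ,
      c * ∑ m, v m ^ 2 ≤ ∫ u, (∑ m, v m * scaledMonomial m.entry u) ^ 2 * K u := by
  classical
  set F : (MultiIndex d ℓ → ℝ) → ℝ :=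
    fun v => ∫ u, (∑ m, v m * scaledMonomial m.entry u) ^ 2 * K u with hF
  have hint : ∀ g : E d → ℝ, Continuous g → Integrable (fun u => g u * K u) := fun g hg =>
    (hg.mul hK.continuous).integrable_of_hasCompactSupport hK.compact_support.mul_left
  have hFsum : ∀ v, F v = ∑ m, ∑ m', v m * v m' *
      ∫ u, scaledMonomial m.entry u * scaledMonomial m'.entry u * K u := by
    intro v
    have h1 : ∀ u, (∑ m, v m * scaledMonomial m.entry u) ^ 2 * K u
        = ∑ m : MultiIndex d ℓ, ∑ m' : MultiIndex d ℓ, v m * v m' *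
          (scaledMonomial m.entry u * scaledMonomial m'.entry u * K u) := by
      intro u
      rw [sq, Finset.sum_mul_sum, Finset.sum_mul]
      refine Finset.sum_congr rfl fun m _ => ?_
      rw [Finset.sum_mul]
      exact Finset.sum_congr rfl fun m' _ => by ring
    have h2 : ∀ m m' : MultiIndex d ℓ, Integrable (fun u : E d => v m * v m' *
          (scaledMonomial m.entry u * scaledMonomial m'.entry u * K u)) := fun m m' =>
      (hint _ (by fun_prop)).const_mul _
    simp only [hF, h1]
    rw [integral_finsetSum _ fun m _ => integrable_finsetSum _ fun m' _ => h2 m m']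
    refine Finset.sum_congr rfl fun m _ => ?_
    rw [integral_finsetSum _ fun m' _ => h2 m m']
    exact Finset.sum_congr rfl fun m' _ => integral_const_mul _ _
  have hFcont : Continuous F := by
    have : F = fun v => ∑ m, ∑ m', v m * v m' *
      ∫ u, scaledMonomial m.entry u * scaledMonomial m'.entry u * K u := funext hFsum
    rw [this]
    fun_prop
  have hFhom : ∀ (a : ℝ) v, F (a • v) = a ^ 2 * F v := by
    intro a v
    rw [hFsum, hFsum, Finset.mul_sum]
    refine Finset.sum_congr rfl fun m _ => ?_
    rw [Finset.mul_sum]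
    refine Finset.sum_congr rfl fun m' _ => ?_
    simp only [Pi.smul_apply, smul_eq_mul]
    ring
  have hpos : ∀ v, v ≠ 0 → 0 < F v := by
    intro v hv
    have hnn : ∀ u, 0 ≤ (∑ m, v m * scaledMonomial m.entry u) ^ 2 * K u := fun u =>
      mul_nonneg (sq_nonneg _) (hK.nonneg u)
    have hcont : Continuous fun u => (∑ m, v m * scaledMonomial m.entry u) ^ 2 * K u :=
      (by fun_prop : Continuous fun u : E d => (∑ m, v m * scaledMonomial m.entry u) ^ 2).mul
        hK.continuous
    obtain ⟨u0, hu0⟩ : ∃ u, K u ≠ 0 := by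
      by_contra! h
      have := hK.integral_eq_one
      simp [h] at this
    have hopen : IsOpen {u | K u ≠ 0} := isOpen_ne_fun hK.continuous continuous_const
    obtain ⟨u1, hu1, hne⟩ : ∃ u ∈ {u | K u ≠ 0}, ∑ m, v m * scaledMonomial m.entry u ≠ 0 := by
      by_contra! h
      exact hv (coeff_eq_zero_of_vanishing hopen ⟨u0, hu0⟩ v h)
    exact hcont.integral_pos_of_hasCompactSupport_nonneg_nonzero hK.compact_support.mul_left hnn
      (mul_ne_zero (pow_ne_zero 2 hne) hu1)
  set Sph : Set (MultiIndex d ℓ → ℝ) := {v | ∑ m, v m ^ 2 = 1} with hSph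
  have hcomp : IsCompact Sph := by
    refine Metric.isCompact_of_isClosed_isBounded
      (isClosed_eq (by fun_prop) continuous_const) ?_
    refine (Metric.isBounded_closedBall (x := (0 : MultiIndex d ℓ → ℝ)) (r := 1)).subset
      fun v hv => ?_
    rw [mem_closedBall_zero_iff, pi_norm_le_iff_of_nonneg zero_le_one]
    intro m
    rw [Real.norm_eq_abs, ← sq_le_one_iff_abs_le_one, ← (show ∑ m, v m ^ 2 = 1 from hv)]
    exact Finset.single_le_sum (f := fun m => v m ^ 2) (fun _ _ => sq_nonneg _)
      (Finset.mem_univ m)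
  have hSne : Sph.Nonempty := ⟨Pi.single (zeroIndex d ℓ) 1, by
    simp only [hSph, Set.mem_ofPred_eq]
    rw [Finset.sum_eq_single (zeroIndex d ℓ)] <;> simp +contextual⟩
  obtain ⟨v0, hv0, hmin⟩ := hcomp.exists_isMinOn hSne hFcont.continuousOn
  have hv0ne : v0 ≠ 0 := by
    rintro rfl
    simp [hSph] at hv0
  refine ⟨F v0, hpos v0 hv0ne, fun v => ?_⟩
  change _ ≤ F v
  by_cases hv : v = 0
  · subst hv
    have h0 : F 0 = 0 := by rw [hFsum]; simp
    rw [h0]; simp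
  have hs : 0 < ∑ m, v m ^ 2 := by
    obtain ⟨m, hm⟩ := Function.ne_iff.mp hv
    exact Finset.sum_pos' (fun _ _ => sq_nonneg _) ⟨m, Finset.mem_univ m, by
      have : v m ≠ 0 := hm
      positivity⟩
  set a := (Real.sqrt (∑ m, v m ^ 2))⁻¹ with ha
  have ha2 : a ^ 2 = (∑ m, v m ^ 2)⁻¹ := by rw [ha, inv_pow, Real.sq_sqrt hs.le]
  have hmem : a • v ∈ Sph := by
    simp only [hSph, Set.mem_ofPred_eq, Pi.smul_apply, smul_eq_mul, mul_pow, ← Finset.mul_sum, ha2]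
    exact inv_mul_cancel₀ hs.ne'
  have h1 : F v0 ≤ F (a • v) := hmin hmem
  rw [hFhom, ha2, inv_mul_eq_div, le_div_iff₀ hs] at h1
  exact h1

/-! ### Deterministic error bounds -/

/-- The kernel average `(1 / (|s| h^d)) ∑_{i ∈ s} w_i g((x_i - z) / h)`. The entries of `B_s(z)` and
`D_s(z)` and the noise term of the estimator are all of this form. -/
def kernelAvg {d n : ℕ} (h : ℝ) (s : Finset (Fin n)) (x : Fin n → E d) (w : Fin n → ℝ)
    (g : E d → ℝ) (z : E d) : ℝ :=
  (1 / ((s.card : ℝ) * h ^ d)) * ∑ i ∈ s, w i * g (h⁻¹ • (x i - z))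

/-- The function `u ↦ u^m / m! K(u)`. -/
def weightedMonomial {d : ℕ} (K : E d → ℝ) (m : Fin d → ℕ) (u : E d) : ℝ :=
  scaledMonomial m u * K u

/-- The function `u ↦ (u^m / m!) (u^m' / m'!) K(u)`. -/
def weightedProduct {d : ℕ} (K : E d → ℝ) (m m' : Fin d → ℕ) (u : E d) : ℝ :=
  scaledMonomial m u * scaledMonomial m' u * K u

lemma gramMatrix_apply {d n ℓ : ℕ} (K : E d → ℝ) (h : ℝ) (s : Finset (Fin n)) (x : Fin n → E d)
    (z : E d) (m m' : MultiIndex d ℓ) :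
    gramMatrix ℓ K h s x z m m'
      = kernelAvg h s x (fun _ => 1) (weightedProduct K m.entry m'.entry) z := by
  simp only [gramMatrix, kernelAvg, Matrix.smul_apply, Matrix.sum_apply, Matrix.vecMulVec_apply,
    smul_eq_mul, monomialVec, weightedProduct]
  congr 1
  exact Finset.sum_congr rfl fun i _ => by ring

lemma responseVec_apply {d n ℓ : ℕ} (K : E d → ℝ) (h : ℝ) (s : Finset (Fin n)) (x : Fin n → E d)
    (y : Fin n → ℝ) (z : E d) (m : MultiIndex d ℓ) :
    responseVec ℓ K h s x y z m = kernelAvg h s x y (weightedMonomial K m.entry) z := by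
  simp only [responseVec, kernelAvg, Pi.smul_apply, Finset.sum_apply, smul_eq_mul, monomialVec,
    weightedMonomial]
  congr 1
  exact Finset.sum_congr rfl fun i _ => by ring

lemma sum_mul_kernelAvg {ι : Type*} {d n : ℕ} (h : ℝ) (s : Finset (Fin n)) (x : Fin n → E d)
    (w : Fin n → ℝ) (J : Finset ι) (a : ι → ℝ) (g : ι → E d → ℝ) (z : E d) :
    ∑ j ∈ J, a j * kernelAvg h s x w (g j) z
      = kernelAvg h s x w (fun u => ∑ j ∈ J, a j * g j u) z := by
  simp only [kernelAvg, Finset.mul_sum]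
  rw [Finset.sum_comm]
  exact Finset.sum_congr rfl fun i _ => Finset.sum_congr rfl fun j _ => by ring

lemma weightedProduct_zero {d : ℕ} (K : E d → ℝ) (u : E d) :
    weightedProduct K 0 0 u = K u := by
  simp [weightedProduct, scaledMonomial_zero_index]

lemma IsKernel.abs_weightedMonomial_le {d : ℕ} {K : E d → ℝ} (hK : IsKernel K) (m : Fin d → ℕ)
    (u : E d) : |weightedMonomial K m u| ≤ K u := by
  by_cases hu : ‖u‖ ≤ 1
  · rw [weightedMonomial, abs_mul, abs_of_nonneg (hK.nonneg u)]
    exact mul_le_of_le_one_left (hK.nonneg u) (abs_scaledMonomial_le_one m hu)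
  · simp [weightedMonomial, hK.eq_zero (not_le.mp hu)]

lemma IsKernel.abs_weightedProduct_le {d : ℕ} {K : E d → ℝ} (hK : IsKernel K) (m m' : Fin d → ℕ)
    (u : E d) : |weightedProduct K m m' u| ≤ K u := by
  by_cases hu : ‖u‖ ≤ 1
  · rw [weightedProduct, abs_mul, abs_mul, abs_of_nonneg (hK.nonneg u)]
    exact mul_le_of_le_one_left (hK.nonneg u) (mul_le_one₀ (abs_scaledMonomial_le_one m hu)
      (abs_nonneg _) (abs_scaledMonomial_le_one m' hu))
  · simp [weightedProduct, hK.eq_zero (not_le.mp hu)]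

/-- Lipschitz dependence of a kernel average on the evaluation point. -/
lemma abs_kernelAvg_sub_le {d n : ℕ} {h : ℝ} (hh : 0 < h) (s : Finset (Fin n)) (x : Fin n → E d)
    (w : Fin n → ℝ) {g : E d → ℝ} {A : ℝ} (hg : ∀ u v, |g u - g v| ≤ A * ‖u - v‖) (z z' : E d) :
    |kernelAvg h s x w g z - kernelAvg h s x w g z'|
      ≤ A * ‖z - z'‖ / h ^ (d + 1) * ((1 / (s.card : ℝ)) * ∑ i ∈ s, |w i|) := by
  rw [kernelAvg, kernelAvg, ← mul_sub, ← Finset.sum_sub_distrib, abs_mul,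
    abs_of_nonneg (by positivity)]
  have h1 : |∑ i ∈ s, (w i * g (h⁻¹ • (x i - z)) - w i * g (h⁻¹ • (x i - z')))|
      ≤ ∑ i ∈ s, |w i| * (A * (h⁻¹ * ‖z - z'‖)) := by
    refine (Finset.abs_sum_le_sum_abs _ _).trans (Finset.sum_le_sum fun i _ => ?_)
    rw [← mul_sub, abs_mul]
    refine mul_le_mul_of_nonneg_left ((hg _ _).trans_eq ?_) (abs_nonneg _)
    rw [← smul_sub, norm_smul, norm_inv, Real.norm_of_nonneg hh.le, sub_sub_sub_cancel_left,
      norm_sub_rev]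
  refine (mul_le_mul_of_nonneg_left h1 (by positivity)).trans_eq ?_
  rw [← Finset.sum_mul, pow_succ]
  rcases eq_or_ne (s.card : ℝ) 0 with h0 | h0
  · simp [h0]
  · field_simp

/-- A kernel average is at most the average weight times the maximum of the function over `h^d`. -/
lemma abs_kernelAvg_le {d n : ℕ} {h : ℝ} (hh : 0 < h) (s : Finset (Fin n)) (x : Fin n → E d)
    (w : Fin n → ℝ) {g : E d → ℝ} {A : ℝ} (hg : ∀ u, |g u| ≤ A) (z : E d) :
    |kernelAvg h s x w g z| ≤ A / h ^ d * ((1 / (s.card : ℝ)) * ∑ i ∈ s, |w i|) := by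
  rw [kernelAvg, abs_mul, abs_of_nonneg (by positivity)]
  have h1 : |∑ i ∈ s, w i * g (h⁻¹ • (x i - z))| ≤ ∑ i ∈ s, |w i| * A := by
    refine (Finset.abs_sum_le_sum_abs _ _).trans (Finset.sum_le_sum fun i _ => ?_)
    rw [abs_mul]
    exact mul_le_mul_of_nonneg_left (hg _) (abs_nonneg _)
  refine (mul_le_mul_of_nonneg_left h1 (by positivity)).trans_eq ?_
  rw [← Finset.sum_mul]
  rcases eq_or_ne (s.card : ℝ) 0 with h0 | h0
  · simp [h0]
  · field_simp

lemma gramMatrix_quadForm_nonneg {d n ℓ : ℕ} {K : E d → ℝ} (hK : IsKernel K) {h : ℝ} (hh : 0 < h)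
    (s : Finset (Fin n)) (x : Fin n → E d) (z : E d) (v : MultiIndex d ℓ → ℝ) :
    0 ≤ ∑ m, ∑ m', v m * v m' * gramMatrix ℓ K h s x z m m' := by
  have : ∑ m, ∑ m', v m * v m' * gramMatrix ℓ K h s x z m m'
      = kernelAvg h s x (fun _ => 1)
        (fun u => (∑ m, v m * scaledMonomial m.entry u) ^ 2 * K u) z := by
    simp only [gramMatrix_apply, sum_mul_kernelAvg]
    have h1 := sum_mul_kernelAvg h s x (fun _ => 1) Finset.univ (fun _ : MultiIndex d ℓ => (1 : ℝ))
      (fun m u => ∑ m', v m * v m' * weightedProduct K m.entry m'.entry u) z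
    simp only [one_mul] at h1
    rw [h1]
    congr 1
    funext u
    rw [sq, Finset.sum_mul_sum, Finset.sum_mul]
    refine Finset.sum_congr rfl fun m _ => ?_
    rw [Finset.sum_mul]
    exact Finset.sum_congr rfl fun m' _ => by rw [weightedProduct]; ring
  rw [this, kernelAvg]
  refine mul_nonneg (by positivity) (Finset.sum_nonneg fun i _ => ?_)
  rw [one_mul]
  exact mul_nonneg (sq_nonneg _) (hK.nonneg _)

/-- The basic error bound. The coefficients `h^|m| c_m` are those of the Taylor polynomial of `f` at
`z` in the rescaled variable; `lamstar` is any lower bound for the quadratic form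
of `B_s(z) + λ I`, with `λ = h^β`. The three terms on the right come from the regularization, the
Taylor remainder and the noise. -/
lemma sum_sq_localPolyCoeff_sub_le {d n ℓ : ℕ} {K : E d → ℝ} (hK : IsKernel K) {β L h lamstar : ℝ}
    (hβ : 0 < β) (hL : 0 ≤ L) (hh : 0 < h) (hh1 : h ≤ 1) (hlam : 0 < lamstar)
    (s : Finset (Fin n)) (x : Fin n → E d) (y ξ : Fin n → ℝ) {f : E d → ℝ} (z : E d)
    (c : MultiIndex d ℓ → ℝ)
    (hy : ∀ i, y i = f (x i) + ξ i)
    (hf : ∀ x', |f x' - ∑ m, c m * scaledMonomial m.entry (x' - z)| ≤ L * ‖x' - z‖ ^ β)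
    (hco : ∀ v : MultiIndex d ℓ → ℝ, lamstar * ∑ m, v m ^ 2 ≤
      ∑ m, ∑ m', v m * v m' * gramMatrix ℓ K h s x z m m' + h ^ β * ∑ m, v m ^ 2) :
    ∑ m, (localPolyCoeff ℓ K h (h ^ β) s x y z m - h ^ (∑ i, m.entry i) * c m) ^ 2
      ≤ 3 / lamstar ^ 2 * ((h ^ β) ^ 2 * ∑ m, c m ^ 2
        + Fintype.card (MultiIndex d ℓ) *
            (L * h ^ β * kernelAvg h s x (fun _ => 1) K z) ^ 2
        + ∑ m : MultiIndex d ℓ, kernelAvg h s x ξ (weightedMonomial K m.entry) z ^ 2) := by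
  classical
  set η := h ^ β with hη
  have hη0 : 0 < η := Real.rpow_pos_of_pos hh β
  set B := gramMatrix ℓ K h s x z with hB
  set A : Matrix (MultiIndex d ℓ) (MultiIndex d ℓ) ℝ := B + η • (1 : Matrix _ _ ℝ) with hA
  set D := responseVec ℓ K h s x y z with hD
  set th : MultiIndex d ℓ → ℝ := fun m => h ^ (∑ i, m.entry i) * c m with hth
  set that := localPolyCoeff ℓ K h η s x y z with hthat
  have hAv : ∀ v m, (A.mulVec v) m = ∑ m', B m m' * v m' + η * v m := by
    intro v m
    rw [hA, Matrix.add_mulVec, Matrix.smul_mulVec, Matrix.one_mulVec]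
    rfl
  have hquad : ∀ v, lamstar * ∑ m, v m ^ 2 ≤ ∑ m, v m * (A.mulVec v) m := by
    intro v
    refine (hco v).trans_eq ?_
    simp only [hAv, mul_add, Finset.sum_add_distrib, Finset.mul_sum]
    congr 1
    · exact Finset.sum_congr rfl fun m _ => Finset.sum_congr rfl fun m' _ => by ring
    · exact Finset.sum_congr rfl fun m _ => by ring
  have hdet : IsUnit A.det := by
    rw [isUnit_iff_ne_zero]
    intro h0
    obtain ⟨v, hv, hv0⟩ := Matrix.exists_mulVec_eq_zero_iff.mpr h0
    have h1 := hquad v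
    rw [hv0] at h1
    simp only [Pi.zero_apply, mul_zero, Finset.sum_const_zero] at h1
    have h2 : ∑ m, v m ^ 2 = 0 :=
      le_antisymm (nonpos_of_mul_nonpos_right h1 hlam) (Finset.sum_nonneg fun _ _ => sq_nonneg _)
    rw [Finset.sum_eq_zero_iff_of_nonneg fun _ _ => sq_nonneg _] at h2
    exact hv (funext fun m => by simpa using h2 m (Finset.mem_univ m))
  have hsol : A.mulVec that = D := by
    rw [hthat, localPolyCoeff, Matrix.mulVec_mulVec, ← hB, ← hA, Matrix.mul_nonsing_inv _ hdet,
      Matrix.one_mulVec]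
  -- the Taylor remainders
  set R : Fin n → ℝ := fun i => f (x i) - ∑ m, c m * scaledMonomial m.entry (x i - z) with hR
  set rem : MultiIndex d ℓ → ℝ := fun m => kernelAvg h s x R (weightedMonomial K m.entry) z
    with hrem
  set noi : MultiIndex d ℓ → ℝ := fun m => kernelAvg h s x ξ (weightedMonomial K m.entry) z
    with hnoi
  have hDB : ∀ m, D m = ∑ m', B m m' * th m' + rem m + noi m := by
    intro m
    have hpoly : ∀ i, ∑ m', c m' * scaledMonomial m'.entry (x i - z)
        = ∑ m', scaledMonomial m'.entry (h⁻¹ • (x i - z)) * th m' := by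
      intro i
      refine Finset.sum_congr rfl fun m' _ => ?_
      conv_lhs => rw [← smul_inv_smul₀ hh.ne' (x i - z), scaledMonomial_smul]
      simp only [hth]
      ring
    rw [hD, responseVec_apply]
    have hBth : ∑ m', B m m' * th m' = kernelAvg h s x (fun _ => 1)
        (fun u => ∑ m', th m' * weightedProduct K m.entry m'.entry u) z := by
      rw [← sum_mul_kernelAvg]
      exact Finset.sum_congr rfl fun m' _ => by rw [hB, gramMatrix_apply, mul_comm]
    rw [hBth]
    simp only [hrem, hnoi, kernelAvg, hR, hy, hpoly]
    rw [← mul_add, ← mul_add, ← Finset.sum_add_distrib, ← Finset.sum_add_distrib]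
    congr 1
    refine Finset.sum_congr rfl fun i _ => ?_
    have : ∑ m', th m' * weightedProduct K m.entry m'.entry (h⁻¹ • (x i - z))
        = (∑ m', scaledMonomial m'.entry (h⁻¹ • (x i - z)) * th m')
          * weightedMonomial K m.entry (h⁻¹ • (x i - z)) := by
      rw [Finset.sum_mul]
      exact Finset.sum_congr rfl fun m' _ => by rw [weightedProduct, weightedMonomial]; ring
    rw [this]
    ring
  set q : MultiIndex d ℓ → ℝ := fun m => rem m + noi m - η * th m with hq
  set w : MultiIndex d ℓ → ℝ := fun m => that m - th m with hw
  have hAw : A.mulVec w = q := by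
    have : w = that - th := rfl
    rw [this, Matrix.mulVec_sub, hsol]
    funext m
    simp only [Pi.sub_apply, hAv, hDB, hq]
    ring
  have hwq : lamstar ^ 2 * ∑ m, w m ^ 2 ≤ ∑ m, q m ^ 2 := by
    have h1 := hquad w
    rw [hAw] at h1
    have h2 : lamstar * (2 * ∑ m, w m * q m) ≤ lamstar ^ 2 * ∑ m, w m ^ 2 + ∑ m, q m ^ 2 := by
      rw [Finset.mul_sum, Finset.mul_sum, Finset.mul_sum, ← Finset.sum_add_distrib]
      refine Finset.sum_le_sum fun m _ => ?_
      nlinarith [sq_nonneg (lamstar * w m - q m)]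
    nlinarith
  have hremle : ∀ m, |rem m| ≤ L * η * kernelAvg h s x (fun _ => 1) K z := by
    intro m
    simp only [hrem, kernelAvg]
    rw [abs_mul, abs_of_nonneg (by positivity), mul_left_comm]
    refine mul_le_mul_of_nonneg_left ?_ (by positivity)
    rw [Finset.mul_sum]
    refine (Finset.abs_sum_le_sum_abs _ _).trans (Finset.sum_le_sum fun i _ => ?_)
    rw [abs_mul, one_mul]
    by_cases hu : ‖h⁻¹ • (x i - z)‖ ≤ 1
    · have hnorm : ‖x i - z‖ ≤ h := by
        rwa [norm_smul, norm_inv, Real.norm_of_nonneg hh.le, inv_mul_le_iff₀ hh, mul_one] at hu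
      refine mul_le_mul ((hf (x i)).trans ?_) (hK.abs_weightedMonomial_le _ _) (abs_nonneg _)
        (by positivity)
      exact mul_le_mul_of_nonneg_left (Real.rpow_le_rpow (norm_nonneg _) hnorm hβ.le) hL
    · simp [weightedMonomial, hK.eq_zero (not_le.mp hu)]
  have hqle : ∑ m, q m ^ 2 ≤ 3 * (η ^ 2 * ∑ m, c m ^ 2
        + Fintype.card (MultiIndex d ℓ) * (L * η * kernelAvg h s x (fun _ => 1) K z) ^ 2
        + ∑ m, noi m ^ 2) := by
    have hcard : (Fintype.card (MultiIndex d ℓ) : ℝ)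
          * (L * η * kernelAvg h s x (fun _ => 1) K z) ^ 2
        = ∑ _m : MultiIndex d ℓ, (L * η * kernelAvg h s x (fun _ => 1) K z) ^ 2 := by
      rw [Finset.sum_const, Finset.card_univ, nsmul_eq_mul]
    rw [hcard, Finset.mul_sum, ← Finset.sum_add_distrib, ← Finset.sum_add_distrib, Finset.mul_sum]
    refine Finset.sum_le_sum fun m _ => ?_
    have h1 : rem m ^ 2 ≤ (L * η * kernelAvg h s x (fun _ => 1) K z) ^ 2 :=
      sq_le_sq.mpr ((hremle m).trans (le_abs_self _))
    have h2 : th m ^ 2 ≤ c m ^ 2 := by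
      simp only [hth, mul_pow]
      exact mul_le_of_le_one_left (sq_nonneg _) (pow_le_one₀ (by positivity)
        (pow_le_one₀ hh.le hh1))
    have h3 : η ^ 2 * th m ^ 2 ≤ η ^ 2 * c m ^ 2 := mul_le_mul_of_nonneg_left h2 (sq_nonneg _)
    have h4 : q m ^ 2 ≤ 3 * (η ^ 2 * th m ^ 2 + rem m ^ 2 + noi m ^ 2) := by
      simp only [hq]
      nlinarith [sq_nonneg (rem m - noi m), sq_nonneg (rem m + η * th m),
        sq_nonneg (noi m + η * th m)]
    linarith
  rw [div_mul_eq_mul_div, le_div_iff₀ (by positivity), mul_comm]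
  exact hwq.trans hqle

/-- An entrywise perturbation of a coercive matrix is coercive; symmetry is not needed. -/
lemma quadForm_perturbation {ι : Type*} [Fintype ι] {B G : ι → ι → ℝ} {c ε : ℝ}
    (hG : ∀ v : ι → ℝ, c * ∑ m, v m ^ 2 ≤ ∑ m, ∑ m', v m * v m' * G m m')
    (hBG : ∀ m m', |B m m' - G m m'| ≤ ε) (hε : ε * Fintype.card ι ≤ c / 2) (v : ι → ℝ) :
    c / 2 * ∑ m, v m ^ 2 ≤ ∑ m, ∑ m', v m * v m' * B m m' := by
  have h1 : ∑ m, ∑ m', v m * v m' * G m m' - ∑ m, ∑ m', v m * v m' * B m m'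
      ≤ ∑ m, ∑ m' : ι, ε * ((v m ^ 2 + v m' ^ 2) / 2) := by
    rw [← Finset.sum_sub_distrib]
    refine Finset.sum_le_sum fun m _ => ?_
    rw [← Finset.sum_sub_distrib]
    refine Finset.sum_le_sum fun m' _ => ?_
    have hε0 : 0 ≤ ε := (abs_nonneg _).trans (hBG m m')
    have h2 : |v m * v m' * (B m m' - G m m')| ≤ (v m ^ 2 + v m' ^ 2) / 2 * ε := by
      rw [abs_mul]
      refine mul_le_mul ?_ (hBG m m') (abs_nonneg _) (by positivity)
      rw [abs_le]
      constructor <;> nlinarith [sq_nonneg (v m - v m'), sq_nonneg (v m + v m')]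
    have h3 := (abs_le.mp h2).1
    nlinarith
  have h2 : ∑ m, ∑ m' : ι, ε * ((v m ^ 2 + v m' ^ 2) / 2)
      = ε * Fintype.card ι * ∑ m, v m ^ 2 := by
    simp only [← Finset.mul_sum, ← Finset.sum_div, Finset.sum_add_distrib, Finset.sum_const,
      Finset.card_univ, nsmul_eq_mul]
    ring
  have h3 : ε * Fintype.card ι * ∑ m, v m ^ 2 ≤ c / 2 * ∑ m, v m ^ 2 :=
    mul_le_mul_of_nonneg_right hε (Finset.sum_nonneg fun _ _ => sq_nonneg _)
  have := hG v
  linarith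

/-! ### Taylor coefficients -/

lemma mixedPartial_zero {d : ℕ} (f : E d → ℝ) : mixedPartial (0 : Fin d → ℕ) f = f := by
  have : ∀ l : List (Fin d),
      l.foldr (fun i g => (partialDeriv i)^[(0 : Fin d → ℕ) i] g) f = f := by
    intro l
    induction l with
    | nil => rfl
    | cons a l ih => rw [List.foldr_cons, ih]; rfl
  exact this _

lemma mixedPartial_single {d : ℕ} (j : Fin d) (f : E d → ℝ) :
    mixedPartial (Pi.single j 1) f = partialDeriv j f := by
  have key : ∀ l : List (Fin d), l.Nodup →
      l.foldr (fun i g => (partialDeriv i)^[(Pi.single j 1 : Fin d → ℕ) i] g) f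
        = if j ∈ l then partialDeriv j f else f := by
    intro l hl
    induction l with
    | nil => simp
    | cons a l ih =>
      rw [List.nodup_cons] at hl
      rw [List.foldr_cons, ih hl.2]
      by_cases h : a = j
      · subst h
        simp [hl.1]
      · simp [h, Ne.symm h]
  rw [mixedPartial, key _ (List.nodup_finRange d)]
  simp

lemma one_le_strictFloor {β : ℝ} (hβ : 2 ≤ β) : 1 ≤ strictFloor β := by
  have : 2 ≤ ⌈β⌉₊ := by
    have h : (2 : ℝ) ≤ (⌈β⌉₊ : ℝ) := hβ.trans (Nat.le_ceil β)
    exact_mod_cast h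
  unfold strictFloor
  omega

lemma HolderClass.differentiable_fun {d : ℕ} {β L : ℝ} {f : E d → ℝ} (hf : HolderClass β L f)
    (hβ : 2 ≤ β) : Differentiable ℝ f := by
  have h := hf.differentiable 0 (one_le_strictFloor hβ)
  rwa [iteratedFDeriv_zero_eq_comp, LinearIsometryEquiv.comp_differentiable_iff] at h

lemma partialDeriv_eq_gradient {d : ℕ} {f : E d → ℝ} {z : E d} (hf : DifferentiableAt ℝ f z)
    (j : Fin d) : partialDeriv j f z = (∇ f z) j := by
  rw [partialDeriv, hf.lineDeriv_eq_fderiv, ← inner_gradient_left,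
    EuclideanSpace.inner_single_right]
  simp

/-- Taylor coefficients of a bounded function in the Hölder class are bounded: the Taylor polynomial
is bounded by `M + L` on the unit ball, which controls the coefficients by coercivity. -/
lemma sum_sq_mixedPartial_le {d : ℕ} {β L M c0 : ℝ} (hβ : 2 ≤ β) (hL : 0 < L) {Θ : Set (E d)}
    {K : E d → ℝ} (hK : IsKernel K)
    (hc0 : ∀ v : MultiIndex d (strictFloor β) → ℝ,
      c0 * ∑ m, v m ^ 2 ≤ ∫ u, (∑ m, v m * scaledMonomial m.entry u) ^ 2 * K u)
    {f : E d → ℝ} (hf : HolderClass β L f) (hM : ∀ x ∈ enlarge Θ, |f x| ≤ M) {z : E d}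
    (hz : z ∈ Θ) :
    c0 * ∑ m : MultiIndex d (strictFloor β), mixedPartial m.entry f z ^ 2 ≤ (M + L) ^ 2 := by
  refine (hc0 fun m => mixedPartial m.entry f z).trans ?_
  have hML : 0 ≤ M := (abs_nonneg _).trans (hM z ⟨z, hz, 0, by simp, by simp⟩)
  have hle : ∀ u, (∑ m : MultiIndex d (strictFloor β),
      mixedPartial m.entry f z * scaledMonomial m.entry u) ^ 2 * K u ≤ (M + L) ^ 2 * K u := by
    intro u
    by_cases hu : ‖u‖ ≤ 1
    · refine mul_le_mul_of_nonneg_right (sq_le_sq.mpr ?_) (hK.nonneg u)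
      have h1 := hf.taylor z (z + u)
      rw [add_sub_cancel_left] at h1
      have h2 := hM (z + u) ⟨z, hz, u, hu, rfl⟩
      have h3 : L * ‖u‖ ^ β ≤ L := mul_le_of_le_one_right hL.le
        (Real.rpow_le_one (norm_nonneg _) hu (by linarith))
      rw [abs_of_nonneg (by linarith : 0 ≤ M + L), abs_le]
      rw [abs_le] at h1 h2
      constructor <;> linarith [h1.1, h1.2, h2.1, h2.2]
    · simp [hK.eq_zero (not_le.mp hu)]
  refine (integral_mono_of_nonneg (Filter.Eventually.of_forall fun u =>
    mul_nonneg (sq_nonneg _) (hK.nonneg u)) (hK.integrable.const_mul _)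
    (Filter.Eventually.of_forall hle)).trans_eq ?_
  rw [integral_const_mul, hK.integral_eq_one, mul_one]

/-! ### Bounds on expectations -/

/-- `F` is integrable with expectation at most `c`. -/
structure MeanLE {Ω : Type*} [MeasurableSpace Ω] (μ : Measure Ω) (F : Ω → ℝ) (c : ℝ) : Prop where
  integrable : Integrable F μ
  integral_le : ∫ ω, F ω ∂μ ≤ c

namespace MeanLE

variable {Ω : Type*} [MeasurableSpace Ω] {μ : Measure Ω} {F G : Ω → ℝ} {a c c' : ℝ}

lemma mono (h : MeanLE μ F c) (hc : c ≤ c') : MeanLE μ F c' := ⟨h.1, h.2.trans hc⟩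

lemma add (hF : MeanLE μ F c) (hG : MeanLE μ G c') : MeanLE μ (fun ω => F ω + G ω) (c + c') :=
  ⟨hF.1.add hG.1, by rw [integral_add hF.1 hG.1]; exact add_le_add hF.2 hG.2⟩

lemma const_mul (hF : MeanLE μ F c) (ha : 0 ≤ a) : MeanLE μ (fun ω => a * F ω) (a * c) :=
  ⟨hF.1.const_mul a, by rw [integral_const_mul]; exact mul_le_mul_of_nonneg_left hF.2 ha⟩

lemma const [IsProbabilityMeasure μ] (c : ℝ) : MeanLE μ (fun _ => c) c :=
  ⟨integrable_const c, by simp⟩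

lemma sum {ι : Type*} {s : Finset ι} {F : ι → Ω → ℝ} {c : ι → ℝ}
    (h : ∀ i ∈ s, MeanLE μ (F i) (c i)) : MeanLE μ (fun ω => ∑ i ∈ s, F i ω) (∑ i ∈ s, c i) :=
  ⟨integrable_finsetSum _ fun i hi => (h i hi).1, by
    rw [integral_finsetSum _ fun i hi => (h i hi).1]
    exact Finset.sum_le_sum fun i hi => (h i hi).2⟩

lemma of_le (hG : MeanLE μ G c) (hF : Measurable F) (h0 : ∀ ω, 0 ≤ F ω) (hle : ∀ ω, F ω ≤ G ω) :
    MeanLE μ F c := by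
  have hi : Integrable F μ := hG.1.mono' hF.aestronglyMeasurable
    (Filter.Eventually.of_forall fun ω => by rw [Real.norm_of_nonneg (h0 ω)]; exact hle ω)
  exact ⟨hi, (integral_mono hi hG.1 hle).trans hG.2⟩

end MeanLE

lemma exp_le_one_add_add_sq_mul_exp (u : ℝ) :
    Real.exp u ≤ 1 + u + u ^ 2 * Real.exp |u| := by
  have h := Complex.norm_exp_sub_sum_le_norm_mul_exp (u : ℂ) 2
  simp only [Finset.sum_range_succ, Finset.sum_range_zero, zero_add, pow_zero, pow_one,
    Nat.factorial_zero, Nat.factorial_one, Nat.cast_one, div_one] at h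
  rw [← Complex.ofReal_exp, ← Complex.ofReal_one, ← Complex.ofReal_add, ← Complex.ofReal_sub,
    Complex.norm_real, Complex.norm_real, Real.norm_eq_abs, Real.norm_eq_abs, sq_abs] at h
  linarith [le_abs_self (Real.exp u - (1 + u))]

/-- A moment generating function bound for a centred variable, from
`exp u ≤ 1 + u + u² exp |u|`. -/
lemma meanLE_exp_mul {Ω : Type*} [MeasurableSpace Ω] {μ : Measure Ω} [IsProbabilityMeasure μ]
    {V : Ω → ℝ} {t v : ℝ} (hV : Measurable V) (hi : Integrable V μ) (h0 : ∫ ω, V ω ∂μ = 0)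
    (hv : MeanLE μ (fun ω => V ω ^ 2 * Real.exp |t * V ω|) v) :
    MeanLE μ (fun ω => Real.exp (t * V ω)) (Real.exp (t ^ 2 * v)) := by
  have h1 : MeanLE μ (fun ω => t * V ω) 0 :=
    ⟨hi.const_mul t, by rw [integral_const_mul, h0, mul_zero]⟩
  refine ((((MeanLE.const 1).add h1).add (hv.const_mul (sq_nonneg t))).of_le (by fun_prop)
    (fun ω => (Real.exp_pos _).le) fun ω => ?_).mono ?_
  · have := exp_le_one_add_add_sq_mul_exp (t * V ω)
    rwa [mul_pow, mul_assoc] at this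
  · linarith [Real.add_one_le_exp (t ^ 2 * v)]

lemma meanLE_exp_mul_sum {Ω : Type*} [MeasurableSpace Ω] {μ : Measure Ω} [IsProbabilityMeasure μ]
    {n : ℕ} {V : Fin n → Ω → ℝ} {t v : ℝ} (hind : iIndepFun V μ) (hV : ∀ i, Measurable (V i))
    (h : ∀ i, MeanLE μ (fun ω => Real.exp (t * V i ω)) (Real.exp (t ^ 2 * v)))
    (s : Finset (Fin n)) :
    MeanLE μ (fun ω => Real.exp (t * ∑ i ∈ s, V i ω)) (Real.exp (t ^ 2 * (s.card * v))) := by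
  have hi := hind.integrable_exp_mul_sum hV (s := s) fun i _ => (h i).1
  have hs := hind.mgf_sum (t := t) hV s
  simp only [mgf, Finset.sum_apply] at hi hs
  refine ⟨hi, hs.trans_le ?_⟩
  refine (Finset.prod_le_prod (fun i _ => integral_nonneg fun ω => (Real.exp_pos _).le)
    fun i _ => (h i).2).trans_eq ?_
  rw [Finset.prod_const, ← Real.exp_nat_mul]
  ring_nf

/-! ### The design and the noise -/

/-- The observations `(X_i, ξ_i)` are independent. -/
lemma iIndepFun_prodMk_of_indepFun {Ω α γ : Type*} [MeasurableSpace Ω] [MeasurableSpace α]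
    [MeasurableSpace γ] {μ : Measure Ω} [IsProbabilityMeasure μ] {n : ℕ} {X : Fin n → Ω → α}
    {ξ : Fin n → Ω → γ} (hX : ∀ i, Measurable (X i)) (hξ : ∀ i, Measurable (ξ i))
    (hXi : iIndepFun X μ) (hξi : iIndepFun ξ μ)
    (hind : IndepFun (fun ω i => ξ i ω) (fun ω i => X i ω) μ) :
    iIndepFun (fun i ω => (X i ω, ξ i ω)) μ := by
  have hprobX : ∀ i, IsProbabilityMeasure (μ.map (X i)) :=
    fun i => Measure.isProbabilityMeasure_map (hX i).aemeasurable
  have hprobξ : ∀ i, IsProbabilityMeasure (μ.map (ξ i)) :=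
    fun i => Measure.isProbabilityMeasure_map (hξ i).aemeasurable
  have hXm : Measurable fun ω i => X i ω := measurable_pi_lambda _ hX
  have hξm : Measurable fun ω i => ξ i ω := measurable_pi_lambda _ hξ
  have hi1 : ∀ i, IndepFun (X i) (ξ i) μ := fun i =>
    (hind.comp (measurable_pi_apply i) (measurable_pi_apply i)).symm
  rw [iIndepFun_iff_map_fun_eq_pi_map fun i => ((hX i).prodMk (hξ i)).aemeasurable]
  have hj : μ.map (fun ω => ((fun i => X i ω), (fun i => ξ i ω)))
      = (Measure.pi fun i => μ.map (X i)).prod (Measure.pi fun i => μ.map (ξ i)) := by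
    rw [(indepFun_iff_map_prod_eq_prod_map_map hXm.aemeasurable hξm.aemeasurable).mp hind.symm,
      hXi.map_fun_eq_pi_map fun i => (hX i).aemeasurable,
      hξi.map_fun_eq_pi_map fun i => (hξ i).aemeasurable]
  have hmp := measurePreserving_arrowProdEquivProdArrow α γ (Fin n)
    (fun i => μ.map (X i)) (fun i => μ.map (ξ i))
  have hp : (fun i => μ.map fun ω => (X i ω, ξ i ω))
      = fun i => (μ.map (X i)).prod (μ.map (ξ i)) := funext fun i =>
    (indepFun_iff_map_prod_eq_prod_map_map (hX i).aemeasurable (hξ i).aemeasurable).mp (hi1 i)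
  rw [hp, ← (hmp.symm).map_eq, ← hj, Measure.map_map (MeasurableEquiv.measurable _)
    (hXm.prodMk hξm)]
  rfl

lemma integral_scaled {d : ℕ} {h : ℝ} (hh : 0 < h) (z : E d) (g : E d → ℝ) :
    ∫ x, g (h⁻¹ • (x - z)) = h ^ d * ∫ u, g u := by
  rw [integral_sub_right_eq_self (fun x => g (h⁻¹ • x)) z, Measure.integral_comp_smul]
  simp [abs_of_pos hh]

/-- Expectations of localized nonnegative functions of a design point, of size `h^d`. -/
lemma IsDesign.integral_bounds {d n : ℕ} {Ω : Type*} [MeasurableSpace Ω] {μ : Measure Ω}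
    [IsProbabilityMeasure μ] {Θ : Set (E d)} {pmin pmax : ℝ} {X : Fin n → Ω → E d}
    (hX : IsDesign μ Θ pmin pmax X) {h : ℝ} (hh : 0 < h) (hh1 : h ≤ 1) {z : E d} (hz : z ∈ Θ)
    {g : E d → ℝ} (hg : Continuous g) (hgc : HasCompactSupport g) (hg0 : ∀ u, 0 ≤ g u)
    (hsupp : ∀ u, 1 < ‖u‖ → g u = 0) (i : Fin n) :
    pmin * (h ^ d * ∫ u, g u) ≤ ∫ ω, g (h⁻¹ • (X i ω - z)) ∂μ ∧
      ∫ ω, g (h⁻¹ • (X i ω - z)) ∂μ ≤ pmax * (h ^ d * ∫ u, g u) := by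
  obtain ⟨p, hpm, hp0, hlaw, hp⟩ := hX.density
  have hcont : Continuous fun x : E d => g (h⁻¹ • (x - z)) := by fun_prop
  have h1 : ∫ ω, g (h⁻¹ • (X i ω - z)) ∂μ = ∫ x, p x * g (h⁻¹ • (x - z)) := by
    rw [← integral_map (hX.measurable i).aemeasurable
      (f := fun x => g (h⁻¹ • (x - z))) hcont.aestronglyMeasurable, hlaw i,
      integral_withDensity_eq_integral_toReal_smul hpm.ennreal_ofReal
        (Filter.Eventually.of_forall fun x => ENNReal.ofReal_lt_top)]
    simp only [ENNReal.toReal_ofReal (hp0 _), smul_eq_mul]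
  have hcs : HasCompactSupport fun x : E d => g (h⁻¹ • (x - z)) := by
    have := hgc.comp_homeomorph ((Homeomorph.subRight z).trans
      (Homeomorph.smulOfNeZero h⁻¹ (inv_ne_zero hh.ne')))
    exact this
  have hint : Integrable fun x : E d => g (h⁻¹ • (x - z)) :=
    hcont.integrable_of_hasCompactSupport hcs
  have hle : ∀ x, pmin * g (h⁻¹ • (x - z)) ≤ p x * g (h⁻¹ • (x - z)) ∧
      p x * g (h⁻¹ • (x - z)) ≤ pmax * g (h⁻¹ • (x - z)) := by
    intro x
    by_cases hu : ‖h⁻¹ • (x - z)‖ ≤ 1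
    · have hnorm : ‖x - z‖ ≤ 1 := by
        rw [norm_smul, norm_inv, Real.norm_of_nonneg hh.le, inv_mul_le_iff₀ hh, mul_one] at hu
        exact hu.trans hh1
      have := hp x ⟨z, hz, x - z, hnorm, by simp⟩
      exact ⟨mul_le_mul_of_nonneg_right this.1 (hg0 _),
        mul_le_mul_of_nonneg_right this.2 (hg0 _)⟩
    · simp [hsupp _ (not_le.mp hu)]
  have hpint : Integrable fun x : E d => p x * g (h⁻¹ • (x - z)) :=
    (hint.const_mul pmax).mono' (hpm.mul hcont.measurable).aestronglyMeasurable
      (Filter.Eventually.of_forall fun x => by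
        rw [Real.norm_of_nonneg (mul_nonneg (hp0 x) (hg0 _))]; exact (hle x).2)
  rw [h1, ← integral_scaled hh z, ← integral_const_mul, ← integral_const_mul]
  exact ⟨integral_mono (hint.const_mul _) hpint fun x => (hle x).1,
    integral_mono hpint (hint.const_mul _) fun x => (hle x).2⟩

/-! ### The error near a net point -/

/-- Average of the squared noise. -/
def noiseMeanSq {n : ℕ} (s : Finset (Fin n)) (ξ : Fin n → ℝ) : ℝ :=
  (1 / (s.card : ℝ)) * ∑ i ∈ s, ξ i ^ 2

lemma noiseMeanSq_nonneg {n : ℕ} (s : Finset (Fin n)) (ξ : Fin n → ℝ) : 0 ≤ noiseMeanSq s ξ :=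
  mul_nonneg (by positivity) (Finset.sum_nonneg fun _ _ => sq_nonneg _)

lemma sq_mean_abs_le_noiseMeanSq {n : ℕ} (s : Finset (Fin n)) (ξ : Fin n → ℝ) :
    ((1 / (s.card : ℝ)) * ∑ i ∈ s, |ξ i|) ^ 2 ≤ noiseMeanSq s ξ := by
  have h := sq_sum_le_card_mul_sum_sq (s := s) (f := fun i => |ξ i|)
  simp only [sq_abs] at h
  rw [noiseMeanSq, mul_pow]
  rcases eq_or_ne (s.card : ℝ) 0 with h0 | h0
  · simp [h0]
  · refine (mul_le_mul_of_nonneg_left h (by positivity)).trans_eq ?_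
    field_simp

lemma continuous_weightedMonomial {d : ℕ} {K : E d → ℝ} (hK : IsKernel K) (m : Fin d → ℕ) :
    Continuous (weightedMonomial K m) :=
  (continuous_scaledMonomial m).mul hK.continuous

lemma continuous_weightedProduct {d : ℕ} {K : E d → ℝ} (hK : IsKernel K) (m m' : Fin d → ℕ) :
    Continuous (weightedProduct K m m') :=
  ((continuous_scaledMonomial m).mul (continuous_scaledMonomial m')).mul hK.continuous

lemma IsKernel.exists_bound {d : ℕ} {K : E d → ℝ} (hK : IsKernel K) :
    ∃ Kb : ℝ, 0 < Kb ∧ ∀ u, K u ≤ Kb := by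
  obtain ⟨b, hb⟩ := hK.bounded
  exact ⟨max b 1, by positivity, fun u => (hb ⟨u, rfl⟩).trans (le_max_left _ _)⟩

/-- Common Lipschitz constant of all weighted monomials and products of degree at most `ℓ`. -/
lemma IsKernel.exists_common_lipschitz {d : ℕ} {K : E d → ℝ} (hK : IsKernel K) (ℓ : ℕ) :
    ∃ A : ℝ, 0 ≤ A ∧
      (∀ (m : MultiIndex d ℓ) (u v : E d),
        |weightedMonomial K m.entry u - weightedMonomial K m.entry v| ≤ A * ‖u - v‖) ∧
      ∀ (m m' : MultiIndex d ℓ) (u v : E d),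
        |weightedProduct K m.entry m'.entry u - weightedProduct K m.entry m'.entry v|
          ≤ A * ‖u - v‖ := by
  choose A1 hA1 h1 using fun m : MultiIndex d ℓ =>
    hK.exists_lipschitz_mul (contDiff_scaledMonomial m.entry)
  choose A2 hA2 h2 using fun q : MultiIndex d ℓ × MultiIndex d ℓ =>
    hK.exists_lipschitz_mul
      ((contDiff_scaledMonomial q.1.entry).mul (contDiff_scaledMonomial q.2.entry))
  have hs1 : 0 ≤ ∑ m, A1 m := Finset.sum_nonneg fun m _ => hA1 m
  have hs2 : 0 ≤ ∑ q, A2 q := Finset.sum_nonneg fun q _ => hA2 q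
  refine ⟨∑ m, A1 m + ∑ q, A2 q, by positivity, fun m u v => (h1 m u v).trans ?_,
    fun m m' u v => (h2 (m, m') u v).trans ?_⟩
  · refine mul_le_mul_of_nonneg_right ?_ (norm_nonneg _)
    have := Finset.single_le_sum (fun m _ => hA1 m) (Finset.mem_univ m)
    linarith
  · refine mul_le_mul_of_nonneg_right ?_ (norm_nonneg _)
    have := Finset.single_le_sum (fun q _ => hA2 q) (Finset.mem_univ (m, m'))
    linarith

set_option maxHeartbeats 1000000 in
/-- Deterministic bound of the error at `z` by quantities computed at a nearby net point `z0`. The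
scale `h^(d+1) h^β` of the net makes the change of all kernel averages from `z0` to `z` of order
`h^β`. If the Gram matrix at `z0` is close to a coercive matrix `G`, then the error is governed by
the noise term at `z0` and by `h^β`. Otherwise `Bad ≥ 1`, and the regularization still gives a bound
that is polynomial in `1 / h`. -/
lemma exists_localPoly_dichotomy {d ℓ : ℕ} {K : E d → ℝ} (hK : IsKernel K) {β L c0 c1 T pmax : ℝ}
    (hβ : 0 < β) (hL : 0 ≤ L) (hc0 : 0 < c0) (hc1 : 0 < c1) :
    ∃ κ : ℝ, 0 < κ ∧ ∃ ε : ℝ, 0 < ε ∧ ∃ C : ℝ, 0 ≤ C ∧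
      ∀ (n : ℕ) (s : Finset (Fin n)) (x : Fin n → E d) (y ξ : Fin n → ℝ) (f : E d → ℝ) (h : ℝ)
        (z z0 : E d) (c : MultiIndex d ℓ → ℝ) (G : MultiIndex d ℓ → MultiIndex d ℓ → ℝ) (Bad : ℝ),
        s.Nonempty → 0 < h → h ≤ 1 → ‖z - z0‖ ≤ κ * (h ^ (d + 1) * h ^ β) →
        (∀ i, y i = f (x i) + ξ i) →
        (∀ x', |f x' - ∑ m, c m * scaledMonomial m.entry (x' - z)| ≤ L * ‖x' - z‖ ^ β) →
        c0 * ∑ m, c m ^ 2 ≤ T →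
        (∀ v : MultiIndex d ℓ → ℝ, c1 * ∑ m, v m ^ 2 ≤ ∑ m, ∑ m', v m * v m' * G m m') →
        G (zeroIndex d ℓ) (zeroIndex d ℓ) ≤ pmax →
        0 ≤ Bad → ((∃ m m', ε < |gramMatrix ℓ K h s x z0 m m' - G m m'|) → 1 ≤ Bad) →
        ∑ m, (localPolyCoeff ℓ K h (h ^ β) s x y z m - h ^ (∑ i, m.entry i) * c m) ^ 2
          ≤ C * (∑ m : MultiIndex d ℓ, kernelAvg h s x ξ (weightedMonomial K m.entry) z0 ^ 2
            + (h ^ β) ^ 2 * (1 + noiseMeanSq s ξ)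
            + (1 + noiseMeanSq s ξ) / ((h ^ β) ^ 2 * h ^ (2 * d)) * Bad) := by
  obtain ⟨A, hA0, hA1, hA2⟩ := hK.exists_common_lipschitz ℓ
  obtain ⟨Kb, hKb0, hKb⟩ := hK.exists_bound
  set N : ℝ := (Fintype.card (MultiIndex d ℓ) : ℝ) with hN
  have hN0 : 0 ≤ N := by positivity
  set ε : ℝ := c1 / (4 * (N + 1)) with hε
  have hε0 : 0 < ε := by positivity
  have hεN : 2 * ε * N ≤ c1 / 2 := by
    rw [hε]
    have : c1 / (4 * (N + 1)) * (N + 1) = c1 / 4 := by field_simp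
    nlinarith
  set κ : ℝ := ε / (A + 1) with hκ
  have hκ0 : 0 < κ := by positivity
  have hAκ : A * κ ≤ ε := by
    have : κ * (A + 1) = ε := by rw [hκ]; field_simp
    nlinarith
  set Cg : ℝ := 3 / (c1 / 2) ^ 2 * (|T| / c0 + N * (L * (|pmax| + 2 * ε)) ^ 2
    + 2 + 2 * N * ε ^ 2) with hCg
  set Cb : ℝ := 3 * (|T| / c0 + N * (L * Kb) ^ 2 + N * Kb ^ 2) with hCb
  have hCg0 : 0 ≤ Cg := by positivity
  have hCb0 : 0 ≤ Cb := by positivity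
  refine ⟨κ, hκ0, ε, hε0, Cg + Cb, by positivity, ?_⟩
  intro n s x y ξ f h z z0 c G Bad hs hh hh1 hz hy hf hc hG hG0 hBad0 hBad
  set η := h ^ β with hη
  have hη0 : 0 < η := Real.rpow_pos_of_pos hh β
  have hη1 : η ≤ 1 := Real.rpow_le_one hh.le hh1 hβ.le
  set S2 := noiseMeanSq s ξ with hS2
  have hS20 : 0 ≤ S2 := noiseMeanSq_nonneg s ξ
  set S := (1 / (s.card : ℝ)) * ∑ i ∈ s, |ξ i| with hS
  have hSS : S ^ 2 ≤ S2 := sq_mean_abs_le_noiseMeanSq s ξ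
  have hS0 : 0 ≤ S := mul_nonneg (by positivity) (Finset.sum_nonneg fun _ _ => abs_nonneg _)
  set N0 := ∑ m : MultiIndex d ℓ, kernelAvg h s x ξ (weightedMonomial K m.entry) z0 ^ 2 with hN0'
  have hN00 : 0 ≤ N0 := Finset.sum_nonneg fun _ _ => sq_nonneg _
  have hcs : ∑ m, c m ^ 2 ≤ |T| / c0 := by
    rw [le_div_iff₀ hc0, mul_comm]
    exact hc.trans (le_abs_self T)
  have hcs0 : 0 ≤ ∑ m, c m ^ 2 := Finset.sum_nonneg fun _ _ => sq_nonneg _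
  have hcard : (s.card : ℝ) ≠ 0 := by
    exact_mod_cast hs.card_pos.ne'
  have hone : (1 / (s.card : ℝ)) * ∑ i ∈ s, |(1 : ℝ)| = 1 := by
    simp [hcard]
  have hshift : A * ‖z - z0‖ / h ^ (d + 1) ≤ ε * η := by
    rw [div_le_iff₀ (by positivity)]
    calc A * ‖z - z0‖ ≤ A * (κ * (h ^ (d + 1) * η)) := by gcongr
      _ = A * κ * (η * h ^ (d + 1)) := by ring
      _ ≤ ε * (η * h ^ (d + 1)) := by gcongr
      _ = _ := by ring
  have hB00 : kernelAvg h s x (fun _ => 1) K z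
      = gramMatrix ℓ K h s x z (zeroIndex d ℓ) (zeroIndex d ℓ) := by
    rw [gramMatrix_apply, entry_zeroIndex]
    congr 1
    exact funext fun u => (weightedProduct_zero K u).symm
  have hB00nn : 0 ≤ kernelAvg h s x (fun _ => 1) K z := by
    rw [kernelAvg]
    exact mul_nonneg (by positivity) (Finset.sum_nonneg fun i _ => by
      rw [one_mul]; exact hK.nonneg _)
  by_cases hgood : ∃ m m', ε < |gramMatrix ℓ K h s x z0 m m' - G m m'|
  · -- the crude bound, with `h^β` as lower bound of the quadratic form
    have h1 := sum_sq_localPolyCoeff_sub_le hK hβ hL hh hh1 hη0 s x y ξ z c hy hf (fun v => by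
      have := gramMatrix_quadForm_nonneg hK hh s x z v
      linarith)
    have h2 : kernelAvg h s x (fun _ => 1) K z ≤ Kb / h ^ d := by
      have := abs_kernelAvg_le hh s x (fun _ => 1) (g := K) (A := Kb)
        (fun u => by rw [abs_of_nonneg (hK.nonneg u)]; exact hKb u) z
      rw [hone, mul_one] at this
      exact (le_abs_self _).trans this
    have h3 : ∀ m : MultiIndex d ℓ, kernelAvg h s x ξ (weightedMonomial K m.entry) z ^ 2
        ≤ (Kb / h ^ d) ^ 2 * S2 := by
      intro m
      have := abs_kernelAvg_le hh s x ξ (g := weightedMonomial K m.entry) (A := Kb)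
        (fun u => (hK.abs_weightedMonomial_le _ u).trans (hKb u)) z
      calc kernelAvg h s x ξ (weightedMonomial K m.entry) z ^ 2
          ≤ (Kb / h ^ d * S) ^ 2 := sq_le_sq.mpr (this.trans (le_abs_self _))
        _ = (Kb / h ^ d) ^ 2 * S ^ 2 := by ring
        _ ≤ _ := by gcongr
    have h4 : ∑ m : MultiIndex d ℓ, kernelAvg h s x ξ (weightedMonomial K m.entry) z ^ 2
        ≤ N * ((Kb / h ^ d) ^ 2 * S2) := by
      refine (Finset.sum_le_sum fun m _ => h3 m).trans_eq ?_
      rw [Finset.sum_const, Finset.card_univ, nsmul_eq_mul]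
    have hhd : h ^ (2 * d) ≤ 1 := pow_le_one₀ hh.le hh1
    have hη2 : η ^ 2 ≤ 1 := pow_le_one₀ hη0.le hη1
    have h5 : η ^ 2 * ∑ m, c m ^ 2 + N * (L * η * kernelAvg h s x (fun _ => 1) K z) ^ 2
        + ∑ m : MultiIndex d ℓ, kernelAvg h s x ξ (weightedMonomial K m.entry) z ^ 2
        ≤ (|T| / c0 + N * (L * Kb) ^ 2 + N * Kb ^ 2) * ((1 + S2) / h ^ (2 * d)) := by
      have e1 : η ^ 2 * ∑ m, c m ^ 2 ≤ |T| / c0 * ((1 + S2) / h ^ (2 * d)) := by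
        have : 1 ≤ (1 + S2) / h ^ (2 * d) := by
          rw [one_le_div (by positivity)]; linarith
        calc η ^ 2 * ∑ m, c m ^ 2 ≤ 1 * (|T| / c0) := by gcongr
          _ = |T| / c0 * 1 := by ring
          _ ≤ _ := by gcongr
      have e2 : N * (L * η * kernelAvg h s x (fun _ => 1) K z) ^ 2
          ≤ N * (L * Kb) ^ 2 * ((1 + S2) / h ^ (2 * d)) := by
        calc N * (L * η * kernelAvg h s x (fun _ => 1) K z) ^ 2
            ≤ N * (L * 1 * (Kb / h ^ d)) ^ 2 := by gcongr
          _ = N * (L * Kb) ^ 2 * (1 / h ^ (2 * d)) := by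
              rw [pow_mul']; field_simp
          _ ≤ _ := by gcongr; linarith
      have e3 : N * ((Kb / h ^ d) ^ 2 * S2) ≤ N * Kb ^ 2 * ((1 + S2) / h ^ (2 * d)) := by
        calc N * ((Kb / h ^ d) ^ 2 * S2) = N * Kb ^ 2 * (S2 / h ^ (2 * d)) := by
              rw [pow_mul']; field_simp
          _ ≤ _ := by gcongr; linarith
      linarith
    have hB1 := hBad hgood
    calc _ ≤ 3 / η ^ 2 * (η ^ 2 * ∑ m, c m ^ 2
          + N * (L * η * kernelAvg h s x (fun _ => 1) K z) ^ 2
          + ∑ m : MultiIndex d ℓ, kernelAvg h s x ξ (weightedMonomial K m.entry) z ^ 2) := h1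
      _ ≤ 3 / η ^ 2 * ((|T| / c0 + N * (L * Kb) ^ 2 + N * Kb ^ 2)
          * ((1 + S2) / h ^ (2 * d))) := by gcongr
      _ = Cb * ((1 + S2) / (η ^ 2 * h ^ (2 * d)) * 1) := by rw [hCb]; field_simp
      _ ≤ (Cg + Cb) * ((1 + S2) / (η ^ 2 * h ^ (2 * d)) * Bad) :=
        mul_le_mul (by linarith) (mul_le_mul_of_nonneg_left hB1 (by positivity)) (by positivity)
          (by positivity)
      _ ≤ _ := by
        refine mul_le_mul_of_nonneg_left ?_ (by positivity)
        have : 0 ≤ N0 + η ^ 2 * (1 + S2) := by positivity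
        linarith
  · -- the Gram matrix at `z` inherits the coercivity of `G`, with the constant `c1 / 2`
    push Not at hgood
    have hBG : ∀ m m', |gramMatrix ℓ K h s x z m m' - G m m'| ≤ 2 * ε := by
      intro m m'
      have h1 := abs_kernelAvg_sub_le hh s x (fun _ => 1) (hA2 m m') z z0
      rw [hone, mul_one, ← gramMatrix_apply, ← gramMatrix_apply] at h1
      have h2 : ε * η ≤ ε := mul_le_of_le_one_right hε0.le hη1
      have h3 := abs_sub_le (gramMatrix ℓ K h s x z m m') (gramMatrix ℓ K h s x z0 m m') (G m m')
      linarith [hgood m m']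
    have hquad := quadForm_perturbation hG hBG hεN
    have h1 := sum_sq_localPolyCoeff_sub_le hK hβ hL hh hh1 (half_pos hc1) s x y ξ z c hy hf
      (fun v => by
        have h2 : 0 ≤ h ^ β * ∑ m, v m ^ 2 :=
          mul_nonneg hη0.le (Finset.sum_nonneg fun _ _ => sq_nonneg _)
        linarith [hquad v])
    have h2 : kernelAvg h s x (fun _ => 1) K z ≤ |pmax| + 2 * ε := by
      rw [hB00]
      have := (abs_le.mp (hBG (zeroIndex d ℓ) (zeroIndex d ℓ))).2
      linarith [le_abs_self pmax]
    have h3 : ∀ m : MultiIndex d ℓ, kernelAvg h s x ξ (weightedMonomial K m.entry) z ^ 2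
        ≤ 2 * kernelAvg h s x ξ (weightedMonomial K m.entry) z0 ^ 2 + 2 * (ε * η) ^ 2 * S2 := by
      intro m
      have h4 := abs_kernelAvg_sub_le hh s x ξ (hA1 m) z z0
      have h5 : |kernelAvg h s x ξ (weightedMonomial K m.entry) z
          - kernelAvg h s x ξ (weightedMonomial K m.entry) z0| ≤ ε * η * S :=
        h4.trans (mul_le_mul_of_nonneg_right hshift hS0)
      have h6 := sq_le_sq.mpr (h5.trans (le_abs_self _))
      have h7 : (ε * η * S) ^ 2 ≤ (ε * η) ^ 2 * S2 := by
        rw [mul_pow (ε * η)]; gcongr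
      nlinarith [sq_nonneg (kernelAvg h s x ξ (weightedMonomial K m.entry) z
        - 2 * kernelAvg h s x ξ (weightedMonomial K m.entry) z0)]
    have h4 : ∑ m : MultiIndex d ℓ, kernelAvg h s x ξ (weightedMonomial K m.entry) z ^ 2
        ≤ 2 * N0 + N * (2 * (ε * η) ^ 2 * S2) := by
      refine (Finset.sum_le_sum fun m _ => h3 m).trans_eq ?_
      rw [Finset.sum_add_distrib, ← Finset.mul_sum, Finset.sum_const, Finset.card_univ,
        nsmul_eq_mul]
    have h5 : η ^ 2 * ∑ m, c m ^ 2 + N * (L * η * kernelAvg h s x (fun _ => 1) K z) ^ 2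
        + ∑ m : MultiIndex d ℓ, kernelAvg h s x ξ (weightedMonomial K m.entry) z ^ 2
        ≤ (|T| / c0 + N * (L * (|pmax| + 2 * ε)) ^ 2 + 2 + 2 * N * ε ^ 2)
          * (N0 + η ^ 2 * (1 + S2)) := by
      have e1 : η ^ 2 * ∑ m, c m ^ 2 ≤ |T| / c0 * (N0 + η ^ 2 * (1 + S2)) := by
        calc η ^ 2 * ∑ m, c m ^ 2 ≤ η ^ 2 * (|T| / c0) := by gcongr
          _ = |T| / c0 * (0 + η ^ 2 * (1 + 0)) := by ring
          _ ≤ _ := by gcongr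
      have e2 : N * (L * η * kernelAvg h s x (fun _ => 1) K z) ^ 2
          ≤ N * (L * (|pmax| + 2 * ε)) ^ 2 * (N0 + η ^ 2 * (1 + S2)) := by
        calc N * (L * η * kernelAvg h s x (fun _ => 1) K z) ^ 2
            ≤ N * (L * η * (|pmax| + 2 * ε)) ^ 2 := by gcongr
          _ = N * (L * (|pmax| + 2 * ε)) ^ 2 * (0 + η ^ 2 * (1 + 0)) := by ring
          _ ≤ _ := by gcongr
      have e3 : 2 * N0 ≤ 2 * (N0 + η ^ 2 * (1 + S2)) := by
        have : 0 ≤ η ^ 2 * (1 + S2) := by positivity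
        linarith
      have e4 : N * (2 * (ε * η) ^ 2 * S2) ≤ 2 * N * ε ^ 2 * (N0 + η ^ 2 * (1 + S2)) := by
        calc N * (2 * (ε * η) ^ 2 * S2) = 2 * N * ε ^ 2 * (0 + η ^ 2 * (0 + S2)) := by ring
          _ ≤ _ := by gcongr; linarith
      linarith
    calc _ ≤ 3 / (c1 / 2) ^ 2 * (η ^ 2 * ∑ m, c m ^ 2
          + N * (L * η * kernelAvg h s x (fun _ => 1) K z) ^ 2
          + ∑ m : MultiIndex d ℓ, kernelAvg h s x ξ (weightedMonomial K m.entry) z ^ 2) := h1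
      _ ≤ 3 / (c1 / 2) ^ 2 * ((|T| / c0 + N * (L * (|pmax| + 2 * ε)) ^ 2 + 2 + 2 * N * ε ^ 2)
          * (N0 + η ^ 2 * (1 + S2))) := by gcongr
      _ = Cg * (N0 + η ^ 2 * (1 + S2)) := by rw [hCg]; ring
      _ ≤ (Cg + Cb) * (N0 + η ^ 2 * (1 + S2)) :=
        mul_le_mul_of_nonneg_right (by linarith) (by positivity)
      _ ≤ _ := by
        refine mul_le_mul_of_nonneg_left ?_ (by positivity)
        have : 0 ≤ (1 + S2) / (η ^ 2 * h ^ (2 * d)) * Bad := by positivity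
        linarith

/-! ### Exponential moments of kernel sums -/

lemma sq_le_two_mul_exp {x : ℝ} (hx : 0 ≤ x) : x ^ 2 ≤ 2 * Real.exp x := by
  have := Real.pow_div_factorial_le_exp x hx 2
  simp only [Nat.factorial_two, Nat.cast_ofNat] at this
  linarith

section Stochastic

variable {d n : ℕ} {Ω : Type*} [MeasurableSpace Ω] {μ : Measure Ω}
  {Θ : Set (E d)} {pmin pmax σ : ℝ} {X : Fin n → Ω → E d} {ξ : Fin n → Ω → ℝ}

lemma IsNoise.meanLE_exp (hξ : IsNoise μ σ X ξ) (i : Fin n) :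
    MeanLE μ (fun ω => Real.exp (|ξ i ω| / σ)) 2 :=
  ⟨hξ.integrable_exp i, hξ.exp_moment i⟩

lemma IsNoise.meanLE_sq [IsProbabilityMeasure μ] (hξ : IsNoise μ σ X ξ) (hσ : 0 < σ) (i : Fin n) :
    MeanLE μ (fun ω => ξ i ω ^ 2) (4 * σ ^ 2) := by
  have := hξ.measurable i
  refine (((hξ.meanLE_exp i).const_mul (by positivity : 0 ≤ 2 * σ ^ 2)).of_le (by fun_prop)
    (fun ω => sq_nonneg _) fun ω => ?_).mono (by linarith)
  have h := sq_le_two_mul_exp (x := |ξ i ω| / σ) (by positivity)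
  rw [div_pow, sq_abs, div_le_iff₀ (by positivity)] at h
  linarith

lemma IsNoise.meanLE_noiseMeanSq [IsProbabilityMeasure μ] (hξ : IsNoise μ σ X ξ) (hσ : 0 < σ)
    {s : Finset (Fin n)} (hs : s.Nonempty) :
    MeanLE μ (fun ω => noiseMeanSq s fun i => ξ i ω) (4 * σ ^ 2) := by
  have hcard : (s.card : ℝ) ≠ 0 := by exact_mod_cast hs.card_pos.ne'
  refine ((MeanLE.sum fun i _ => hξ.meanLE_sq hσ i).const_mul
    (by positivity : (0 : ℝ) ≤ 1 / (s.card : ℝ))).mono (le_of_eq ?_)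
  rw [Finset.sum_const, nsmul_eq_mul]
  field_simp

lemma IsDesign.meanLE_kernel [IsProbabilityMeasure μ] (hX : IsDesign μ Θ pmin pmax X)
    {K : E d → ℝ} (hK : IsKernel K) {h : ℝ} (hh : 0 < h) (hh1 : h ≤ 1) {z : E d} (hz : z ∈ Θ)
    (i : Fin n) :
    MeanLE μ (fun ω => K (h⁻¹ • (X i ω - z))) (pmax * h ^ d) := by
  obtain ⟨Kb, hKb0, hKb⟩ := hK.exists_bound
  refine ⟨?_, ?_⟩
  · refine (integrable_const Kb).mono' ?_ (Filter.Eventually.of_forall fun ω => ?_)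
    · have hc : Continuous fun x : E d => K (h⁻¹ • (x - z)) :=
        hK.continuous.comp (by fun_prop)
      exact (hc.measurable.comp (hX.measurable i)).aestronglyMeasurable
    · rw [Real.norm_of_nonneg (hK.nonneg _)]
      exact hKb _
  · have := (hX.integral_bounds hh hh1 hz hK.continuous hK.compact_support hK.nonneg
      (fun u hu => hK.eq_zero hu) i).2
    rwa [hK.integral_eq_one, mul_one] at this

lemma IsDesign.measurable_scaled (hX : IsDesign μ Θ pmin pmax X) {g : E d → ℝ} (hg : Continuous g)
    (h : ℝ) (z : E d) (i : Fin n) : Measurable fun ω => g (h⁻¹ • (X i ω - z)) := by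
  have hc : Continuous fun x : E d => g (h⁻¹ • (x - z)) := hg.comp (by fun_prop)
  exact hc.measurable.comp (hX.measurable i)

lemma IsNoise.indepFun_pair (hξ : IsNoise μ σ X ξ) (i : Fin n) : IndepFun (ξ i) (X i) μ :=
  hξ.indep_design.comp (measurable_pi_apply i) (measurable_pi_apply i)

/-- Exponential moments of a noise sum with small parameter `t`. The factor `h^d` in the exponent is
the probability, up to constants, that a design point falls in the window around `z`. -/
lemma meanLE_exp_noise_sum [IsProbabilityMeasure μ] (hX : IsDesign μ Θ pmin pmax X)
    (hξ : IsNoise μ σ X ξ) (hσ : 0 < σ)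
    {K : E d → ℝ} (hK : IsKernel K) {Kb : ℝ} (hKb : ∀ u, K u ≤ Kb) {g : E d → ℝ}
    (hg : Continuous g) (hgK : ∀ u, |g u| ≤ K u) {h : ℝ} (hh : 0 < h) (hh1 : h ≤ 1) {z : E d}
    (hz : z ∈ Θ) {t : ℝ} (ht : |t| * Kb * σ ≤ 1 / 2) (s : Finset (Fin n)) :
    MeanLE μ (fun ω => Real.exp (t * ∑ i ∈ s, ξ i ω * g (h⁻¹ • (X i ω - z))))
      (Real.exp (t ^ 2 * (s.card * (16 * σ ^ 2 * Kb * pmax * h ^ d)))) := by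
  have hKb0 : 0 ≤ Kb := (hK.nonneg 0).trans (hKb 0)
  have hind : iIndepFun (fun i ω => ξ i ω * g (h⁻¹ • (X i ω - z))) μ :=
    (iIndepFun_prodMk_of_indepFun hX.measurable hξ.measurable hX.independent hξ.independent
      hξ.indep_design).comp (fun _ (q : E d × ℝ) => q.2 * g (h⁻¹ • (q.1 - z)))
      (fun _ => measurable_snd.mul ((hg.comp (by fun_prop : Continuous fun x : E d =>
        h⁻¹ • (x - z))).measurable.comp measurable_fst))
  have hgm := fun i => hX.measurable_scaled hg h z i
  have hmeas : ∀ i, Measurable fun ω => ξ i ω * g (h⁻¹ • (X i ω - z)) := fun i =>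
    (hξ.measurable i).mul (hgm i)
  refine meanLE_exp_mul_sum hind hmeas (fun i => ?_) s
  have hindi : IndepFun (ξ i) (fun ω => g (h⁻¹ • (X i ω - z))) μ :=
    (hξ.indepFun_pair i).comp measurable_id
      (hg.comp (by fun_prop : Continuous fun x : E d => h⁻¹ • (x - z))).measurable
  have hgi : Integrable (fun ω => g (h⁻¹ • (X i ω - z))) μ :=
    (hX.meanLE_kernel hK hh hh1 hz i).1.mono' (hgm i).aestronglyMeasurable
      (Filter.Eventually.of_forall fun ω => hgK _)
  have hindK : IndepFun (fun ω => Real.exp (|ξ i ω| / σ)) (fun ω => K (h⁻¹ • (X i ω - z))) μ :=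
    (hξ.indepFun_pair i).comp (φ := fun y => Real.exp (|y| / σ)) (by fun_prop)
      (hK.continuous.comp (by fun_prop : Continuous fun x : E d => h⁻¹ • (x - z))).measurable
  have hprod : MeanLE μ (fun ω => Real.exp (|ξ i ω| / σ) * K (h⁻¹ • (X i ω - z)))
      (2 * (pmax * h ^ d)) := by
    have h1 := hξ.meanLE_exp i
    have h2 := hX.meanLE_kernel hK hh hh1 hz i
    refine ⟨hindK.integrable_mul h1.1 h2.1, ?_⟩
    rw [hindK.integral_fun_mul_eq_mul_integral h1.1.aestronglyMeasurable
      h2.1.aestronglyMeasurable]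
    exact mul_le_mul h1.2 h2.2 (integral_nonneg fun ω => hK.nonneg _) zero_le_two
  refine meanLE_exp_mul (hmeas i) (hindi.integrable_mul (hξ.integrable i) hgi) ?_ ?_
  · rw [hindi.integral_fun_mul_eq_mul_integral (hξ.integrable i).aestronglyMeasurable
      hgi.aestronglyMeasurable, hξ.mean_zero i, zero_mul]
  · refine ((hprod.const_mul (by positivity : 0 ≤ 8 * σ ^ 2 * Kb)).of_le
      (by have := hmeas i; fun_prop)
      (fun ω => by positivity) fun ω => ?_).mono (le_of_eq (by ring))
    set y := ξ i ω
    set u := h⁻¹ • (X i ω - z)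
    -- half of the exponential absorbs the square of the noise
    have h1 : |t * (y * g u)| ≤ |y| / σ / 2 := by
      have h2 : |g u| ≤ Kb := (hgK u).trans (hKb u)
      rw [abs_mul, abs_mul, div_div, le_div_iff₀ (by positivity)]
      calc |t| * (|y| * |g u|) * (σ * 2) ≤ |t| * (|y| * Kb) * (σ * 2) := by gcongr
        _ = |y| * (2 * (|t| * Kb * σ)) := by ring
        _ ≤ |y| * (2 * (1 / 2)) := by gcongr
        _ = |y| := by ring
    have h3 : y ^ 2 ≤ 8 * σ ^ 2 * Real.exp (|y| / σ / 2) := by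
      have h := sq_le_two_mul_exp (x := |y| / σ / 2) (by positivity)
      rw [div_pow, div_pow, sq_abs, div_div, div_le_iff₀ (by positivity)] at h
      linarith
    have h4 : g u ^ 2 ≤ Kb * K u := by
      rw [← sq_abs, sq]
      exact mul_le_mul ((hgK u).trans (hKb u)) (hgK u) (abs_nonneg _) hKb0
    have h5 : Real.exp (|y| / σ / 2) * Real.exp (|y| / σ / 2) = Real.exp (|y| / σ) := by
      rw [← Real.exp_add]; ring_nf
    calc (y * g u) ^ 2 * Real.exp |t * (y * g u)|
        ≤ (y * g u) ^ 2 * Real.exp (|y| / σ / 2) := by gcongr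
      _ = y ^ 2 * g u ^ 2 * Real.exp (|y| / σ / 2) := by ring
      _ ≤ (8 * σ ^ 2 * Real.exp (|y| / σ / 2)) * (Kb * K u) * Real.exp (|y| / σ / 2) := by
          gcongr
      _ = 8 * σ ^ 2 * Kb * ((Real.exp (|y| / σ / 2) * Real.exp (|y| / σ / 2)) * K u) := by ring
      _ = _ := by rw [h5]

lemma IsDesign.integral_scaled_eq (hX : IsDesign μ Θ pmin pmax X) {g : E d → ℝ}
    (hg : Continuous g) (h : ℝ) (z : E d) (i j : Fin n) :
    ∫ ω, g (h⁻¹ • (X i ω - z)) ∂μ = ∫ ω, g (h⁻¹ • (X j ω - z)) ∂μ := by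
  obtain ⟨p, -, -, hlaw, -⟩ := hX.density
  have hc : Continuous fun x : E d => g (h⁻¹ • (x - z)) := hg.comp (by fun_prop)
  rw [← integral_map (hX.measurable i).aemeasurable (f := fun x => g (h⁻¹ • (x - z)))
    hc.aestronglyMeasurable, ← integral_map (hX.measurable j).aemeasurable
    (f := fun x => g (h⁻¹ • (x - z))) hc.aestronglyMeasurable, hlaw i, hlaw j]

/-- Exponential moments of a centred kernel sum with small parameter `t`. The summands are bounded,
with variance of order `h^d`. -/
lemma meanLE_exp_design_sum [IsProbabilityMeasure μ] (hX : IsDesign μ Θ pmin pmax X)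
    {K : E d → ℝ} (hK : IsKernel K) {Kb : ℝ}
    (hKb : ∀ u, K u ≤ Kb) {g : E d → ℝ} (hg : Continuous g) (hgK : ∀ u, |g u| ≤ K u) {h : ℝ}
    (hh : 0 < h) (hh1 : h ≤ 1) {z : E d} (hz : z ∈ Θ) {t : ℝ} (ht : |t| * (2 * Kb) ≤ 1)
    (s : Finset (Fin n)) :
    MeanLE μ (fun ω => Real.exp (t * ∑ i ∈ s,
        (g (h⁻¹ • (X i ω - z)) - ∫ ω', g (h⁻¹ • (X i ω' - z)) ∂μ)))
      (Real.exp (t ^ 2 * (s.card * (3 * Kb * pmax * h ^ d)))) := by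
  have hKb0 : 0 ≤ Kb := (hK.nonneg 0).trans (hKb 0)
  set a : Fin n → ℝ := fun i => ∫ ω', g (h⁻¹ • (X i ω' - z)) ∂μ with ha
  have hgm := fun i => hX.measurable_scaled hg h z i
  have hgi : ∀ i, Integrable (fun ω => g (h⁻¹ • (X i ω - z))) μ := fun i =>
    (hX.meanLE_kernel hK hh hh1 hz i).1.mono' (hgm i).aestronglyMeasurable
      (Filter.Eventually.of_forall fun ω => hgK _)
  have hind : iIndepFun (fun i ω => g (h⁻¹ • (X i ω - z)) - a i) μ :=
    hX.independent.comp (fun i x => g (h⁻¹ • (x - z)) - a i) (fun i =>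
      ((hg.comp (by fun_prop : Continuous fun x : E d => h⁻¹ • (x - z))).measurable).sub_const _)
  have hmeas : ∀ i, Measurable fun ω => g (h⁻¹ • (X i ω - z)) - a i := fun i =>
    (hgm i).sub_const _
  refine meanLE_exp_mul_sum hind hmeas (fun i => ?_) s
  have habs : ∀ ω, |g (h⁻¹ • (X i ω - z))| ≤ Kb := fun ω => (hgK _).trans (hKb _)
  have haK : |a i| ≤ Kb := by
    have := norm_integral_le_of_norm_le_const (μ := μ) (f := fun ω => g (h⁻¹ • (X i ω - z)))
      (C := Kb) (Filter.Eventually.of_forall habs)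
    simpa using this
  refine meanLE_exp_mul (hmeas i) ((hgi i).sub (integrable_const _)) ?_ ?_
  · rw [integral_sub (hgi i) (integrable_const _)]
    simp [ha]
  have hgsq : MeanLE μ (fun ω => g (h⁻¹ • (X i ω - z)) ^ 2) (Kb * (pmax * h ^ d)) := by
    refine ((hX.meanLE_kernel hK hh hh1 hz i).const_mul hKb0).of_le ((hgm i).pow_const 2)
      (fun ω => sq_nonneg _) fun ω => ?_
    rw [← sq_abs, sq]
    exact mul_le_mul (habs ω) (hgK _) (abs_nonneg _) hKb0
  have hvar : MeanLE μ (fun ω => (g (h⁻¹ • (X i ω - z)) - a i) ^ 2) (Kb * (pmax * h ^ d)) := by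
    have hlin : Integrable (fun ω => 2 * a i * g (h⁻¹ • (X i ω - z))) μ := (hgi i).const_mul _
    have heq : ∀ ω, (g (h⁻¹ • (X i ω - z)) - a i) ^ 2
        = g (h⁻¹ • (X i ω - z)) ^ 2 - 2 * a i * g (h⁻¹ • (X i ω - z)) + a i ^ 2 := fun ω => by
      ring
    simp only [heq]
    refine ⟨(hgsq.1.sub hlin).add (integrable_const _), ?_⟩
    have h1 : ∫ ω, (g (h⁻¹ • (X i ω - z)) ^ 2 - 2 * a i * g (h⁻¹ • (X i ω - z)) + a i ^ 2) ∂μ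
        = ∫ ω, g (h⁻¹ • (X i ω - z)) ^ 2 ∂μ - 2 * a i * a i + a i ^ 2 := by
      have h2 : Integrable (fun ω => g (h⁻¹ • (X i ω - z)) ^ 2
          - 2 * a i * g (h⁻¹ • (X i ω - z))) μ := hgsq.1.sub hlin
      rw [integral_add h2 (integrable_const _), integral_sub hgsq.1 hlin, integral_const_mul]
      simp [ha]
    rw [h1]
    nlinarith [hgsq.2, sq_nonneg (a i)]
  refine ((hvar.const_mul (by norm_num : (0 : ℝ) ≤ 3)).of_le
    (by have := hmeas i; fun_prop)
    (fun ω => by positivity) fun ω => ?_).mono (le_of_eq (by ring))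
  have h1 : |t * (g (h⁻¹ • (X i ω - z)) - a i)| ≤ 1 := by
    rw [abs_mul]
    refine le_trans (mul_le_mul_of_nonneg_left ?_ (abs_nonneg t)) ht
    exact (abs_sub _ _).trans (by linarith [habs ω])
  have h2 : Real.exp |t * (g (h⁻¹ • (X i ω - z)) - a i)| ≤ 3 :=
    (Real.exp_le_exp.mpr h1).trans (by linarith [Real.exp_one_lt_d9])
  rw [mul_comm]
  exact mul_le_mul_of_nonneg_right h2 (sq_nonneg _)

end Stochastic

/-! ### Exponential majorants of the exceptional events -/

/-- A square is at most `b²` plus an exponential that is small unless `V` exceeds `b / 2`. -/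
lemma sq_le_add_exp {c b V Λ : ℝ} (hc : 0 < c) (hb : 0 ≤ b) (hV : 0 ≤ V) (hΛ : 1 / 2 ≤ Λ) :
    V ^ 2 ≤ b ^ 2 + 32 / c ^ 2 * Real.exp (c * Λ * V - c * Λ * (b / 2)) := by
  rcases le_total V b with h | h
  · have : 0 ≤ 32 / c ^ 2 * Real.exp (c * Λ * V - c * Λ * (b / 2)) := by positivity
    nlinarith
  · have h1 : c * V / 4 ≤ c * Λ * V - c * Λ * (b / 2) := by
      have : c * (1 / 2) * (V / 2) ≤ c * Λ * (V - b / 2) := by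
        gcongr
        linarith
      linarith
    have h2 := sq_le_two_mul_exp (x := c * V / 4) (by positivity)
    have h3 := Real.exp_le_exp.mpr h1
    have h4 : V ^ 2 = 16 / c ^ 2 * (c * V / 4) ^ 2 := by field_simp; norm_num
    calc V ^ 2 = 16 / c ^ 2 * (c * V / 4) ^ 2 := h4
      _ ≤ 16 / c ^ 2 * (2 * Real.exp (c * Λ * V - c * Λ * (b / 2))) := by gcongr; linarith
      _ = 32 / c ^ 2 * Real.exp (c * Λ * V - c * Λ * (b / 2)) := by ring
      _ ≤ _ := by linarith [sq_nonneg b]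

/-- The exponential probability of a bad Gram matrix beats all powers of the bandwidth. -/
lemma exp_neg_le_pow {c h η Λ : ℝ} (hc : 0 < c) (hh : 0 < h) (hη : 0 < η) (hηh : η ≤ h)
    (hh1 : h ≤ 1) (hΛ : 1 / 2 ≤ Λ) (d A : ℕ) :
    Real.exp (-(c * (Λ / η ^ 2)))
      ≤ (d + A + 2).factorial * (2 / c) ^ (d + A + 2) * (η ^ 4 * h ^ (2 * d + A)) := by
  set j := d + A + 2 with hj
  set x := c / (2 * η ^ 2) with hx
  have hx0 : 0 < x := by positivity
  have h1 : Real.exp (-(c * (Λ / η ^ 2))) ≤ Real.exp (-x) := by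
    apply Real.exp_le_exp.mpr
    rw [neg_le_neg_iff, hx]
    calc c / (2 * η ^ 2) = c * ((1 / 2) / η ^ 2) := by field_simp
      _ ≤ _ := by gcongr
  have h2 : Real.exp (-x) ≤ j.factorial / x ^ j := by
    have := Real.pow_div_factorial_le_exp x hx0.le j
    rw [Real.exp_neg, inv_le_comm₀ (Real.exp_pos _) (by positivity), inv_div]
    exact this
  have h3 : (j.factorial : ℝ) / x ^ j = j.factorial * (2 / c) ^ j * (η ^ 2) ^ j := by
    rw [hx, div_pow, mul_pow, div_pow]
    field_simp
  have h4 : (η ^ 2) ^ j ≤ η ^ 4 * h ^ (2 * d + A) := by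
    have h5 : (η ^ 2) ^ j = η ^ 4 * η ^ (2 * d + 2 * A) := by
      rw [← pow_mul, ← pow_add]; congr 1; omega
    rw [h5]
    refine mul_le_mul_of_nonneg_left ?_ (by positivity)
    exact (pow_le_pow_left₀ hη.le hηh _).trans (pow_le_pow_of_le_one hh.le hh1 (by omega))
  refine h1.trans (h2.trans (h3.trans_le ?_))
  gcongr

/-- The sum of the exponentials which dominate the indicator of the event that some entry of the
Gram matrix at `z` is far from its expectation, the `a m m'` being the summands' expectations. -/
def badGram {d n ℓ : ℕ} (K : E d → ℝ) (h τ ε : ℝ) (s : Finset (Fin n))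
    (a : MultiIndex d ℓ → MultiIndex d ℓ → ℝ) (z : E d) (x : Fin n → E d) : ℝ :=
  ∑ m, ∑ m', (Real.exp (τ * ∑ i ∈ s,
      (weightedProduct K m.entry m'.entry (h⁻¹ • (x i - z)) - a m m'))
    + Real.exp (-τ * ∑ i ∈ s,
      (weightedProduct K m.entry m'.entry (h⁻¹ • (x i - z)) - a m m')))
      * Real.exp (-(τ * ε * (s.card * h ^ d)))

lemma badGram_nonneg {d n ℓ : ℕ} (K : E d → ℝ) (h τ ε : ℝ) (s : Finset (Fin n))
    (a : MultiIndex d ℓ → MultiIndex d ℓ → ℝ) (z : E d) (x : Fin n → E d) :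
    0 ≤ badGram K h τ ε s a z x :=
  Finset.sum_nonneg fun _ _ => Finset.sum_nonneg fun _ _ => by positivity

/-- Markov's inequality in exponential form, for each entry and each sign of the deviation. -/
lemma one_le_badGram {d n ℓ : ℕ} {K : E d → ℝ} {h τ ε : ℝ} (hh : 0 < h) (hτ : 0 < τ)
    {s : Finset (Fin n)} (hs : s.Nonempty) {a : MultiIndex d ℓ → MultiIndex d ℓ → ℝ} {z : E d}
    {x : Fin n → E d}
    (hbad : ∃ m m', ε < |gramMatrix ℓ K h s x z m m' - (h ^ d)⁻¹ * a m m'|) :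
    1 ≤ badGram K h τ ε s a z x := by
  obtain ⟨m, m', hm⟩ := hbad
  have hcard : (0 : ℝ) < s.card := by exact_mod_cast hs.card_pos
  have hkh : 0 < s.card * h ^ d := by positivity
  set S := ∑ i ∈ s, (weightedProduct K m.entry m'.entry (h⁻¹ • (x i - z)) - a m m') with hS
  have hgS : gramMatrix ℓ K h s x z m m' - (h ^ d)⁻¹ * a m m' = S / (s.card * h ^ d) := by
    rw [gramMatrix_apply, kernelAvg, hS, Finset.sum_sub_distrib, Finset.sum_const, nsmul_eq_mul]
    simp only [one_mul]
    field_simp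
  rw [hgS, abs_div, abs_of_pos hkh, lt_div_iff₀ hkh] at hm
  have hterm : 1 ≤ (Real.exp (τ * S) + Real.exp (-τ * S))
      * Real.exp (-(τ * ε * (s.card * h ^ d))) := by
    rw [add_mul, ← Real.exp_add, ← Real.exp_add]
    rcases abs_cases S with ⟨h1, -⟩ | ⟨h1, -⟩
    · have : 0 ≤ τ * S + -(τ * ε * (s.card * h ^ d)) := by
        rw [h1] at hm; nlinarith
      linarith [Real.one_le_exp this, Real.exp_pos (-τ * S + -(τ * ε * (s.card * h ^ d)))]
    · have : 0 ≤ -τ * S + -(τ * ε * (s.card * h ^ d)) := by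
        rw [h1] at hm; nlinarith
      linarith [Real.one_le_exp this, Real.exp_pos (τ * S + -(τ * ε * (s.card * h ^ d)))]
  refine hterm.trans ?_
  refine (Finset.single_le_sum (f := fun m' => (Real.exp (τ * ∑ i ∈ s,
      (weightedProduct K m.entry m'.entry (h⁻¹ • (x i - z)) - a m m'))
    + Real.exp (-τ * ∑ i ∈ s,
      (weightedProduct K m.entry m'.entry (h⁻¹ • (x i - z)) - a m m')))
      * Real.exp (-(τ * ε * (s.card * h ^ d)))) (fun _ _ => by positivity)
      (Finset.mem_univ m')).trans ?_
  exact Finset.single_le_sum (f := fun m => ∑ m', (Real.exp (τ * ∑ i ∈ s,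
      (weightedProduct K m.entry m'.entry (h⁻¹ • (x i - z)) - a m m'))
    + Real.exp (-τ * ∑ i ∈ s,
      (weightedProduct K m.entry m'.entry (h⁻¹ • (x i - z)) - a m m')))
      * Real.exp (-(τ * ε * (s.card * h ^ d))))
      (fun _ _ => Finset.sum_nonneg fun _ _ => by positivity) (Finset.mem_univ m)

lemma continuous_badGram {d n ℓ : ℕ} {K : E d → ℝ} (hK : IsKernel K) (h τ ε : ℝ)
    (s : Finset (Fin n)) (a : MultiIndex d ℓ → MultiIndex d ℓ → ℝ) (z : E d) :
    Continuous (badGram K h τ ε s a z) := by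
  have h1 : ∀ (m m' : MultiIndex d ℓ) (i : Fin n), Continuous fun x : Fin n → E d =>
      weightedProduct K m.entry m'.entry (h⁻¹ • (x i - z)) := fun m m' i =>
    (continuous_weightedProduct hK _ _).comp (by fun_prop)
  unfold badGram
  fun_prop

section Stochastic

variable {d n : ℕ} {Ω : Type*} [MeasurableSpace Ω] {μ : Measure Ω}
  {Θ : Set (E d)} {pmin pmax σ : ℝ} {X : Fin n → Ω → E d} {ξ : Fin n → Ω → ℝ}

/-- The parameter `τ` is so small that the exponential moments, quadratic in `τ`, use up only half
of the linear gain `τ ε`. -/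
lemma meanLE_badGram [IsProbabilityMeasure μ] (hX : IsDesign μ Θ pmin pmax X) {K : E d → ℝ}
    (hK : IsKernel K) {Kb : ℝ} (hKb : ∀ u, K u ≤ Kb) {ℓ : ℕ} {h : ℝ} (hh : 0 < h) (hh1 : h ≤ 1)
    {z : E d} (hz : z ∈ Θ) {τ ε : ℝ} (hτ : 0 < τ) (hτK : τ * (2 * Kb) ≤ 1)
    (hτε : τ * (3 * Kb * pmax) ≤ ε / 2) (s : Finset (Fin n)) (i0 : Fin n) :
    MeanLE μ (fun ω => badGram (ℓ := ℓ) K h τ ε s (fun m m' =>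
        ∫ ω', weightedProduct K m.entry m'.entry (h⁻¹ • (X i0 ω' - z)) ∂μ) z fun i => X i ω)
      (2 * (Fintype.card (MultiIndex d ℓ) : ℝ) ^ 2
        * Real.exp (-(τ * ε / 2 * (s.card * h ^ d)))) := by
  have key : ∀ m m' : MultiIndex d ℓ, MeanLE μ (fun ω => (Real.exp (τ * ∑ i ∈ s,
      (weightedProduct K m.entry m'.entry (h⁻¹ • (X i ω - z))
        - ∫ ω', weightedProduct K m.entry m'.entry (h⁻¹ • (X i0 ω' - z)) ∂μ))
    + Real.exp (-τ * ∑ i ∈ s,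
      (weightedProduct K m.entry m'.entry (h⁻¹ • (X i ω - z))
        - ∫ ω', weightedProduct K m.entry m'.entry (h⁻¹ • (X i0 ω' - z)) ∂μ)))
      * Real.exp (-(τ * ε * (s.card * h ^ d))))
      (2 * Real.exp (-(τ * ε / 2 * (s.card * h ^ d)))) := by
    intro m m'
    have hc := continuous_weightedProduct hK m.entry m'.entry
    have hbd := hK.abs_weightedProduct_le m.entry m'.entry
    have h1 := meanLE_exp_design_sum hX hK hKb hc hbd hh hh1 hz (t := τ)
      (by rwa [abs_of_pos hτ]) s
    have h2 := meanLE_exp_design_sum hX hK hKb hc hbd hh hh1 hz (t := -τ)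
      (by rwa [abs_neg, abs_of_pos hτ]) s
    simp only [hX.integral_scaled_eq hc h z _ i0] at h1 h2
    have h3 := (h1.add h2).const_mul (Real.exp_pos (-(τ * ε * (s.card * h ^ d)))).le
    simp only [mul_comm (Real.exp (-(τ * ε * (s.card * h ^ d))))] at h3
    refine h3.mono ?_
    rw [neg_sq, ← two_mul, mul_assoc, ← Real.exp_add]
    refine mul_le_mul_of_nonneg_left (Real.exp_le_exp.mpr ?_) zero_le_two
    have h4 : (0 : ℝ) ≤ τ * (s.card * h ^ d) := by positivity
    have h5 := mul_le_mul_of_nonneg_left hτε h4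
    calc τ ^ 2 * (s.card * (3 * Kb * pmax * h ^ d)) + -(τ * ε * (s.card * h ^ d))
        = τ * (s.card * h ^ d) * (τ * (3 * Kb * pmax)) - τ * (s.card * h ^ d) * ε := by ring
      _ ≤ τ * (s.card * h ^ d) * (ε / 2) - τ * (s.card * h ^ d) * ε := by linarith
      _ = _ := by ring
  unfold badGram
  refine (MeanLE.sum fun m _ => MeanLE.sum fun m' _ => key m m').mono (le_of_eq ?_)
  simp only [Finset.sum_const, Finset.card_univ, nsmul_eq_mul]
  ring

/-- The sum of the exponentials which dominate the large values of the noise terms at `z`. -/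
def noiseExp (ℓ : ℕ) (K : E d → ℝ) (h t r : ℝ) (s : Finset (Fin n)) (z : E d) (x : Fin n → E d)
    (ξ : Fin n → ℝ) : ℝ :=
  ∑ m : MultiIndex d ℓ,
    (Real.exp (t * ∑ i ∈ s, ξ i * weightedMonomial K m.entry (h⁻¹ • (x i - z)))
      + Real.exp (-t * ∑ i ∈ s, ξ i * weightedMonomial K m.entry (h⁻¹ • (x i - z)))) * Real.exp (-r)

lemma noiseExp_nonneg (ℓ : ℕ) (K : E d → ℝ) (h t r : ℝ) (s : Finset (Fin n)) (z : E d)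
    (x : Fin n → E d) (ξ : Fin n → ℝ) : 0 ≤ noiseExp ℓ K h t r s z x ξ :=
  Finset.sum_nonneg fun _ _ => by positivity

lemma meanLE_noiseExp [IsProbabilityMeasure μ] (hX : IsDesign μ Θ pmin pmax X)
    (hξ : IsNoise μ σ X ξ) (hσ : 0 < σ) {K : E d → ℝ} (hK : IsKernel K) {Kb : ℝ}
    (hKb : ∀ u, K u ≤ Kb) (ℓ : ℕ) {h : ℝ} (hh : 0 < h) (hh1 : h ≤ 1) {z : E d} (hz : z ∈ Θ)
    {t : ℝ} (ht0 : 0 ≤ t) (ht : t * Kb * σ ≤ 1 / 2) (r : ℝ) (s : Finset (Fin n)) :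
    MeanLE μ (fun ω => noiseExp ℓ K h t r s z (fun i => X i ω) fun i => ξ i ω)
      (Fintype.card (MultiIndex d ℓ) *
        (2 * Real.exp (t ^ 2 * (s.card * (16 * σ ^ 2 * Kb * pmax * h ^ d)) - r))) := by
  unfold noiseExp
  refine (MeanLE.sum (c := fun _ =>
    2 * Real.exp (t ^ 2 * (s.card * (16 * σ ^ 2 * Kb * pmax * h ^ d)) - r))
    fun m _ => ?_).mono (le_of_eq ?_)
  · have hc := continuous_weightedMonomial hK m.entry
    have hbd := hK.abs_weightedMonomial_le m.entry
    have h1 := meanLE_exp_noise_sum hX hξ hσ hK hKb hc hbd hh hh1 hz (t := t)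
      (by rwa [abs_of_nonneg ht0]) s
    have h2 := meanLE_exp_noise_sum hX hξ hσ hK hKb hc hbd hh hh1 hz (t := -t)
      (by rwa [abs_neg, abs_of_nonneg ht0]) s
    have h3 := (h1.add h2).const_mul (Real.exp_pos (-r)).le
    simp only [mul_comm (Real.exp (-r))] at h3
    refine h3.mono (le_of_eq ?_)
    rw [neg_sq, ← two_mul, mul_assoc, ← Real.exp_add, sub_eq_add_neg]
  · simp only [Finset.sum_const, Finset.card_univ, nsmul_eq_mul]

/-- The squared noise term at `z` is of order `η²`, with `η` standing for `h^β`, up to exponentials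
of small mean. -/
lemma sum_sq_noise_le {ℓ : ℕ} {K : E d → ℝ} {h η c b Λ : ℝ} (hh : 0 < h) (hη : 0 < η)
    (hc : 0 < c) (hb : 0 ≤ b) {s : Finset (Fin n)} (hs : s.Nonempty)
    (hΛ : Λ = s.card * h ^ d * η ^ 2) (hΛ2 : 1 / 2 ≤ Λ) (z : E d) (x : Fin n → E d)
    (ξ : Fin n → ℝ) :
    ∑ m : MultiIndex d ℓ, kernelAvg h s x ξ (weightedMonomial K m.entry) z ^ 2
      ≤ η ^ 2 * (Fintype.card (MultiIndex d ℓ) * b ^ 2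
        + 32 / c ^ 2 * noiseExp ℓ K h (c * η) (c * Λ * (b / 2)) s z x ξ) := by
  have hcard : (0 : ℝ) < s.card := by exact_mod_cast hs.card_pos
  have key : ∀ m : MultiIndex d ℓ, kernelAvg h s x ξ (weightedMonomial K m.entry) z ^ 2
      ≤ η ^ 2 * (b ^ 2 + 32 / c ^ 2 *
        ((Real.exp (c * η * ∑ i ∈ s, ξ i * weightedMonomial K m.entry (h⁻¹ • (x i - z)))
          + Real.exp (-(c * η) * ∑ i ∈ s, ξ i * weightedMonomial K m.entry (h⁻¹ • (x i - z))))
            * Real.exp (-(c * Λ * (b / 2))))) := by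
    intro m
    set Ξ := ∑ i ∈ s, ξ i * weightedMonomial K m.entry (h⁻¹ • (x i - z)) with hΞ
    set V := |Ξ| / (s.card * h ^ d * η) with hV
    have hV0 : 0 ≤ V := by positivity
    have h1 : kernelAvg h s x ξ (weightedMonomial K m.entry) z ^ 2 = η ^ 2 * V ^ 2 := by
      rw [kernelAvg, ← hΞ, hV, div_pow, sq_abs]
      field_simp
    have h2 : c * Λ * V = c * η * |Ξ| := by
      rw [hΛ, hV]; field_simp
    have h3 := sq_le_add_exp hc hb hV0 hΛ2
    have h4 : Real.exp (c * Λ * V - c * Λ * (b / 2))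
        ≤ (Real.exp (c * η * Ξ) + Real.exp (-(c * η) * Ξ)) * Real.exp (-(c * Λ * (b / 2))) := by
      rw [sub_eq_add_neg, Real.exp_add, h2]
      refine mul_le_mul_of_nonneg_right ?_ (Real.exp_pos _).le
      rcases abs_cases Ξ with ⟨h5, -⟩ | ⟨h5, -⟩
      · rw [h5]; linarith [Real.exp_pos (-(c * η) * Ξ)]
      · rw [h5, mul_neg, ← neg_mul]; linarith [Real.exp_pos (c * η * Ξ)]
    rw [h1]
    refine mul_le_mul_of_nonneg_left (h3.trans ?_) (sq_nonneg _)
    gcongr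
  refine (Finset.sum_le_sum fun m _ => key m).trans_eq ?_
  rw [← Finset.mul_sum, Finset.sum_add_distrib, ← Finset.mul_sum, noiseExp, Finset.sum_const,
    Finset.card_univ, nsmul_eq_mul]

end Stochastic

/-! ### Mean squared error over a set with a small net -/

/-- The expected Gram matrix is coercive uniformly in the point and the bandwidth. -/
lemma IsDesign.gram_coercive {d n ℓ : ℕ} {Ω : Type*} [MeasurableSpace Ω] {μ : Measure Ω}
    [IsProbabilityMeasure μ] {Θ : Set (E d)} {pmin pmax c0 : ℝ} {X : Fin n → Ω → E d}
    (hX : IsDesign μ Θ pmin pmax X) (hpmin : 0 ≤ pmin) {K : E d → ℝ} (hK : IsKernel K)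
    (hc0 : ∀ v : MultiIndex d ℓ → ℝ,
      c0 * ∑ m, v m ^ 2 ≤ ∫ u, (∑ m, v m * scaledMonomial m.entry u) ^ 2 * K u)
    {h : ℝ} (hh : 0 < h) (hh1 : h ≤ 1) {z : E d} (hz : z ∈ Θ) (i0 : Fin n)
    (v : MultiIndex d ℓ → ℝ) :
    pmin * c0 * ∑ m, v m ^ 2 ≤ ∑ m, ∑ m', v m * v m' *
      ((h ^ d)⁻¹ * ∫ ω, weightedProduct K m.entry m'.entry (h⁻¹ • (X i0 ω - z)) ∂μ) := by
  have hcont : Continuous fun u : E d => (∑ m, v m * scaledMonomial m.entry u) ^ 2 * K u :=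
    (by fun_prop : Continuous fun u : E d => (∑ m, v m * scaledMonomial m.entry u) ^ 2).mul
      hK.continuous
  have h1 := (hX.integral_bounds hh hh1 hz hcont hK.compact_support.mul_left
    (fun u => mul_nonneg (sq_nonneg _) (hK.nonneg u))
    (fun u hu => by rw [hK.eq_zero hu, mul_zero]) i0).1
  have hint : ∀ m m' : MultiIndex d ℓ, Integrable (fun ω => v m * v m' *
      weightedProduct K m.entry m'.entry (h⁻¹ • (X i0 ω - z))) μ := fun m m' =>
    ((hX.meanLE_kernel hK hh hh1 hz i0).1.mono'
      (hX.measurable_scaled (continuous_weightedProduct hK _ _) h z i0).aestronglyMeasurable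
      (Filter.Eventually.of_forall fun ω => hK.abs_weightedProduct_le _ _ _)).const_mul _
  have h2 : ∀ u, (∑ m, v m * scaledMonomial m.entry u) ^ 2 * K u
      = ∑ m : MultiIndex d ℓ, ∑ m' : MultiIndex d ℓ,
        v m * v m' * weightedProduct K m.entry m'.entry u := by
    intro u
    rw [sq, Finset.sum_mul_sum, Finset.sum_mul]
    refine Finset.sum_congr rfl fun m _ => ?_
    rw [Finset.sum_mul]
    exact Finset.sum_congr rfl fun m' _ => by rw [weightedProduct]; ring
  have h3 : ∫ ω, (∑ m, v m * scaledMonomial m.entry (h⁻¹ • (X i0 ω - z))) ^ 2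
        * K (h⁻¹ • (X i0 ω - z)) ∂μ
      = ∑ m : MultiIndex d ℓ, ∑ m' : MultiIndex d ℓ, v m * v m' *
        ∫ ω, weightedProduct K m.entry m'.entry (h⁻¹ • (X i0 ω - z)) ∂μ := by
    simp only [h2]
    rw [integral_finsetSum _ fun m _ => integrable_finsetSum _ fun m' _ => hint m m']
    refine Finset.sum_congr rfl fun m _ => ?_
    rw [integral_finsetSum _ fun m' _ => hint m m']
    exact Finset.sum_congr rfl fun m' _ => integral_const_mul _ _
  have h4 : ∑ m : MultiIndex d ℓ, ∑ m' : MultiIndex d ℓ, v m * v m' *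
      ((h ^ d)⁻¹ * ∫ ω, weightedProduct K m.entry m'.entry (h⁻¹ • (X i0 ω - z)) ∂μ)
      = (h ^ d)⁻¹ * ∑ m : MultiIndex d ℓ, ∑ m' : MultiIndex d ℓ, v m * v m' *
        ∫ ω, weightedProduct K m.entry m'.entry (h⁻¹ • (X i0 ω - z)) ∂μ := by
    simp only [Finset.mul_sum]
    exact Finset.sum_congr rfl fun m _ => Finset.sum_congr rfl fun m' _ => by ring
  rw [h4, ← h3, le_inv_mul_iff₀ (by positivity)]
  refine le_trans ?_ h1
  have h5 := mul_le_mul_of_nonneg_left (hc0 v) (by positivity : 0 ≤ pmin * h ^ d)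
  linarith

lemma measurable_noiseMeanSq {n : ℕ} (s : Finset (Fin n)) :
    Measurable (noiseMeanSq s) := by
  unfold noiseMeanSq
  fun_prop

/-- Mean squared error of the local polynomial coefficients, uniformly over a set `T` that has a
finite net of polynomial size. With `T` reduced to a point this is the pointwise bound;
with `T = Θ` and `|s| h^(2β+d) = log (|s| + 1)` it is a uniform bound over `Θ`. -/
theorem exists_uniform_error_bound {d : ℕ} {β L M pmin pmax σ : ℝ} (hβ : 2 ≤ β) (hL : 0 < L)
    (hpmin : 0 < pmin) (hσ : 0 < σ) {Θ : Set (E d)} {K : E d → ℝ} (hK : IsKernel K) :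
    ∃ κ : ℝ, 0 < κ ∧ ∀ (A : ℕ) (a C2 : ℝ), 0 ≤ a → 0 ≤ C2 → ∃ C : ℝ, 0 ≤ C ∧
      ∀ (n : ℕ) (f : E d → ℝ), HolderClass β L f → (∀ x ∈ enlarge Θ, |f x| ≤ M) →
      ∀ (Ω : Type*) [MeasurableSpace Ω] (μ : Measure Ω) [IsProbabilityMeasure μ]
        (X : Fin n → Ω → E d) (ξ : Fin n → Ω → ℝ),
        IsDesign μ Θ pmin pmax X → IsNoise μ σ X ξ →
      ∀ (s : Finset (Fin n)) (h : ℝ), s.Nonempty → 0 < h → h ≤ 1 →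
        1 / 2 ≤ s.card * h ^ d * (h ^ β) ^ 2 →
      ∀ (T : Set (E d)) (net : Finset (E d)), T ⊆ Θ → (∀ z0 ∈ net, z0 ∈ Θ) →
        (∀ z ∈ T, ∃ z0 ∈ net, ‖z - z0‖ ≤ κ * (h ^ (d + 1) * h ^ β)) →
        (net.card : ℝ) ≤ C2 / h ^ A →
        (net.card : ℝ) ≤ C2 * Real.exp (a * (s.card * h ^ d * (h ^ β) ^ 2)) →
      ∃ Q : Ω → ℝ, MeanLE μ Q (C * (h ^ β) ^ 2) ∧ ∀ ω, ∀ z ∈ T,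
        ∑ m : MultiIndex d (strictFloor β),
          (localPolyCoeff (strictFloor β) K h (h ^ β) s (fun i => X i ω)
              (fun i => f (X i ω) + ξ i ω) z m
            - h ^ (∑ i, m.entry i) * mixedPartial m.entry f z) ^ 2 ≤ Q ω := by
  obtain ⟨c0, hc0, hcoer⟩ := hK.exists_coercive (strictFloor β)
  obtain ⟨Kb, hKb0, hKb⟩ := hK.exists_bound
  have hβ0 : 0 < β := by linarith
  obtain ⟨κ, hκ, ε, hε, C3, hC3, hdich⟩ := exists_localPoly_dichotomy (ℓ := strictFloor β) hK
    (T := (M + L) ^ 2) (pmax := pmax) hβ0 hL.le hc0 (mul_pos hpmin hc0)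
  refine ⟨κ, hκ, fun A a C2 ha hC2 => ?_⟩
  set N : ℝ := (Fintype.card (MultiIndex d (strictFloor β)) : ℝ) with hN
  have hN0 : 0 ≤ N := by positivity
  -- `c` keeps the exponential moments of the noise finite, and `b` is so large that the exponent
  -- `c² C1 Λ - c Λ b / 2` equals `-a Λ`, which offsets the cardinality of the net; `τ` fulfils the
  -- requirements of `meanLE_badGram`
  set c : ℝ := 1 / (2 * Kb * σ) with hc
  have hc0' : 0 < c := by positivity
  set C1 : ℝ := |16 * σ ^ 2 * Kb * pmax| with hC1
  set b : ℝ := 2 * (a + c ^ 2 * C1) / c with hb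
  have hb0 : 0 ≤ b := by positivity
  set τ : ℝ := min (1 / (2 * Kb)) (ε / (2 * (|3 * Kb * pmax| + 1))) with hτ
  have hτ0 : 0 < τ := lt_min (by positivity) (by positivity)
  have hτK : τ * (2 * Kb) ≤ 1 := by
    have := min_le_left (1 / (2 * Kb)) (ε / (2 * (|3 * Kb * pmax| + 1)))
    rwa [← hτ, le_div_iff₀ (by positivity)] at this
  have hτε : τ * (3 * Kb * pmax) ≤ ε / 2 := by
    have := min_le_right (1 / (2 * Kb)) (ε / (2 * (|3 * Kb * pmax| + 1)))
    rw [← hτ, le_div_iff₀ (by positivity)] at this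
    have h1 : τ * (3 * Kb * pmax) ≤ τ * (|3 * Kb * pmax| + 1) :=
      mul_le_mul_of_nonneg_left (by linarith [le_abs_self (3 * Kb * pmax)]) hτ0.le
    linarith
  set C4 : ℝ := (d + A + 2).factorial * (2 / (τ * ε / 2)) ^ (d + A + 2) with hC4
  have hC40 : 0 ≤ C4 := by positivity
  set C5 : ℝ := C3 * ((N * b ^ 2 + 32 / c ^ 2 * (2 * N * C2)) + (1 + 4 * σ ^ 2)
    + (1 + 4 * σ ^ 2) * (2 * N ^ 2 * C2 * C4)) with hC5
  refine ⟨C5, by positivity, ?_⟩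
  intro n f hf hfM Ω _ μ _ X ξ hX hξ s h hs hh hh1 hΛ T net hT hnet hcov hcard1 hcard2
  obtain ⟨i0, -⟩ := id hs
  set η := h ^ β with hη
  have hη0 : 0 < η := Real.rpow_pos_of_pos hh β
  have hηh : η ≤ h := by
    have := Real.rpow_le_rpow_of_exponent_ge hh hh1 (by linarith : (1 : ℝ) ≤ β)
    rwa [Real.rpow_one] at this
  set Λ := s.card * h ^ d * η ^ 2 with hΛdef
  have hkh : (s.card : ℝ) * h ^ d = Λ / η ^ 2 := by rw [hΛdef]; field_simp
  set S2 : Ω → ℝ := fun ω => noiseMeanSq s fun i => ξ i ω with hS2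
  have hS20 : ∀ ω, 0 ≤ S2 ω := fun ω => noiseMeanSq_nonneg _ _
  set av : E d → MultiIndex d (strictFloor β) → MultiIndex d (strictFloor β) → ℝ :=
    fun z m m' => ∫ ω', weightedProduct K m.entry m'.entry (h⁻¹ • (X i0 ω' - z)) ∂μ with hav
  set Bd : Ω → ℝ := fun ω => ∑ z0 ∈ net, badGram K h τ ε s (av z0) z0 fun i => X i ω with hBd
  have hBd0 : ∀ ω, 0 ≤ Bd ω := fun ω => Finset.sum_nonneg fun _ _ => badGram_nonneg ..
  set P : Ω → ℝ := fun ω => ∑ z0 ∈ net, noiseExp (strictFloor β) K h (c * η) (c * Λ * (b / 2)) s z0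
    (fun i => X i ω) fun i => ξ i ω with hP
  refine ⟨fun ω => C3 * (η ^ 2 * (N * b ^ 2 + 32 / c ^ 2 * P ω) + η ^ 2 * (1 + S2 ω)
    + 1 / (η ^ 2 * h ^ (2 * d)) * ((1 + S2 ω) * Bd ω)), ?_, ?_⟩
  · have hPm : MeanLE μ P (2 * N * C2) := by
      refine (MeanLE.sum fun z0 hz0 => meanLE_noiseExp hX hξ hσ hK hKb (strictFloor β) hh hh1
        (hnet z0 hz0) (t := c * η) (by positivity) ?_ (c * Λ * (b / 2)) s).mono ?_
      · have h1 : c * Kb * σ = 1 / 2 := by rw [hc]; field_simp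
        have h2 : η ≤ 1 := hηh.trans hh1
        calc c * η * Kb * σ = η * (c * Kb * σ) := by ring
          _ ≤ 1 / 2 := by rw [h1]; linarith
      · rw [Finset.sum_const, nsmul_eq_mul]
        have h1 : (c * η) ^ 2 * (s.card * (16 * σ ^ 2 * Kb * pmax * h ^ d)) - c * Λ * (b / 2)
            ≤ -(a * Λ) := by
          have h2 : c * Λ * (b / 2) = (a + c ^ 2 * C1) * Λ := by rw [hb]; field_simp
          have h3 : (c * η) ^ 2 * (s.card * (16 * σ ^ 2 * Kb * pmax * h ^ d))
              = c ^ 2 * (16 * σ ^ 2 * Kb * pmax) * Λ := by rw [hΛdef]; ring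
          have h4 : c ^ 2 * (16 * σ ^ 2 * Kb * pmax) * Λ ≤ c ^ 2 * C1 * Λ := by
            have h5 : 0 ≤ Λ := le_trans (by norm_num) hΛ
            exact mul_le_mul_of_nonneg_right
              (mul_le_mul_of_nonneg_left (le_abs_self _) (sq_nonneg _)) h5
          rw [h2, h3]
          linarith
        calc (net.card : ℝ) * (N * (2 * Real.exp ((c * η) ^ 2
              * (s.card * (16 * σ ^ 2 * Kb * pmax * h ^ d)) - c * Λ * (b / 2))))
            ≤ (C2 * Real.exp (a * Λ)) * (N * (2 * Real.exp (-(a * Λ)))) := by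
              gcongr
          _ = 2 * N * C2 * (Real.exp (a * Λ) * Real.exp (-(a * Λ))) := by ring
          _ = 2 * N * C2 := by rw [← Real.exp_add, add_neg_cancel, Real.exp_zero, mul_one]
    have hS2m : MeanLE μ (fun ω => 1 + S2 ω) (1 + 4 * σ ^ 2) :=
      (MeanLE.const 1).add (hξ.meanLE_noiseMeanSq hσ hs)
    have hBdm : MeanLE μ Bd (net.card * (2 * N ^ 2 *
        Real.exp (-(τ * ε / 2 * (s.card * h ^ d))))) := by
      refine (MeanLE.sum fun z0 hz0 => meanLE_badGram hX hK hKb hh hh1 (hnet z0 hz0) hτ0 hτK hτε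
        s i0).mono (le_of_eq ?_)
      rw [Finset.sum_const, nsmul_eq_mul]
    -- the crude bound on the bad event is a function of the noise, the event one of the design
    have hind : IndepFun (fun ω => 1 + S2 ω) Bd μ := by
      have h1 : Measurable fun y : Fin n → ℝ => 1 + noiseMeanSq s y :=
        (measurable_noiseMeanSq s).const_add 1
      have h2 : Measurable fun x : Fin n → E d => ∑ z0 ∈ net, badGram K h τ ε s (av z0) z0 x :=
        Finset.measurable_fun_sum _ fun z0 _ => (continuous_badGram hK h τ ε s _ z0).measurable
      exact hξ.indep_design.comp h1 h2
    have hprod : MeanLE μ (fun ω => (1 + S2 ω) * Bd ω)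
        ((1 + 4 * σ ^ 2) * (net.card * (2 * N ^ 2 *
          Real.exp (-(τ * ε / 2 * (s.card * h ^ d)))))) := by
      refine ⟨hind.integrable_mul hS2m.1 hBdm.1, ?_⟩
      rw [hind.integral_fun_mul_eq_mul_integral hS2m.1.aestronglyMeasurable
        hBdm.1.aestronglyMeasurable]
      exact mul_le_mul hS2m.2 hBdm.2 (integral_nonneg hBd0) (by positivity)
    have hexp := exp_neg_le_pow (c := τ * ε / 2) (by positivity) hh hη0 hηh hh1 hΛ d A
    rw [← hkh, ← hC4] at hexp
    have hsmall : 1 / (η ^ 2 * h ^ (2 * d)) * ((1 + 4 * σ ^ 2) * (net.card * (2 * N ^ 2 *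
          Real.exp (-(τ * ε / 2 * (s.card * h ^ d))))))
        ≤ (1 + 4 * σ ^ 2) * (2 * N ^ 2 * C2 * C4) * η ^ 2 := by
      calc 1 / (η ^ 2 * h ^ (2 * d)) * ((1 + 4 * σ ^ 2) * (net.card * (2 * N ^ 2 *
          Real.exp (-(τ * ε / 2 * (s.card * h ^ d))))))
          ≤ 1 / (η ^ 2 * h ^ (2 * d)) * ((1 + 4 * σ ^ 2) * (C2 / h ^ A * (2 * N ^ 2 *
          (C4 * (η ^ 4 * h ^ (2 * d + A)))))) := by gcongr
        _ = _ := by rw [pow_add]; field_simp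
    refine ((((MeanLE.const (N * b ^ 2)).add (hPm.const_mul (by positivity :
      0 ≤ 32 / c ^ 2))).const_mul (sq_nonneg η)).add (hS2m.const_mul (sq_nonneg η))
      |>.add (hprod.const_mul (by positivity : 0 ≤ 1 / (η ^ 2 * h ^ (2 * d))))
      |>.const_mul hC3).mono ?_
    rw [hC5, mul_assoc C3]
    refine mul_le_mul_of_nonneg_left ?_ hC3
    linarith
  · intro ω z hz
    obtain ⟨z0, hz0, hzz0⟩ := hcov z hz
    have h1 := hdich n s (fun i => X i ω) (fun i => f (X i ω) + ξ i ω) (fun i => ξ i ω) f h z z0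
      (fun m => mixedPartial m.entry f z) (fun m m' => (h ^ d)⁻¹ * av z0 m m') (Bd ω) hs hh hh1
      hzz0 (fun i => rfl) (fun x' => hf.taylor z x')
      (sum_sq_mixedPartial_le hβ hL hK hcoer hf hfM (hT hz))
      (hX.gram_coercive hpmin.le hK hcoer hh hh1 (hnet z0 hz0) i0) ?_ (hBd0 ω) ?_
    · refine h1.trans (mul_le_mul_of_nonneg_left ?_ hC3)
      have h2 := sum_sq_noise_le (ℓ := strictFloor β) (K := K) hh hη0 hc0' hb0 hs rfl hΛ z0
        (fun i => X i ω) fun i => ξ i ω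
      have h3 : noiseExp (strictFloor β) K h (c * η) (c * Λ * (b / 2)) s z0
          (fun i => X i ω) (fun i => ξ i ω) ≤ P ω :=
        Finset.single_le_sum (f := fun z0 => noiseExp (strictFloor β) K h (c * η)
          (c * Λ * (b / 2)) s z0 (fun i => X i ω) fun i => ξ i ω)
          (fun _ _ => noiseExp_nonneg ..) hz0
      have h4 : η ^ 2 * (N * b ^ 2 + 32 / c ^ 2 * noiseExp (strictFloor β) K h (c * η)
          (c * Λ * (b / 2)) s z0 (fun i => X i ω) fun i => ξ i ω)
          ≤ η ^ 2 * (N * b ^ 2 + 32 / c ^ 2 * P ω) := by gcongr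
      have h5 : (1 + S2 ω) / (η ^ 2 * h ^ (2 * d)) * Bd ω
          = 1 / (η ^ 2 * h ^ (2 * d)) * ((1 + S2 ω) * Bd ω) := by ring
      linarith
    · rw [inv_mul_le_iff₀ (by positivity)]
      have := (hX.meanLE_kernel hK hh hh1 (hnet z0 hz0) i0).2
      simp only [hav, entry_zeroIndex, weightedProduct_zero]
      linarith
    · intro hbad
      refine (one_le_badGram hh hτ0 hs hbad).trans ?_
      exact Finset.single_le_sum (f := fun z0 => badGram K h τ ε s (av z0) z0 fun i => X i ω)
        (fun _ _ => badGram_nonneg ..) hz0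

/-! ### Nets -/

/-- A bounded set in `ℝ^d` has `δ`-nets of cardinality of order `δ^(-d)`. -/
lemma exists_net {d : ℕ} {Θ : Set (E d)} (hΘ : Bornology.IsBounded Θ) :
    ∃ C : ℝ, 0 ≤ C ∧ ∀ δ : ℝ, 0 < δ → δ ≤ 1 → ∃ net : Finset (E d), (∀ z ∈ net, z ∈ Θ) ∧
      (∀ z ∈ Θ, ∃ z0 ∈ net, ‖z - z0‖ ≤ δ) ∧ (net.card : ℝ) ≤ C / δ ^ d := by
  classical
  obtain ⟨R, hR0, hR⟩ : ∃ R : ℝ, 0 ≤ R ∧ ∀ z ∈ Θ, ‖z‖ ≤ R := by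
    obtain ⟨R, hR⟩ := hΘ.exists_norm_le
    exact ⟨max R 0, le_max_right _ _, fun z hz => (hR z hz).trans (le_max_left _ _)⟩
  refine ⟨(2 * (R * (d + 1)) + 5) ^ d, by positivity, fun δ hδ hδ1 => ?_⟩
  -- the net has one point of `Θ` in each cell of a grid of mesh `δ / (d + 1)` which meets `Θ`
  set q : E d → Fin d → ℤ := fun z i => ⌊z i * ((d + 1) / δ)⌋ with hq
  set B : ℤ := ⌈R * ((d + 1) / δ)⌉ + 1 with hB
  set J : Finset (Fin d → ℤ) := Fintype.piFinset fun _ => Finset.Icc (-B) B with hJ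
  set J' := J.filter fun j => ∃ z ∈ Θ, q z = j with hJ'
  have hch : ∀ j : Fin d → ℤ, ∃ z : E d, (∃ z ∈ Θ, q z = j) → z ∈ Θ ∧ q z = j := by
    intro j
    by_cases h : ∃ z ∈ Θ, q z = j
    · obtain ⟨z, hz⟩ := h
      exact ⟨z, fun _ => hz⟩
    · exact ⟨0, fun h' => absurd h' h⟩
  choose r hr using hch
  refine ⟨J'.image r, ?_, ?_, ?_⟩
  · intro z hz
    obtain ⟨j, hj, rfl⟩ := Finset.mem_image.mp hz
    exact (hr j (Finset.mem_filter.mp hj).2).1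
  · intro z hz
    have hqJ : q z ∈ J' := by
      refine Finset.mem_filter.mpr ⟨Fintype.mem_piFinset.mpr fun i => ?_, z, hz, rfl⟩
      have hzi : |z i| ≤ R := (Real.norm_eq_abs (z i) ▸ PiLp.norm_apply_le z i).trans (hR z hz)
      have hp : 0 ≤ ((d : ℝ) + 1) / δ := by positivity
      have h1 : |z i * ((d + 1) / δ)| ≤ R * ((d + 1) / δ) := by
        rw [abs_mul, abs_of_nonneg hp]
        exact mul_le_mul_of_nonneg_right hzi hp
      have h2 := Int.le_ceil (R * (((d : ℝ) + 1) / δ))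
      rw [abs_le] at h1
      rw [Finset.mem_Icc, hB]
      constructor
      · refine Int.le_floor.mpr ?_
        push_cast
        linarith
      · refine (Int.floor_le_ceil _).trans (Int.ceil_le.mpr ?_)
        push_cast
        linarith
    refine ⟨r (q z), Finset.mem_image_of_mem r hqJ, ?_⟩
    have hrz := (hr (q z) ⟨z, hz, rfl⟩).2
    have hd1 : (0 : ℝ) < (d : ℝ) + 1 := by positivity
    have hco : ∀ i, (z i - r (q z) i) ^ 2 ≤ (δ / (d + 1)) ^ 2 := by
      intro i
      have h1 : ⌊z i * (((d : ℝ) + 1) / δ)⌋ = ⌊r (q z) i * (((d : ℝ) + 1) / δ)⌋ :=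
        (congrFun hrz i).symm
      have h2 := Int.abs_sub_lt_one_of_floor_eq_floor h1
      rw [← sub_mul, abs_mul, abs_of_nonneg (by positivity : 0 ≤ ((d : ℝ) + 1) / δ)] at h2
      have h3 : |z i - r (q z) i| ≤ δ / (d + 1) := by
        rw [le_div_iff₀ hd1]
        rw [mul_div_assoc', div_lt_one hδ] at h2
        exact h2.le
      exact sq_le_sq.mpr (h3.trans (le_abs_self _))
    refine abs_le_of_sq_le_sq' ?_ hδ.le |>.2
    rw [EuclideanSpace.norm_sq_eq]
    calc ∑ i, ‖(z - r (q z)) i‖ ^ 2 ≤ ∑ _i : Fin d, (δ / (d + 1)) ^ 2 :=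
          Finset.sum_le_sum fun i _ => by
            rw [Real.norm_eq_abs, sq_abs]
            exact hco i
      _ = d / (d + 1) ^ 2 * δ ^ 2 := by
          rw [Finset.sum_const, Finset.card_univ, Fintype.card_fin, nsmul_eq_mul, div_pow]
          ring
      _ ≤ 1 * δ ^ 2 := by
          gcongr
          rw [div_le_one (by positivity)]
          nlinarith [(Nat.cast_nonneg d : (0 : ℝ) ≤ d)]
      _ = δ ^ 2 := one_mul _
  · have hB0 : 0 ≤ B := by
      have : 0 ≤ ⌈R * (((d : ℝ) + 1) / δ)⌉ := Int.ceil_nonneg (by positivity)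
      omega
    have h1 : (J.card : ℝ) = (2 * (B : ℝ) + 1) ^ d := by
      rw [hJ, Fintype.card_piFinset]
      simp only [Int.card_Icc, Finset.prod_const, Finset.card_univ, Fintype.card_fin]
      push_cast
      congr 1
      have : ((B + 1 - -B).toNat : ℤ) = 2 * B + 1 := by omega
      exact_mod_cast this
    have h2 : (B : ℝ) ≤ R * (((d : ℝ) + 1) / δ) + 2 := by
      have := (Int.ceil_lt_add_one (R * (((d : ℝ) + 1) / δ))).le
      rw [hB]
      push_cast
      linarith
    have h3 : 2 * (B : ℝ) + 1 ≤ (2 * (R * (d + 1)) + 5) / δ := by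
      rw [add_div]
      have h4 : 5 ≤ 5 / δ := by rw [le_div_iff₀ hδ]; nlinarith
      have h5 : 2 * (R * ((d : ℝ) + 1)) / δ = 2 * (R * (((d : ℝ) + 1) / δ)) := by ring
      rw [h5]
      linarith
    calc ((J'.image r).card : ℝ) ≤ J.card := by
          exact_mod_cast Finset.card_image_le.trans (Finset.card_filter_le _ _)
      _ = (2 * (B : ℝ) + 1) ^ d := h1
      _ ≤ ((2 * (R * (d + 1)) + 5) / δ) ^ d := by
          have : (0 : ℝ) ≤ B := by exact_mod_cast hB0
          gcongr
      _ = _ := div_pow _ _ _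

/-! ### Errors of the function and gradient estimators -/

lemma sq_funEstimator_sub_le {d n ℓ : ℕ} (K : E d → ℝ) (h lam : ℝ) (s : Finset (Fin n))
    (x : Fin n → E d) (y : Fin n → ℝ) (z : E d) (f : E d → ℝ) :
    (funEstimator ℓ K h lam s x y z - f z) ^ 2 ≤ ∑ m : MultiIndex d ℓ,
      (localPolyCoeff ℓ K h lam s x y z m
        - h ^ (∑ i, m.entry i) * mixedPartial m.entry f z) ^ 2 := by
  have h1 : funEstimator ℓ K h lam s x y z
      = localPolyCoeff ℓ K h lam s x y z (zeroIndex d ℓ) := by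
    rw [funEstimator, dotProduct, Finset.sum_eq_single (zeroIndex d ℓ)]
    · rw [monomialVec, entry_zeroIndex, scaledMonomial_zero_index, one_mul]
    · intro m _ hm
      rw [monomialVec, scaledMonomial_at_zero, zero_mul]
      rw [← entry_zeroIndex d ℓ]
      exact fun h => hm (MultiIndex.entry_injective h)
    · simp
  have h2 : h ^ (∑ i, (zeroIndex d ℓ).entry i) * mixedPartial (zeroIndex d ℓ).entry f z = f z := by
    rw [entry_zeroIndex, mixedPartial_zero]
    simp
  rw [h1]
  nth_rewrite 1 [← h2]
  exact Finset.single_le_sum (f := fun m : MultiIndex d ℓ =>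
    (localPolyCoeff ℓ K h lam s x y z m - h ^ (∑ i, m.entry i) * mixedPartial m.entry f z) ^ 2)
    (fun _ _ => sq_nonneg _) (Finset.mem_univ _)

/-- The multi-index with a single entry `1`, at the place `j`. -/
lemma exists_firstOrderIndex {d ℓ : ℕ} (hℓ : 1 ≤ ℓ) :
    ∃ e : Fin d → MultiIndex d ℓ, Function.Injective e ∧ ∀ j, (e j).entry = Pi.single j 1 := by
  have : ∀ j : Fin d, ∃ m : MultiIndex d ℓ, m.entry = Pi.single j 1 := fun j =>
    MultiIndex.exists_entry_eq (by simpa using hℓ)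
  choose e he using this
  refine ⟨e, fun i j hij => ?_, he⟩
  have h1 : (Pi.single i 1 : Fin d → ℕ) = Pi.single j 1 := by rw [← he, ← he, hij]
  by_contra hne
  have := congrFun h1 i
  simp [hne] at this

lemma gradEstimator_apply {d n ℓ : ℕ} (K : E d → ℝ) (h lam : ℝ) (s : Finset (Fin n))
    (x : Fin n → E d) (y : Fin n → ℝ) (z : E d) {j : Fin d} {m : MultiIndex d ℓ}
    (hm : m.entry = Pi.single j 1) :
    gradEstimator ℓ K h lam s x y z j = h⁻¹ * localPolyCoeff ℓ K h lam s x y z m := by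
  simp only [gradEstimator, Pi.smul_apply, smul_eq_mul, Matrix.mulVec, dotProduct, gradSelector]
  congr 1
  rw [Finset.sum_eq_single m]
  · simp [hm]
  · intro m' _ hne
    rw [if_neg, zero_mul]
    rw [← hm]
    exact fun h => hne (MultiIndex.entry_injective h)
  · simp

lemma sq_norm_gradEstimator_sub_le {d n ℓ : ℕ} (hℓ : 1 ≤ ℓ) (K : E d → ℝ) {h : ℝ} (hh : 0 < h)
    (lam : ℝ) (s : Finset (Fin n)) (x : Fin n → E d) (y : Fin n → ℝ) (z : E d) {f : E d → ℝ}
    (hf : Differentiable ℝ f) :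
    ‖∇ f z - gradEstimator ℓ K h lam s x y z‖ ^ 2 ≤ (h ^ 2)⁻¹ * ∑ m : MultiIndex d ℓ,
      (localPolyCoeff ℓ K h lam s x y z m
        - h ^ (∑ i, m.entry i) * mixedPartial m.entry f z) ^ 2 := by
  classical
  obtain ⟨e, hinj, he⟩ := exists_firstOrderIndex (d := d) hℓ
  rw [EuclideanSpace.norm_sq_eq]
  have h1 : ∀ j, ‖(∇ f z - gradEstimator ℓ K h lam s x y z) j‖ ^ 2
      = (h ^ 2)⁻¹ * (localPolyCoeff ℓ K h lam s x y z (e j)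
        - h ^ (∑ i, (e j).entry i) * mixedPartial (e j).entry f z) ^ 2 := by
    intro j
    rw [PiLp.sub_apply, gradEstimator_apply K h lam s x y z (he j), he j, mixedPartial_single,
      partialDeriv_eq_gradient (hf z), Real.norm_eq_abs, sq_abs]
    simp only [Finset.sum_pi_single', Finset.mem_univ, if_true, pow_one]
    field_simp
    ring
  simp only [h1]
  rw [← Finset.mul_sum, ← Finset.sum_image (s := Finset.univ) (g := e) (f := fun m =>
    (localPolyCoeff ℓ K h lam s x y z m
        - h ^ (∑ i, m.entry i) * mixedPartial m.entry f z) ^ 2) (fun _ _ _ _ h => hinj h)]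
  refine mul_le_mul_of_nonneg_left ?_ (by positivity)
  exact Finset.sum_le_sum_of_subset_of_nonneg (Finset.subset_univ _) fun _ _ _ => sq_nonneg _

lemma sq_norm_gradient_le {d ℓ : ℕ} (hℓ : 1 ≤ ℓ) {f : E d → ℝ} (hf : Differentiable ℝ f)
    (z : E d) : ‖∇ f z‖ ^ 2 ≤ ∑ m : MultiIndex d ℓ, mixedPartial m.entry f z ^ 2 := by
  classical
  obtain ⟨e, hinj, he⟩ := exists_firstOrderIndex (d := d) hℓ
  rw [EuclideanSpace.norm_sq_eq]
  have h1 : ∀ j, ‖(∇ f z) j‖ ^ 2 = mixedPartial (e j).entry f z ^ 2 := by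
    intro j
    rw [he j, mixedPartial_single, partialDeriv_eq_gradient (hf z), Real.norm_eq_abs, sq_abs]
  simp only [h1]
  rw [← Finset.sum_image (s := Finset.univ) (g := e) (f := fun m => mixedPartial m.entry f z ^ 2)
    (fun _ _ _ _ h => hinj h)]
  exact Finset.sum_le_sum_of_subset_of_nonneg (Finset.subset_univ _) fun _ _ _ => sq_nonneg _

/-! ### Projected gradient descent -/

section Descent

variable {d : ℕ} {Θ : Set (E d)}

lemma proj_spec (hne : Θ.Nonempty) (hc : IsCompact Θ) (x : E d) :
    proj Θ x ∈ Θ ∧ ∀ q ∈ Θ, ‖x - proj Θ x‖ ≤ ‖x - q‖ := by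
  obtain ⟨p, hp, hmin⟩ := hc.exists_isMinOn hne
    (f := fun q => ‖x - q‖) (by fun_prop)
  exact Classical.epsilon_spec (p := fun p => p ∈ Θ ∧ ∀ q ∈ Θ, ‖x - p‖ ≤ ‖x - q‖)
    ⟨p, hp, fun q hq => hmin hq⟩

lemma inner_proj_le_zero (hne : Θ.Nonempty) (hc : IsCompact Θ) (hconv : Convex ℝ Θ) (x : E d)
    {q : E d} (hq : q ∈ Θ) : inner ℝ (x - proj Θ x) (q - proj Θ x) ≤ 0 := by
  obtain ⟨h1, h2⟩ := proj_spec hne hc x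
  refine (norm_eq_iInf_iff_real_inner_le_zero hconv h1).mp ?_ q hq
  have : Nonempty Θ := ⟨⟨_, h1⟩⟩
  refine le_antisymm (le_ciInf fun w => h2 w w.2) ?_
  exact ciInf_le ⟨0, by rintro _ ⟨w, rfl⟩; exact norm_nonneg _⟩ (⟨_, h1⟩ : Θ)

lemma sq_norm_proj_sub_le (hne : Θ.Nonempty) (hc : IsCompact Θ) (hconv : Convex ℝ Θ) (x : E d)
    {q : E d} (hq : q ∈ Θ) : ‖proj Θ x - q‖ ^ 2 ≤ ‖x - q‖ ^ 2 := by
  have h1 := inner_proj_le_zero hne hc hconv x hq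
  have h2 : x - q = (x - proj Θ x) - (q - proj Θ x) := by abel
  rw [h2, norm_sub_sq_real (x - proj Θ x), norm_sub_rev (proj Θ x) q]
  nlinarith [sq_nonneg ‖x - proj Θ x‖]

lemma continuous_proj (hne : Θ.Nonempty) (hc : IsCompact Θ) (hconv : Convex ℝ Θ) :
    Continuous (proj Θ) := by
  refine (LipschitzWith.of_dist_le_mul (K := 1) fun x y => ?_).continuous
  rw [NNReal.coe_one, one_mul, dist_eq_norm, dist_eq_norm]
  have h1 := inner_proj_le_zero hne hc hconv x (proj_spec hne hc y).1
  have h2 := inner_proj_le_zero hne hc hconv y (proj_spec hne hc x).1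
  set p := proj Θ x
  set q := proj Θ y
  have h3 : ‖p - q‖ ^ 2 ≤ inner ℝ (x - y) (p - q) := by
    have e1 : inner ℝ (x - p) (q - p) = - inner ℝ (x - p) (p - q) := by
      rw [← inner_neg_right, neg_sub]
    have e2 : inner ℝ (x - y) (p - q)
        = inner ℝ (x - p) (p - q) + inner ℝ (p - q) (p - q) - inner ℝ (y - q) (p - q) := by
      rw [← inner_add_left, ← inner_sub_left]
      congr 1
      abel
    rw [e2, real_inner_self_eq_norm_sq]
    linarith
  have h4 := h3.trans (real_inner_le_norm (x - y) (p - q))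
  rcases (norm_nonneg (p - q)).eq_or_lt with h0 | h0
  · rw [← h0]; exact norm_nonneg _
  · rw [sq] at h4
    exact le_of_mul_le_mul_right h4 h0

/-- Projected gradient descent with step sizes `2 / (α k)` on a strongly convex function: the value
at the averaged iterate in terms of the errors of the gradient estimates `g k`, of which nothing
else is assumed. The iterates are counted from `0`, so the step from `z k` has index `k + 1`. -/
lemma value_average_sub_le {α G2 : ℝ} (hα : 0 < α) (hc : IsCompact Θ)
    (hconv : Convex ℝ Θ) {f : E d → ℝ} {xstar : E d} (hx : xstar ∈ Θ)
    (hsc : ∀ x ∈ Θ, ∀ y ∈ Θ, f x + inner ℝ (∇ f x) (y - x) + α / 2 * ‖x - y‖ ^ 2 ≤ f y)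
    (hG : ∀ x ∈ Θ, ‖∇ f x‖ ^ 2 ≤ G2) {z g : ℕ → E d} (hz : ∀ k, z k ∈ Θ)
    (hstep : ∀ k, z (k + 1) = proj Θ (z k - (2 / (α * ((k + 1 : ℕ) : ℝ))) • g k))
    {m : ℕ} (hm : 0 < m) :
    (1 / (m : ℝ)) • ∑ k ∈ Finset.range m, z k ∈ Θ ∧
    f ((1 / (m : ℝ)) • ∑ k ∈ Finset.range m, z k) - f xstar
      ≤ α⁻¹ * ((1 / (m : ℝ)) * ∑ k ∈ Finset.range m,
        (3 * ‖∇ f (z k) - g k‖ ^ 2 + 2 * G2 / ((k + 1 : ℕ) : ℝ))) := by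
  have hne : Θ.Nonempty := ⟨_, hx⟩
  have hm' : (0 : ℝ) < m := by exact_mod_cast hm
  set zb := (1 / (m : ℝ)) • ∑ k ∈ Finset.range m, z k with hzb
  have hzbmem : zb ∈ Θ := by
    rw [hzb, Finset.smul_sum]
    refine hconv.sum_mem (fun _ _ => by positivity) ?_ fun k _ => hz k
    rw [Finset.sum_const, Finset.card_range, nsmul_eq_mul]
    field_simp
  refine ⟨hzbmem, ?_⟩
  -- Jensen's inequality, from the gradient inequality at the average
  have hjensen : m * f zb ≤ ∑ k ∈ Finset.range m, f (z k) := by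
    have h1 : ∀ k ∈ Finset.range m, f zb + inner ℝ (∇ f zb) (z k - zb) ≤ f (z k) := fun k _ => by
      have := hsc zb hzbmem (z k) (hz k)
      have h2 : 0 ≤ α / 2 * ‖zb - z k‖ ^ 2 := by positivity
      linarith
    have h2 := Finset.sum_le_sum h1
    rw [Finset.sum_add_distrib, ← inner_sum, Finset.sum_sub_distrib, Finset.sum_const,
      Finset.sum_const, Finset.card_range, nsmul_eq_mul] at h2
    have h3 : ∑ k ∈ Finset.range m, z k - m • zb = 0 := by
      rw [hzb, ← Nat.cast_smul_eq_nsmul ℝ, smul_smul, mul_one_div_cancel hm'.ne', one_smul,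
        sub_self]
    rw [h3, inner_zero_right, add_zero] at h2
    exact h2
  -- the last difference telescopes, the weights being proportional to the
  -- inverse step sizes
  have hstepineq : ∀ k, f (z k) - f xstar ≤ α⁻¹ * (3 * ‖∇ f (z k) - g k‖ ^ 2
      + 2 * G2 / ((k + 1 : ℕ) : ℝ))
      + (α / 4 * (k * ‖z k - xstar‖ ^ 2)
        - α / 4 * (((k + 1 : ℕ) : ℝ) * ‖z (k + 1) - xstar‖ ^ 2)) := by
    intro k
    set κ : ℝ := ((k + 1 : ℕ) : ℝ) with hκ
    have hκ1 : 1 ≤ κ := by rw [hκ]; push_cast; linarith [(Nat.cast_nonneg k : (0 : ℝ) ≤ k)]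
    have hk : (k : ℝ) = κ - 1 := by rw [hκ]; push_cast; ring
    have h1 := hsc (z k) (hz k) xstar hx
    have h2 := sq_norm_proj_sub_le hne hc hconv (z k - (2 / (α * κ)) • g k) hx
    rw [← hstep k] at h2
    have h3 : z k - (2 / (α * κ)) • g k - xstar = (z k - xstar) - (2 / (α * κ)) • g k := by abel
    rw [h3, norm_sub_sq_real (z k - xstar), inner_smul_right, norm_smul, mul_pow,
      Real.norm_eq_abs, sq_abs] at h2
    set a := ‖z k - xstar‖ ^ 2 with ha
    set a' := ‖z (k + 1) - xstar‖ ^ 2 with ha'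
    set b2 := ‖∇ f (z k) - g k‖ ^ 2 with hb2
    have h4 : inner ℝ (∇ f (z k)) (xstar - z k)
        = - inner ℝ (z k - xstar) (g k) - inner ℝ (∇ f (z k) - g k) (z k - xstar) := by
      rw [real_inner_comm (g k) (z k - xstar), ← neg_sub (z k) xstar, inner_neg_right,
        inner_sub_left]
      ring
    have h5 : inner ℝ (∇ f (z k) - g k) (z k - xstar) ≤ α⁻¹ * b2 + α / 4 * a := by
      refine (real_inner_le_norm _ _).trans ?_
      have h6 : 0 ≤ α⁻¹ * (‖∇ f (z k) - g k‖ - α / 2 * ‖z k - xstar‖) ^ 2 := by positivity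
      have h7 : α⁻¹ * (‖∇ f (z k) - g k‖ - α / 2 * ‖z k - xstar‖) ^ 2
          = α⁻¹ * b2 - ‖∇ f (z k) - g k‖ * ‖z k - xstar‖ + α / 4 * a := by
        rw [hb2, ha]; field_simp; ring
      linarith
    have h8 : inner ℝ (z k - xstar) (g k) ≤ α * κ / 4 * (a - a') + α⁻¹ * (‖g k‖ ^ 2 / κ) := by
      have h9 := mul_le_mul_of_nonneg_left h2 (by positivity : 0 ≤ α * κ / 4)
      have h10 : α * κ / 4 * (a - 2 * (2 / (α * κ) * inner ℝ (z k - xstar) (g k))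
          + (2 / (α * κ)) ^ 2 * ‖g k‖ ^ 2)
          = α * κ / 4 * a - inner ℝ (z k - xstar) (g k) + α⁻¹ * (‖g k‖ ^ 2 / κ) := by
        field_simp
        ring
      rw [h10] at h9
      linarith
    have h11 : ‖g k‖ ^ 2 ≤ 2 * b2 + 2 * G2 := by
      have h12 : ‖g k‖ ≤ ‖∇ f (z k) - g k‖ + ‖∇ f (z k)‖ := by
        have := norm_sub_le (∇ f (z k)) (∇ f (z k) - g k)
        rw [sub_sub_cancel] at this
        linarith
      have h13 := hG (z k) (hz k)
      have h14 := pow_le_pow_left₀ (norm_nonneg _) h12 2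
      nlinarith [sq_nonneg (‖∇ f (z k) - g k‖ - ‖∇ f (z k)‖)]
    have h15 : ‖g k‖ ^ 2 / κ ≤ 2 * b2 + 2 * G2 / κ := by
      rw [div_le_iff₀ (by positivity), add_mul, div_mul_cancel₀ _ (by positivity)]
      have : 2 * b2 * 1 ≤ 2 * b2 * κ := mul_le_mul_of_nonneg_left hκ1 (by positivity)
      linarith
    have h16 := mul_le_mul_of_nonneg_left h15 (by positivity : 0 ≤ α⁻¹)
    rw [hk]
    rw [mul_add] at h16 ⊢
    linarith
  have hsum := Finset.sum_le_sum fun k (_ : k ∈ Finset.range m) => hstepineq k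
  rw [Finset.sum_add_distrib, ← Finset.mul_sum, Finset.sum_sub_distrib, Finset.sum_const,
    Finset.card_range, nsmul_eq_mul,
    Finset.sum_range_sub' (fun k : ℕ => α / 4 * ((k : ℝ) * ‖z k - xstar‖ ^ 2))] at hsum
  have hlast : 0 ≤ α / 4 * ((m : ℝ) * ‖z m - xstar‖ ^ 2) := by positivity
  simp only [Nat.cast_zero, zero_mul, mul_zero] at hsum
  have hfin : m * (f zb - f xstar) ≤ α⁻¹ * ∑ k ∈ Finset.range m,
        (3 * ‖∇ f (z k) - g k‖ ^ 2 + 2 * G2 / ((k + 1 : ℕ) : ℝ)) := by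
    rw [mul_sub]
    linarith
  rw [mul_left_comm, one_div, ← div_eq_inv_mul, le_div_iff₀ hm', mul_comm]
  exact hfin

end Descent

/-! ### Measurability -/

section Measurability

variable {d n : ℕ} {α : Type*} [MeasurableSpace α]

lemma continuous_kernelAvg {K : E d → ℝ} (hK : Continuous K) (h : ℝ) (s : Finset (Fin n)) :
    Continuous fun q : (Fin n → E d) × (Fin n → ℝ) × E d => kernelAvg h s q.1 q.2.1 K q.2.2 := by
  have h1 : ∀ i : Fin n, Continuous fun q : (Fin n → E d) × (Fin n → ℝ) × E d =>
      K (h⁻¹ • (q.1 i - q.2.2)) := fun i => hK.comp (by fun_prop)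
  unfold kernelAvg
  fun_prop

/-- Measurability holds across singular matrices, at which `⁻¹` is `0` by convention. -/
lemma measurable_inv_mulVec {ι γ : Type*} [Fintype ι] [DecidableEq ι] [TopologicalSpace γ]
    [MeasurableSpace γ] [OpensMeasurableSpace γ] {B : γ → Matrix ι ι ℝ} {D : γ → ι → ℝ}
    (hB : Continuous B) (hD : Continuous D) (m : ι) :
    Measurable fun q => ((B q)⁻¹.mulVec (D q)) m := by
  have heq : ∀ q, ((B q)⁻¹.mulVec (D q)) m = (B q).det⁻¹ * ((B q).adjugate.mulVec (D q)) m := by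
    intro q
    rw [Matrix.inv_def, Ring.inverse_eq_inv', Matrix.smul_mulVec]
    rfl
  simp only [heq]
  have hdet : Measurable fun q => (B q).det⁻¹ := hB.matrix_det.measurable.inv
  have hadj : Continuous fun q => ((B q).adjugate.mulVec (D q)) m :=
    (continuous_apply m).comp (hB.matrix_adjugate.matrix_mulVec hD)
  exact hdet.mul hadj.measurable

lemma measurable_localPolyCoeff {ℓ : ℕ} {K : E d → ℝ} (hK : IsKernel K) (h lam : ℝ)
    (s : Finset (Fin n)) {x : α → Fin n → E d} {y : α → Fin n → ℝ} {z : α → E d}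
    (hx : Measurable x) (hy : Measurable y) (hz : Measurable z) (m : MultiIndex d ℓ) :
    Measurable fun ω => localPolyCoeff ℓ K h lam s (x ω) (y ω) (z ω) m := by
  have hG : Continuous fun q : (Fin n → E d) × (Fin n → ℝ) × E d =>
      gramMatrix ℓ K h s q.1 q.2.2 := by
    refine continuous_matrix fun m m' => ?_
    simp only [gramMatrix_apply]
    exact (continuous_kernelAvg (continuous_weightedProduct hK m.entry m'.entry) h s).comp
      (by fun_prop : Continuous fun q : (Fin n → E d) × (Fin n → ℝ) × E d =>
        (q.1, (fun _ : Fin n => (1 : ℝ)), q.2.2))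
  have hD : Continuous fun q : (Fin n → E d) × (Fin n → ℝ) × E d =>
      responseVec ℓ K h s q.1 q.2.1 q.2.2 := continuous_pi fun m => by
    simp only [responseVec_apply]
    exact continuous_kernelAvg (continuous_weightedMonomial hK m.entry) h s
  have hB : Continuous fun q : (Fin n → E d) × (Fin n → ℝ) × E d =>
      gramMatrix ℓ K h s q.1 q.2.2 + lam • (1 : Matrix (MultiIndex d ℓ) (MultiIndex d ℓ) ℝ) :=
    hG.add continuous_const
  have hmain : Measurable fun q : (Fin n → E d) × (Fin n → ℝ) × E d =>
      localPolyCoeff ℓ K h lam s q.1 q.2.1 q.2.2 m := by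
    unfold localPolyCoeff
    exact measurable_inv_mulVec hB hD m
  have hp : Measurable fun ω => (x ω, y ω, z ω) := hx.prodMk (hy.prodMk hz)
  have hcomp := hmain.comp hp
  simp only [Function.comp_def] at hcomp
  exact hcomp

lemma measurable_funEstimator {ℓ : ℕ} {K : E d → ℝ} (hK : IsKernel K) (h lam : ℝ)
    (s : Finset (Fin n)) {x : α → Fin n → E d} {y : α → Fin n → ℝ} {z : α → E d}
    (hx : Measurable x) (hy : Measurable y) (hz : Measurable z) :
    Measurable fun ω => funEstimator ℓ K h lam s (x ω) (y ω) (z ω) := by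
  unfold funEstimator dotProduct
  exact Finset.measurable_fun_sum _ fun m _ =>
    (measurable_localPolyCoeff hK h lam s hx hy hz m).const_mul _

lemma measurable_gradEstimator {ℓ : ℕ} {K : E d → ℝ} (hK : IsKernel K) (h lam : ℝ)
    (s : Finset (Fin n)) {x : α → Fin n → E d} {y : α → Fin n → ℝ} {z : α → E d}
    (hx : Measurable x) (hy : Measurable y) (hz : Measurable z) :
    Measurable fun ω => gradEstimator ℓ K h lam s (x ω) (y ω) (z ω) := by
  unfold gradEstimator
  refine (PiLp.continuous_toLp 2 _).measurable.comp (measurable_pi_lambda _ fun j => ?_)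
  simp only [Pi.smul_apply, smul_eq_mul, Matrix.mulVec, dotProduct]
  exact (Finset.measurable_fun_sum _ fun m _ =>
    (measurable_localPolyCoeff hK h lam s hx hy hz m).const_mul _).const_mul _

variable {Θ : Set (E d)} {β a : ℝ} {K : E d → ℝ} {z1 : E d}

lemma iterate_mem (hc : IsCompact Θ) (hz1 : z1 ∈ Θ) (x : Fin n → E d) (y : Fin n → ℝ) (k : ℕ) :
    iterate Θ β a K z1 x y k ∈ Θ := by
  cases k with
  | zero => exact hz1
  | succ k => exact (proj_spec ⟨z1, hz1⟩ hc _).1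

lemma measurable_iterate (hc : IsCompact Θ) (hconv : Convex ℝ Θ) (hK : IsKernel K) (hz1 : z1 ∈ Θ)
    {x : α → Fin n → E d} {y : α → Fin n → ℝ} (hx : Measurable x) (hy : Measurable y) (k : ℕ) :
    Measurable fun ω => iterate Θ β a K z1 (x ω) (y ω) k := by
  induction k with
  | zero => exact measurable_const
  | succ k ih =>
    refine (continuous_proj ⟨z1, hz1⟩ hc hconv).measurable.comp (ih.sub ?_)
    exact (measurable_gradEstimator hK _ _ _ hx hy ih).const_smul
      (2 / (a * ((k + 1 : ℕ) : ℝ)))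

lemma measurable_averagedIterate (hc : IsCompact Θ) (hconv : Convex ℝ Θ) (hK : IsKernel K)
    (hz1 : z1 ∈ Θ) {x : α → Fin n → E d} {y : α → Fin n → ℝ} (hx : Measurable x)
    (hy : Measurable y) (m : ℕ) :
    Measurable fun ω => averagedIterate Θ β a K z1 (x ω) (y ω) m := by
  unfold averagedIterate
  exact (Finset.measurable_fun_sum _ fun k _ =>
    measurable_iterate hc hconv hK hz1 hx hy k).const_smul (1 / (m : ℝ))

end Measurability

/-! ### Dependence on the two halves of the data -/

section Halves

variable {d n : ℕ}

lemma kernelAvg_congr {h : ℝ} {s : Finset (Fin n)} {x x' : Fin n → E d} {w w' : Fin n → ℝ}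
    (hx : ∀ i ∈ s, x i = x' i) (hw : ∀ i ∈ s, w i = w' i) (g : E d → ℝ) (z : E d) :
    kernelAvg h s x w g z = kernelAvg h s x' w' g z := by
  unfold kernelAvg
  congr 1
  exact Finset.sum_congr rfl fun i hi => by rw [hx i hi, hw i hi]

lemma localPolyCoeff_congr {ℓ : ℕ} {K : E d → ℝ} {h lam : ℝ} {s : Finset (Fin n)}
    {x x' : Fin n → E d} {y y' : Fin n → ℝ} (hx : ∀ i ∈ s, x i = x' i)
    (hy : ∀ i ∈ s, y i = y' i) (z : E d) :
    localPolyCoeff ℓ K h lam s x y z = localPolyCoeff ℓ K h lam s x' y' z := by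
  have h1 : gramMatrix ℓ K h s x z = gramMatrix ℓ K h s x' z := by
    ext m m'
    rw [gramMatrix_apply, gramMatrix_apply, kernelAvg_congr hx fun _ _ => rfl]
  have h2 : responseVec ℓ K h s x y z = responseVec ℓ K h s x' y' z := by
    ext m
    rw [responseVec_apply, responseVec_apply, kernelAvg_congr hx hy]
  rw [localPolyCoeff, localPolyCoeff, h1, h2]

/-- The `k`-th iterate, counted from `0`, is a function of the first `k` observations. -/
lemma iterate_congr {Θ : Set (E d)} {β a : ℝ} {K : E d → ℝ} {z1 : E d} {x x' : Fin n → E d}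
    {y y' : Fin n → ℝ} {k : ℕ} (hx : ∀ i ∈ firstObs n k, x i = x' i)
    (hy : ∀ i ∈ firstObs n k, y i = y' i) :
    iterate Θ β a K z1 x y k = iterate Θ β a K z1 x' y' k := by
  induction k with
  | zero => rfl
  | succ k ih =>
    have hsub : ∀ i ∈ firstObs n k, i ∈ firstObs n (k + 1) := fun i hi => by
      simp only [firstObs, Finset.mem_filter, Finset.mem_univ, true_and] at hi ⊢
      omega
    rw [iterate, iterate, ih (fun i hi => hx i (hsub i hi)) (fun i hi => hy i (hsub i hi))]
    simp only [gradEstimator]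
    rw [localPolyCoeff_congr hx hy]

lemma averagedIterate_congr {Θ : Set (E d)} {β a : ℝ} {K : E d → ℝ} {z1 : E d}
    {x x' : Fin n → E d} {y y' : Fin n → ℝ} {m : ℕ} (hx : ∀ i ∈ firstObs n m, x i = x' i)
    (hy : ∀ i ∈ firstObs n m, y i = y' i) :
    averagedIterate Θ β a K z1 x y m = averagedIterate Θ β a K z1 x' y' m := by
  unfold averagedIterate
  congr 1
  refine Finset.sum_congr rfl fun k hk => ?_
  have hsub : ∀ i ∈ firstObs n k, i ∈ firstObs n m := fun i hi => by
    simp only [firstObs, Finset.mem_filter, Finset.mem_univ, true_and] at hi ⊢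
    have := Finset.mem_range.mp hk
    omega
  exact iterate_congr (fun i hi => hx i (hsub i hi)) (fun i hi => hy i (hsub i hi))

/-- An average over independent variables `Z`, `D` is bounded by the worst fixed value of `Z`. -/
lemma meanLE_of_indepFun {Ω α γ : Type*} [MeasurableSpace Ω] [MeasurableSpace α]
    [MeasurableSpace γ] {μ : Measure Ω} [IsProbabilityMeasure μ] {Z : Ω → α} {D : Ω → γ}
    (hZ : Measurable Z) (hD : Measurable D) (hind : IndepFun Z D μ) {F : α → γ → ℝ}
    (hF : Measurable (Function.uncurry F)) (hF0 : ∀ z q, 0 ≤ F z q) {T : Set α}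
    (hT : ∀ ω, Z ω ∈ T) {c : ℝ} (hc : ∀ z ∈ T, MeanLE μ (fun ω => F z (D ω)) c) :
    MeanLE μ (fun ω => F (Z ω) (D ω)) c := by
  obtain ⟨ω0⟩ : Nonempty Ω := μ.nonempty_of_neZero
  have hc0 : 0 ≤ c := (integral_nonneg fun ω => hF0 _ _).trans (hc _ (hT ω0)).2
  have hFZ : Measurable fun ω => F (Z ω) (D ω) := hF.comp (hZ.prodMk hD)
  have hFe : Measurable (Function.uncurry fun z q => ENNReal.ofReal (F z q)) := hF.ennreal_ofReal
  have hle : ∫⁻ ω, ENNReal.ofReal (F (Z ω) (D ω)) ∂μ ≤ ENNReal.ofReal c := by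
    have hprobD : IsProbabilityMeasure (μ.map D) := Measure.isProbabilityMeasure_map hD.aemeasurable
    have h1 : ∫⁻ ω, ENNReal.ofReal (F (Z ω) (D ω)) ∂μ
        = ∫⁻ q, ENNReal.ofReal (F q.1 q.2) ∂(μ.map fun ω => (Z ω, D ω)) :=
      (lintegral_map (f := fun q : α × γ => ENNReal.ofReal (F q.1 q.2)) hFe
        (hZ.prodMk hD)).symm
    rw [h1, (indepFun_iff_map_prod_eq_prod_map_map hZ.aemeasurable hD.aemeasurable).mp hind,
      lintegral_prod _ (by exact hFe.aemeasurable), lintegral_map (by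
        exact hFe.lintegral_prod_right) hZ]
    calc ∫⁻ ω, ∫⁻ q, ENNReal.ofReal (F (Z ω) q) ∂(μ.map D) ∂μ
        ≤ ∫⁻ _ω, ENNReal.ofReal c ∂μ := by
          refine lintegral_mono fun ω => ?_
          rw [lintegral_map (f := fun q => ENNReal.ofReal (F (Z ω) q))
            (hFe.comp measurable_prodMk_left) hD]
          have := hc (Z ω) (hT ω)
          rw [← ofReal_integral_eq_lintegral_ofReal this.1
            (Filter.Eventually.of_forall fun _ => hF0 _ _)]
          exact ENNReal.ofReal_le_ofReal this.2
      _ = ENNReal.ofReal c := by simp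
  have hi : Integrable (fun ω => F (Z ω) (D ω)) μ := by
    refine ⟨hFZ.aestronglyMeasurable, ?_⟩
    rw [hasFiniteIntegral_iff_ofReal (Filter.Eventually.of_forall fun _ => hF0 _ _)]
    exact hle.trans_lt ENNReal.ofReal_lt_top
  refine ⟨hi, ?_⟩
  rw [← ofReal_integral_eq_lintegral_ofReal hi
    (Filter.Eventually.of_forall fun _ => hF0 _ _)] at hle
  exact (ENNReal.ofReal_le_ofReal_iff hc0).mp hle

/-- Data restricted to the observations in `s`, the others being replaced by `0`. This lets
functions of part of the data be written as the given estimators, which take `n` observations. -/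
def restrictData (s : Finset (Fin n)) (q : Fin n → E d × ℝ) : Fin n → E d × ℝ :=
  fun i => if i ∈ s then q i else 0

lemma indepFun_restrictData {Ω : Type*} [MeasurableSpace Ω] {μ : Measure Ω} [IsProbabilityMeasure μ]
    {Z : Fin n → Ω → E d × ℝ} (hZ : ∀ i, Measurable (Z i)) (hind : iIndepFun Z μ)
    {s t : Finset (Fin n)} (hst : Disjoint s t) :
    IndepFun (fun ω => restrictData s fun i => Z i ω)
      (fun ω => restrictData t fun i => Z i ω) μ := by
  have key : ∀ s : Finset (Fin n), Measurable fun (q : s → E d × ℝ) (i : Fin n) =>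
      if hi : i ∈ s then q ⟨i, hi⟩ else 0 := fun s =>
    measurable_pi_lambda _ fun i => by
      by_cases hi : i ∈ s
      · simp only [hi, dite_true]
        exact measurable_pi_apply _
      · simp only [hi, dite_false]
        exact measurable_const
  have h := (hind.indepFun_finset s t hst hZ).comp (key s) (key t)
  have heq : ∀ s : Finset (Fin n), (fun (q : s → E d × ℝ) (i : Fin n) =>
      if hi : i ∈ s then q ⟨i, hi⟩ else 0) ∘ (fun (ω : Ω) (i : s) => Z i ω)
      = fun ω => restrictData s fun i => Z i ω := fun s => by
    funext ω i
    by_cases hi : i ∈ s <;> simp [restrictData, hi]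
  rwa [heq s, heq t] at h

end Halves

/-! ### Bandwidths and rates -/

section Rates

variable {β ρ : ℝ} {d : ℕ}

lemma rpow_bandwidth_pos_le_one (hβ : 2 ≤ β) (hρ : 0 < ρ) (hρ1 : ρ ≤ 1) :
    0 < ρ ^ (1 / (2 * β + d)) ∧ ρ ^ (1 / (2 * β + d)) ≤ 1 :=
  ⟨Real.rpow_pos_of_pos hρ _, Real.rpow_le_one hρ.le hρ1 (by positivity)⟩

lemma bandwidth_rpow (hρ : 0 < ρ) :
    (ρ ^ (1 / (2 * β + d))) ^ β = ρ ^ (β / (2 * β + d)) := by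
  rw [← Real.rpow_mul hρ.le]
  congr 1
  ring

lemma bandwidth_pow_mul (hβ : 2 ≤ β) (hρ : 0 < ρ) :
    (ρ ^ (1 / (2 * β + d))) ^ d * ((ρ ^ (1 / (2 * β + d))) ^ β) ^ 2 = ρ := by
  have h0 : 2 * β + d ≠ 0 := by positivity
  rw [bandwidth_rpow hρ, ← Real.rpow_natCast, ← Real.rpow_natCast, ← Real.rpow_mul hρ.le,
    ← Real.rpow_mul hρ.le, ← Real.rpow_add hρ]
  have : 1 / (2 * β + d) * (d : ℝ) + β / (2 * β + d) * ((2 : ℕ) : ℝ) = 1 := by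
    push_cast
    field_simp
    ring
  rw [this, Real.rpow_one]

lemma inv_bandwidth_sq_mul (hρ : 0 < ρ) :
    ((ρ ^ (1 / (2 * β + d))) ^ 2)⁻¹ * ((ρ ^ (1 / (2 * β + d))) ^ β) ^ 2
      = ρ ^ (2 * (β - 1) / (2 * β + d)) := by
  rw [bandwidth_rpow hρ, ← Real.rpow_natCast, ← Real.rpow_natCast, ← Real.rpow_mul hρ.le,
    ← Real.rpow_mul hρ.le, ← Real.rpow_neg hρ.le, ← Real.rpow_add hρ]
  congr 1
  push_cast
  ring

lemma le_rpow_bandwidth (hβ : 2 ≤ β) (hρ : 0 < ρ) (hρ1 : ρ ≤ 1) : ρ ≤ ρ ^ (1 / (2 * β + d)) := by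
  have h : 1 / (2 * β + d) ≤ 1 := by
    rw [div_le_one (by positivity)]
    linarith [(Nat.cast_nonneg d : (0 : ℝ) ≤ d)]
  have := Real.rpow_le_rpow_of_exponent_ge hρ hρ1 h
  rwa [Real.rpow_one] at this

end Rates

lemma half_le_log_two : 1 / 2 ≤ Real.log 2 := by linarith [Real.log_two_gt_d9]

lemma log_add_one_bounds {k : ℕ} (hk : 0 < k) :
    1 / 2 ≤ Real.log (k + 1) ∧ 0 < Real.log (k + 1) / k ∧ Real.log (k + 1) / k ≤ 1 := by
  have hk' : (1 : ℝ) ≤ k := by exact_mod_cast hk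
  have h1 : Real.log 2 ≤ Real.log (k + 1) := Real.log_le_log (by norm_num) (by linarith)
  have h2 := half_le_log_two
  refine ⟨by linarith, div_pos (by linarith) (by linarith), ?_⟩
  rw [div_le_one (by linarith)]
  have := Real.log_le_sub_one_of_pos (by linarith : (0 : ℝ) < k + 1)
  linarith

lemma sum_rpow_neg_le {γ : ℝ} (hγ0 : 0 ≤ γ) (hγ1 : γ < 1) (m : ℕ) :
    ∑ k ∈ Finset.range m, ((k + 1 : ℕ) : ℝ) ^ (-γ) ≤ (m : ℝ) ^ (1 - γ) / (1 - γ) := by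
  have h1γ : 0 < 1 - γ := by linarith
  induction m with
  | zero => simp [Real.zero_rpow h1γ.ne']
  | succ m ih =>
    rw [Finset.sum_range_succ]
    set N : ℝ := ((m + 1 : ℕ) : ℝ) with hN
    have hN1 : 1 ≤ N := by rw [hN]; exact_mod_cast Nat.le_add_left 1 m
    have hN0 : 0 < N := by linarith
    have hm : (m : ℝ) = N * (1 + -(1 / N)) := by
      rw [hN]; push_cast; field_simp; ring
    have hs : -1 ≤ -(1 / N) := by
      have : 1 / N ≤ 1 := by rw [div_le_one hN0]; exact hN1
      linarith
    -- Bernoulli's inequality for the exponent `1 - γ`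
    have h2 : (m : ℝ) ^ (1 - γ) ≤ N ^ (1 - γ) * (1 + (1 - γ) * -(1 / N)) := by
      rw [hm, Real.mul_rpow hN0.le (by linarith)]
      exact mul_le_mul_of_nonneg_left
        (rpow_one_add_le_one_add_mul_self hs h1γ.le (by linarith)) (by positivity)
    have h3 : N ^ (1 - γ) * (1 / N) = N ^ (-γ) := by
      rw [one_div, ← Real.rpow_neg_one, ← Real.rpow_add hN0]
      congr 1
      ring
    have h4 : (m : ℝ) ^ (1 - γ) ≤ N ^ (1 - γ) - (1 - γ) * N ^ (-γ) := by
      rw [← h3]; linarith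
    rw [le_div_iff₀ h1γ] at ih ⊢
    linarith

lemma card_firstObs {n k : ℕ} (hk : k ≤ n) : (firstObs n k).card = k := by
  rw [firstObs, Fin.card_filter_val_lt, min_eq_right hk]

lemma card_lastObs {n m : ℕ} (hm : m ≤ n) : (lastObs n m).card = n - m := by
  have h1 : lastObs n m = (firstObs n m)ᶜ := by
    ext i
    simp [lastObs, firstObs]
  rw [h1, Finset.card_compl, card_firstObs hm, Fintype.card_fin]

lemma disjoint_firstObs_lastObs (n m : ℕ) : Disjoint (firstObs n m) (lastObs n m) := by
  rw [Finset.disjoint_left]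
  intro i h1 h2
  simp only [firstObs, lastObs, Finset.mem_filter] at h1 h2
  omega

/-- The average of the error bounds of the gradient descent steps. As `γ < 1`, averaging
`k^(-γ)` over `k ≤ m` costs only a constant. -/
lemma average_steps_le {γ Ca G2 : ℝ} (hγ0 : 0 ≤ γ) (hγ1 : γ < 1) (hCa : 0 ≤ Ca) (hG2 : 0 ≤ G2)
    {n m : ℕ} (hm : 0 < m) (hnm : n = 2 * m) :
    1 / (m : ℝ) * ∑ k ∈ Finset.range m,
        (3 * (Ca * (Real.log (((k + 1 : ℕ) : ℝ) + 1) / ((k + 1 : ℕ) : ℝ)) ^ γ)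
          + 2 * G2 / ((k + 1 : ℕ) : ℝ))
      ≤ (3 * Ca + 4 * G2) * 2 / (1 - γ) * (Real.log n / n) ^ γ := by
  have hm' : (1 : ℝ) ≤ m := by exact_mod_cast hm
  have hn : (n : ℝ) = 2 * m := by rw [hnm]; push_cast; ring
  have h1γ : 0 < 1 - γ := by linarith
  have hlog : 1 / 2 ≤ Real.log n := half_le_log_two.trans
    (Real.log_le_log (by norm_num) (by rw [hn]; linarith))
  have hlogγ : 1 ≤ 2 * Real.log n ^ γ := by
    have h1 : (1 / 2 : ℝ) ^ γ ≤ Real.log n ^ γ := Real.rpow_le_rpow (by norm_num) hlog hγ0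
    have h2 : (1 / 2 : ℝ) ^ (1 : ℝ) ≤ (1 / 2 : ℝ) ^ γ :=
      Real.rpow_le_rpow_of_exponent_ge (by norm_num) (by norm_num) hγ1.le
    rw [Real.rpow_one] at h2
    linarith
  have hlogγ0 : 0 ≤ Real.log n ^ γ := by positivity
  have hterm : ∀ k ∈ Finset.range m,
      3 * (Ca * (Real.log (((k + 1 : ℕ) : ℝ) + 1) / ((k + 1 : ℕ) : ℝ)) ^ γ)
          + 2 * G2 / ((k + 1 : ℕ) : ℝ)
        ≤ (3 * Ca + 4 * G2) * Real.log n ^ γ * ((k + 1 : ℕ) : ℝ) ^ (-γ) := by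
    intro k hk
    have hkm : k + 1 ≤ m := Finset.mem_range.mp hk
    set κ : ℝ := ((k + 1 : ℕ) : ℝ) with hκ
    have hκ1 : 1 ≤ κ := by rw [hκ]; exact_mod_cast Nat.le_add_left 1 k
    have hκ0 : 0 < κ := by linarith
    have hκm : κ ≤ m := by rw [hκ]; exact_mod_cast hkm
    have h1 : (Real.log (κ + 1) / κ) ^ γ ≤ Real.log n ^ γ * κ ^ (-γ) := by
      rw [Real.rpow_neg hκ0.le, ← Real.inv_rpow hκ0.le, ← Real.mul_rpow (by linarith)
        (by positivity), ← div_eq_mul_inv]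
      have h0 : 0 ≤ Real.log (κ + 1) := Real.log_nonneg (by linarith)
      have hle : Real.log (κ + 1) ≤ Real.log n :=
        Real.log_le_log (by linarith) (by rw [hn]; linarith)
      exact Real.rpow_le_rpow (by positivity) (by gcongr) hγ0
    have h2 : 1 / κ ≤ 2 * Real.log n ^ γ * κ ^ (-γ) := by
      have h3 : κ ^ (-1 : ℝ) ≤ κ ^ (-γ) := Real.rpow_le_rpow_of_exponent_le hκ1 (by linarith)
      rw [Real.rpow_neg_one] at h3
      have h4 : 0 ≤ κ ^ (-γ) := by positivity
      rw [one_div]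
      nlinarith
    have h5 := mul_le_mul_of_nonneg_left h1 (by positivity : 0 ≤ 3 * Ca)
    have h6 := mul_le_mul_of_nonneg_left h2 (by positivity : 0 ≤ 2 * G2)
    have h7 : 2 * G2 / κ = 2 * G2 * (1 / κ) := by ring
    rw [h7]
    linarith
  have hsum := (Finset.sum_le_sum hterm).trans_eq (Finset.mul_sum ..).symm
  have hD0 : 0 ≤ (3 * Ca + 4 * G2) * Real.log n ^ γ := by positivity
  have h8 := hsum.trans (mul_le_mul_of_nonneg_left (sum_rpow_neg_le hγ0 hγ1 m) hD0)
  have h9 : 1 / (m : ℝ) * (m : ℝ) ^ (1 - γ) = (m : ℝ) ^ (-γ) := by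
    rw [one_div, ← Real.rpow_neg_one, ← Real.rpow_add (by linarith)]
    congr 1
    ring
  have h10 : (m : ℝ) ^ (-γ) ≤ 2 * (n : ℝ) ^ (-γ) := by
    have h11 : (m : ℝ) = 2⁻¹ * n := by rw [hn]; ring
    rw [h11, Real.mul_rpow (by norm_num) (by positivity)]
    refine mul_le_mul_of_nonneg_right ?_ (by positivity)
    rw [Real.inv_rpow (by norm_num), Real.rpow_neg (by norm_num), inv_inv]
    have := Real.rpow_le_rpow_of_exponent_le (by norm_num : (1 : ℝ) ≤ 2) hγ1.le
    rwa [Real.rpow_one] at this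
  have h12 : (Real.log n / n) ^ γ = Real.log n ^ γ * (n : ℝ) ^ (-γ) := by
    rw [Real.div_rpow (by linarith) (by positivity), Real.rpow_neg (by positivity), div_eq_mul_inv]
  calc _ ≤ 1 / (m : ℝ) * ((3 * Ca + 4 * G2) * Real.log n ^ γ * ((m : ℝ) ^ (1 - γ) / (1 - γ))) :=
        mul_le_mul_of_nonneg_left h8 (by positivity)
    _ = (3 * Ca + 4 * G2) * Real.log n ^ γ / (1 - γ) * (1 / (m : ℝ) * (m : ℝ) ^ (1 - γ)) := by
        ring
    _ ≤ (3 * Ca + 4 * G2) * Real.log n ^ γ / (1 - γ) * (2 * (n : ℝ) ^ (-γ)) := by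
        rw [h9]
        exact mul_le_mul_of_nonneg_left h10 (by positivity)
    _ = _ := by rw [h12]; ring

/-- Nets of `Θ` at the scale of `exists_localPoly_dichotomy`, of polynomial size in `1 / h`. -/
lemma exists_net_of_bandwidth {d : ℕ} {Θ : Set (E d)} (hΘ : Bornology.IsBounded Θ) {β κ : ℝ}
    (hκ : 0 < κ) :
    ∃ (A : ℕ) (C2 : ℝ), 0 ≤ C2 ∧ ∀ h : ℝ, 0 < h → h ≤ 1 → ∃ net : Finset (E d),
      (∀ z ∈ net, z ∈ Θ) ∧ (∀ z ∈ Θ, ∃ z0 ∈ net, ‖z - z0‖ ≤ κ * (h ^ (d + 1) * h ^ β)) ∧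
      (net.card : ℝ) ≤ C2 / h ^ A := by
  obtain ⟨C, hC0, hC⟩ := exists_net hΘ
  have hmin : 0 < min κ 1 := lt_min hκ one_pos
  refine ⟨(d + 1 + ⌈β⌉₊) * d, C / (min κ 1) ^ d, by positivity, fun h hh hh1 => ?_⟩
  obtain ⟨net, h1, h2, h3⟩ := hC (min κ 1 * h ^ (d + 1 + ⌈β⌉₊)) (by positivity)
    (mul_le_one₀ (min_le_right _ _) (by positivity) (pow_le_one₀ hh.le hh1))
  refine ⟨net, h1, fun z hz => ?_, h3.trans_eq ?_⟩
  · obtain ⟨z0, hz0, hle⟩ := h2 z hz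
    refine ⟨z0, hz0, hle.trans ?_⟩
    have h4 : h ^ ⌈β⌉₊ ≤ h ^ β := by
      rw [← Real.rpow_natCast]
      exact Real.rpow_le_rpow_of_exponent_ge hh hh1 (Nat.le_ceil β)
    rw [pow_add]
    exact mul_le_mul (min_le_left _ _) (mul_le_mul_of_nonneg_left h4 (by positivity))
      (by positivity) hκ.le
  · rw [mul_pow, ← pow_mul, div_div]

/-! ### The risk bound -/

/-- Uniform bound over `Θ` for the coefficients used at the `k`-th step of the gradient descent, and
pointwise bound for those used in the second stage. -/
lemma exists_stage_bounds {d : ℕ} {β L M pmin pmax σ : ℝ} (hβ : 2 ≤ β) (hL : 0 < L)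
    (hpmin : 0 < pmin) (hσ : 0 < σ) {Θ : Set (E d)} (hΘ : Bornology.IsBounded Θ) {K : E d → ℝ}
    (hK : IsKernel K) :
    ∃ C : ℝ, 0 ≤ C ∧
      ∀ (n : ℕ) (f : E d → ℝ), HolderClass β L f → (∀ x ∈ enlarge Θ, |f x| ≤ M) →
      ∀ (Ω : Type*) [MeasurableSpace Ω] (μ : Measure Ω) [IsProbabilityMeasure μ]
        (X : Fin n → Ω → E d) (ξ : Fin n → Ω → ℝ),
        IsDesign μ Θ pmin pmax X → IsNoise μ σ X ξ →
      (∀ k : ℕ, 0 < k → k ≤ n → ∃ Q : Ω → ℝ,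
        MeanLE μ Q (C * ((bandwidth d β k) ^ β) ^ 2) ∧ ∀ ω, ∀ z ∈ Θ,
          ∑ m : MultiIndex d (strictFloor β),
            (localPolyCoeff (strictFloor β) K (bandwidth d β k) (regularization d β k)
                (firstObs n k) (fun i => X i ω) (fun i => f (X i ω) + ξ i ω) z m
              - bandwidth d β k ^ (∑ i, m.entry i) * mixedPartial m.entry f z) ^ 2 ≤ Q ω) ∧
      (0 < n → Even n → ∀ z ∈ Θ, ∃ Q : Ω → ℝ,
        MeanLE μ Q (C * ((n : ℝ) ^ (-(β / (2 * β + d)))) ^ 2) ∧ ∀ ω,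
          ∑ m : MultiIndex d (strictFloor β),
            (localPolyCoeff (strictFloor β) K ((n : ℝ) ^ (-(1 / (2 * β + d))))
                ((n : ℝ) ^ (-(β / (2 * β + d)))) (lastObs n (n / 2)) (fun i => X i ω)
                (fun i => f (X i ω) + ξ i ω) z m
              - ((n : ℝ) ^ (-(1 / (2 * β + d)))) ^ (∑ i, m.entry i)
                * mixedPartial m.entry f z) ^ 2 ≤ Q ω) := by
  obtain ⟨κ, hκ, hunif⟩ := exists_uniform_error_bound (M := M) (pmax := pmax) (Θ := Θ) hβ hL hpmin
    hσ hK
  obtain ⟨A, C2, hC2, hnets⟩ := exists_net_of_bandwidth (β := β) hΘ hκ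
  obtain ⟨Ca, hCa, h1⟩ := hunif A A (C2 * 2 ^ A) (Nat.cast_nonneg A) (by positivity)
  obtain ⟨Cb, hCb, h2⟩ := hunif 0 0 1 le_rfl zero_le_one
  refine ⟨Ca + Cb, by positivity, fun n f hf hfM Ω _ μ _ X ξ hX hξ => ⟨?_, ?_⟩⟩
  · intro k hk hkn
    obtain ⟨hlog, hρ, hρ1⟩ := log_add_one_bounds hk
    set ρ : ℝ := Real.log (k + 1) / k with hρdef
    have hb : bandwidth d β k = ρ ^ (1 / (2 * β + d)) := rfl
    have hr : regularization d β k = (bandwidth d β k) ^ β := by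
      rw [hb, bandwidth_rpow hρ]; rfl
    obtain ⟨hh, hh1⟩ := rpow_bandwidth_pos_le_one (d := d) hβ hρ hρ1
    rw [← hb] at hh hh1
    have hcard : ((firstObs n k).card : ℝ) = k := by rw [card_firstObs hkn]
    have hne : (firstObs n k).Nonempty := by
      rw [← Finset.card_pos, card_firstObs hkn]; exact hk
    have hk' : (0 : ℝ) < k := by exact_mod_cast hk
    have hΛ : ((firstObs n k).card : ℝ) * bandwidth d β k ^ d * (bandwidth d β k ^ β) ^ 2
        = Real.log (k + 1) := by
      rw [hcard, mul_assoc, hb, bandwidth_pow_mul hβ hρ, hρdef]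
      field_simp
    obtain ⟨net, hnet1, hnet2, hnet3⟩ := hnets (bandwidth d β k) hh hh1
    have hexp : C2 / bandwidth d β k ^ A ≤ C2 * 2 ^ A * Real.exp (A * Real.log (k + 1)) := by
      have hk1 : (0 : ℝ) < k + 1 := by positivity
      rw [mul_comm (A : ℝ), Real.exp_mul, Real.exp_log hk1, Real.rpow_natCast, mul_assoc, ← mul_pow,
        div_eq_mul_inv, ← inv_pow]
      refine mul_le_mul_of_nonneg_left (pow_le_pow_left₀ (by positivity) ?_ A) hC2
      have h3 : ρ ≤ bandwidth d β k := le_rpow_bandwidth hβ hρ hρ1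
      have h4 : (2 * ((k : ℝ) + 1))⁻¹ ≤ ρ := by
        rw [hρdef, inv_eq_one_div, div_le_div_iff₀ (by positivity) hk']
        nlinarith
      rw [inv_le_comm₀ hh (by positivity)]
      exact h4.trans h3
    obtain ⟨Q, hQ, hQle⟩ := h1 n f hf hfM Ω μ X ξ hX hξ (firstObs n k) (bandwidth d β k) hne hh hh1
      (by rw [hΛ]; exact hlog) Θ net subset_rfl hnet1 hnet2
      (hnet3.trans (by gcongr; exact le_mul_of_one_le_right hC2 (one_le_pow₀ one_le_two)))
      (by rw [hΛ]; exact hnet3.trans hexp)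
    refine ⟨Q, hQ.mono ?_, ?_⟩
    · gcongr; linarith
    · rw [hr]; exact hQle
  · intro hn heven z hz
    have hn' : (1 : ℝ) ≤ n := by exact_mod_cast hn
    have hn0 : (0 : ℝ) < n := by linarith
    have hρ : 0 < (n : ℝ)⁻¹ := by positivity
    have hρ1 : (n : ℝ)⁻¹ ≤ 1 := inv_le_one_of_one_le₀ hn'
    have hb : (n : ℝ) ^ (-(1 / (2 * β + d))) = ((n : ℝ)⁻¹) ^ (1 / (2 * β + d)) := by
      rw [Real.rpow_neg hn0.le, Real.inv_rpow hn0.le]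
    have hr : (n : ℝ) ^ (-(β / (2 * β + d))) = ((n : ℝ) ^ (-(1 / (2 * β + d)))) ^ β := by
      rw [hb, bandwidth_rpow hρ, Real.rpow_neg hn0.le, Real.inv_rpow hn0.le]
    obtain ⟨hh, hh1⟩ := rpow_bandwidth_pos_le_one (d := d) hβ hρ hρ1
    rw [← hb] at hh hh1
    obtain ⟨m, hm⟩ := heven
    have hcard' : (lastObs n (n / 2)).card = m := by
      rw [card_lastObs (Nat.div_le_self n 2)]; omega
    have hcard : ((lastObs n (n / 2)).card : ℝ) = n / 2 := by
      rw [hcard', hm]; push_cast; ring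
    have hne : (lastObs n (n / 2)).Nonempty := by
      rw [← Finset.card_pos, hcard']; omega
    have hΛ : ((lastObs n (n / 2)).card : ℝ) * ((n : ℝ) ^ (-(1 / (2 * β + d)))) ^ d
        * (((n : ℝ) ^ (-(1 / (2 * β + d)))) ^ β) ^ 2 = 1 / 2 := by
      rw [hcard, mul_assoc, hb, bandwidth_pow_mul hβ hρ]
      field_simp
    obtain ⟨Q, hQ, hQle⟩ := h2 n f hf hfM Ω μ X ξ hX hξ (lastObs n (n / 2))
      ((n : ℝ) ^ (-(1 / (2 * β + d)))) hne hh hh1 hΛ.ge {z} {z} (by simpa using hz)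
      (by simpa using hz) (fun w hw => ⟨z, by simp, by
        rw [Set.mem_singleton_iff.mp hw, sub_self, norm_zero]; positivity⟩) (by simp) (by simp)
    rw [hr]
    refine ⟨Q, hQ.mono ?_, fun ω => hQle ω z rfl⟩
    gcongr; linarith

set_option maxHeartbeats 400000 in
/-- The risk bound in terms of the rate of the second stage and the optimization error. The
pointwise error of the second stage is in mean square; it becomes a bound in mean through
`2 |D| ≤ D² / η + η`. -/
lemma exists_risk_bound {d : ℕ} {β L M pmin pmax σ : ℝ} (hβ : 2 ≤ β) (hL : 0 < L)
    (hpmin : 0 < pmin) (hσ : 0 < σ) {Θ : Set (E d)} (hΘcompact : IsCompact Θ)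
    (hΘconvex : Convex ℝ Θ) {K : E d → ℝ} (hK : IsKernel K) :
    ∃ C : ℝ, 0 < C ∧
      ∀ (n : ℕ), 0 < n → Even n →
      ∀ (α : ℝ), 0 < α →
      ∀ (f : E d → ℝ) (xstar : E d), RegressionClass Θ β L M α f xstar →
      ∀ (Ω : Type*) [MeasurableSpace Ω] (μ : Measure Ω) [IsProbabilityMeasure μ]
        (X : Fin n → Ω → E d) (ξ : Fin n → Ω → ℝ),
        IsDesign μ Θ pmin pmax X → IsNoise μ σ X ξ →
      ∀ z1 ∈ Θ,
        MeanLE μ (fun ω => |minValueEstimator Θ β α K z1 (fun i => X i ω)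
            (fun i => f (X i ω) + ξ i ω) - f xstar|)
          (C * ((n : ℝ) ^ (-(β / (2 * β + d)))
            + α⁻¹ * (Real.log n / n) ^ (2 * (β - 1) / (2 * β + d)))) := by
  obtain ⟨Cs, hCs, hstage⟩ := exists_stage_bounds (M := M) (pmax := pmax) hβ hL hpmin hσ
    hΘcompact.isBounded hK
  obtain ⟨c0, hc0, hcoer⟩ := hK.exists_coercive (strictFloor β)
  set G2 : ℝ := (M + L) ^ 2 / c0 with hG2
  have hG20 : 0 ≤ G2 := by positivity
  set γ : ℝ := 2 * (β - 1) / (2 * β + d) with hγ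
  have hden : 0 < 2 * β + d := by positivity
  have hγ0 : 0 ≤ γ := div_nonneg (by linarith) hden.le
  have hγ1 : γ < 1 := by
    rw [hγ, div_lt_one hden]
    linarith [(Nat.cast_nonneg d : (0 : ℝ) ≤ d)]
  have h1γ : 0 < 1 - γ := by linarith
  set Co : ℝ := (3 * Cs + 4 * G2) * 2 / (1 - γ) with hCo
  have hCo0 : 0 ≤ Co := by positivity
  refine ⟨(Cs + 1) + Co, by positivity, ?_⟩
  intro n hn heven α hα f xstar hf Ω _ μ _ X ξ hX hξ z1 hz1
  obtain ⟨m, hm2⟩ := heven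
  have hm : n / 2 = m := by omega
  have hm0 : 0 < m := by omega
  have hn' : (1 : ℝ) ≤ n := by exact_mod_cast hn
  have hfdiff := hf.holder.differentiable_fun hβ
  have hfcont : Continuous f := hfdiff.continuous
  have hℓ := one_le_strictFloor hβ
  obtain ⟨hst1, hst2⟩ := hstage n f hf.holder hf.bounded Ω μ X ξ hX hξ
  set η : ℝ := (n : ℝ) ^ (-(β / (2 * β + d))) with hη
  have hη0 : 0 < η := Real.rpow_pos_of_pos (by linarith) _
  set x : Ω → Fin n → E d := fun ω i => X i ω with hx
  set y : Ω → Fin n → ℝ := fun ω i => f (X i ω) + ξ i ω with hy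
  have hxm : Measurable x := measurable_pi_lambda _ hX.measurable
  have hym : Measurable y := measurable_pi_lambda _ fun i =>
    (hfcont.measurable.comp (hX.measurable i)).add (hξ.measurable i)
  set zb : Ω → E d := fun ω => averagedIterate Θ β α K z1 (x ω) (y ω) m with hzb
  have hzbm : Measurable zb := measurable_averagedIterate hΘcompact hΘconvex hK hz1 hxm hym m
  set g : Ω → ℕ → E d := fun ω k => gradEstimator (strictFloor β) K (bandwidth d β (k + 1))
    (regularization d β (k + 1)) (firstObs n (k + 1)) (x ω) (y ω)
    (iterate Θ β α K z1 (x ω) (y ω) k) with hg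
  have hgrad : ∀ z ∈ Θ, ‖∇ f z‖ ^ 2 ≤ G2 := fun z hz => by
    refine (sq_norm_gradient_le hℓ hfdiff z).trans ?_
    rw [hG2, le_div_iff₀ hc0, mul_comm]
    exact sum_sq_mixedPartial_le hβ hL hK hcoer hf.holder hf.bounded hz
  have hdesc : ∀ ω, zb ω ∈ Θ ∧ f (zb ω) - f xstar ≤ α⁻¹ * ((1 / (m : ℝ)) *
      ∑ k ∈ Finset.range m, (3 * ‖∇ f (iterate Θ β α K z1 (x ω) (y ω) k) - g ω k‖ ^ 2
        + 2 * G2 / ((k + 1 : ℕ) : ℝ))) := fun ω =>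
    value_average_sub_le hα hΘcompact hΘconvex hf.xstar_mem hf.strongly_convex hgrad
      (fun k => iterate_mem hΘcompact hz1 _ _ k) (fun k => rfl) hm0
  -- the optimization error; the majorants do not depend on the point, so they may be evaluated at
  -- the iterate, which is a function of the same data
  have hQex : ∀ k : ℕ, ∃ Q : Ω → ℝ, k < m →
      (MeanLE μ Q (Cs * (Real.log (((k + 1 : ℕ) : ℝ) + 1) / ((k + 1 : ℕ) : ℝ)) ^ γ) ∧
        ∀ ω, ‖∇ f (iterate Θ β α K z1 (x ω) (y ω) k) - g ω k‖ ^ 2 ≤ Q ω) := by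
    intro k
    by_cases hkm : k < m
    · obtain ⟨Q, hQ, hQle⟩ := hst1 (k + 1) k.succ_pos (by omega)
      obtain ⟨-, hρ, hρ1⟩ := log_add_one_bounds k.succ_pos
      have hh := (rpow_bandwidth_pos_le_one (d := d) hβ hρ hρ1).1
      refine ⟨fun ω => ((bandwidth d β (k + 1)) ^ 2)⁻¹ * Q ω, fun _ => ⟨?_, fun ω => ?_⟩⟩
      · refine (hQ.const_mul (by positivity)).mono (le_of_eq ?_)
        rw [mul_left_comm]
        congr 1
        exact inv_bandwidth_sq_mul hρ
      · refine (sq_norm_gradEstimator_sub_le hℓ K hh _ _ _ _ _ hfdiff).trans ?_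
        exact mul_le_mul_of_nonneg_left (hQle ω _ (iterate_mem hΘcompact hz1 _ _ k))
          (by positivity)
    · exact ⟨0, fun h => absurd h hkm⟩
  choose Q hQ using hQex
  have hopt : MeanLE μ (fun ω => f (zb ω) - f xstar) (α⁻¹ * (Co * (Real.log n / n) ^ γ)) := by
    have hsum : MeanLE μ (fun ω => ∑ k ∈ Finset.range m, (3 * Q k ω + 2 * G2 / ((k + 1 : ℕ) : ℝ)))
        (∑ k ∈ Finset.range m,
          (3 * (Cs * (Real.log (((k + 1 : ℕ) : ℝ) + 1) / ((k + 1 : ℕ) : ℝ)) ^ γ)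
            + 2 * G2 / ((k + 1 : ℕ) : ℝ))) := MeanLE.sum fun k hk =>
      ((hQ k (Finset.mem_range.mp hk)).1.const_mul (by norm_num)).add (MeanLE.const _)
    refine (((hsum.const_mul (by positivity : (0 : ℝ) ≤ 1 / m)).const_mul
      (by positivity : 0 ≤ α⁻¹)).of_le ((hfcont.measurable.comp hzbm).sub_const _)
      (fun ω => sub_nonneg.mpr (hf.xstar_min _ (hdesc ω).1)) fun ω => ?_).mono ?_
    · refine (hdesc ω).2.trans ?_
      gcongr with k hk
      exact (hQ k (Finset.mem_range.mp hk)).2 ω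
    · refine mul_le_mul_of_nonneg_left ?_ (by positivity)
      exact average_steps_le hγ0 hγ1 hCs hG20 hm0 (by omega)
  -- the estimation error of the second stage, at a point independent of the data it uses
  set est : E d → (Fin n → E d × ℝ) → ℝ := fun z q =>
    funEstimator (strictFloor β) K ((n : ℝ) ^ (-(1 / (2 * β + d)))) η (lastObs n m)
      (fun i => (q i).1) (fun i => f (q i).1 + (q i).2) z with hest
  set q : Ω → Fin n → E d × ℝ := fun ω i => (X i ω, ξ i ω) with hq
  have hdatam : Measurable fun (q : Fin n → E d × ℝ) (i : Fin n) => (q i).1 :=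
    measurable_pi_lambda _ fun i => (measurable_pi_apply i).fst
  have hdatam' : Measurable fun (q : Fin n → E d × ℝ) (i : Fin n) => f (q i).1 + (q i).2 :=
    measurable_pi_lambda _ fun i =>
      (hfcont.measurable.comp (measurable_pi_apply i).fst).add (measurable_pi_apply i).snd
  have hqm : ∀ i, Measurable fun ω => (X i ω, ξ i ω) := fun i =>
    (hX.measurable i).prodMk (hξ.measurable i)
  have hindq : iIndepFun (fun i ω => (X i ω, ξ i ω)) μ :=
    iIndepFun_prodMk_of_indepFun hX.measurable hξ.measurable hX.independent hξ.independent
      hξ.indep_design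
  have hres : ∀ s : Finset (Fin n), Measurable fun ω => restrictData s (q ω) := fun s =>
    measurable_pi_lambda _ fun i => by
      by_cases hi : i ∈ s
      · simp only [restrictData, hi, if_true]; exact hqm i
      · simp only [restrictData, hi, if_false]; exact measurable_const
  have hzbres : ∀ ω, zb ω = averagedIterate Θ β α K z1
      (fun i => (restrictData (firstObs n m) (q ω) i).1)
      (fun i => f (restrictData (firstObs n m) (q ω) i).1
        + (restrictData (firstObs n m) (q ω) i).2) m := fun ω =>
    averagedIterate_congr (fun i hi => by simp [restrictData, hi, hq, hx])
      (fun i hi => by simp [restrictData, hi, hq, hy])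
  have hestres : ∀ z ω, est z (restrictData (lastObs n m) (q ω)) = funEstimator (strictFloor β) K
      ((n : ℝ) ^ (-(1 / (2 * β + d)))) η (lastObs n m) (x ω) (y ω) z := fun z ω => by
    simp only [hest, funEstimator]
    rw [localPolyCoeff_congr (x' := x ω) (y' := y ω)]
    · intro i hi; simp [restrictData, hi, hq, hx]
    · intro i hi; simp [restrictData, hi, hq, hy]
  have hind : IndepFun zb (fun ω => restrictData (lastObs n m) (q ω)) μ := by
    have h1 := indepFun_restrictData hqm hindq (disjoint_firstObs_lastObs n m)
    have h2 := h1.comp (measurable_averagedIterate (β := β) (a := α) hΘcompact hΘconvex hK hz1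
      hdatam hdatam' m) measurable_id
    have h3 : zb = (fun q : Fin n → E d × ℝ => averagedIterate Θ β α K z1 (fun i => (q i).1)
        (fun i => f (q i).1 + (q i).2) m) ∘ fun ω => restrictData (firstObs n m) (q ω) :=
      funext hzbres
    rw [h3]
    exact h2
  have hestm : Measurable (Function.uncurry fun z q => (est z q - f z) ^ 2) := by
    have h1 : Measurable fun p : E d × (Fin n → E d × ℝ) => est p.1 p.2 :=
      measurable_funEstimator hK _ _ _ (hdatam.comp measurable_snd) (hdatam'.comp measurable_snd)
        measurable_fst
    exact (h1.sub (hfcont.measurable.comp measurable_fst)).pow_const 2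
  have hsq : MeanLE μ (fun ω => (est (zb ω) (restrictData (lastObs n m) (q ω)) - f (zb ω)) ^ 2)
      (Cs * η ^ 2) := by
    refine meanLE_of_indepFun (F := fun z q => (est z q - f z) ^ 2) hzbm (hres _) hind hestm
      (fun _ _ => sq_nonneg _) (T := Θ) (fun ω => (hdesc ω).1) fun z hz => ?_
    obtain ⟨Q', hQ', hQle'⟩ := hst2 hn ⟨m, hm2⟩ z hz
    have hmeas : Measurable fun ω => (est z (restrictData (lastObs n m) (q ω)) - f z) ^ 2 := by
      simp only [hestres]
      exact ((measurable_funEstimator hK _ _ _ hxm hym measurable_const).sub_const _).pow_const 2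
    refine hQ'.of_le hmeas (fun ω => sq_nonneg _) fun ω => ?_
    · rw [hestres]
      rw [hm] at hQle'
      exact (sq_funEstimator_sub_le ..).trans (hQle' ω)
  have hfinal := ((hsq.add (MeanLE.const (η ^ 2))).const_mul
    (by positivity : 0 ≤ (2 * η)⁻¹)).add hopt
  refine (hfinal.of_le ?_ (fun ω => abs_nonneg _) fun ω => ?_).mono ?_
  · unfold minValueEstimator
    rw [hm]
    have hm1 : Measurable fun ω => funEstimator (strictFloor β) K ((n : ℝ) ^ (-(1 / (2 * β + d)))) η
        (lastObs n m) (x ω) (y ω) (zb ω) := measurable_funEstimator hK _ _ _ hxm hym hzbm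
    exact (hm1.sub_const _).abs
  · have h1 : minValueEstimator Θ β α K z1 (fun i => X i ω) (fun i => f (X i ω) + ξ i ω)
        = est (zb ω) (restrictData (lastObs n m) (q ω)) := by
      rw [hestres, minValueEstimator, hm]
    rw [h1]
    set D := est (zb ω) (restrictData (lastObs n m) (q ω)) - f (zb ω) with hD
    have h2 : est (zb ω) (restrictData (lastObs n m) (q ω)) - f xstar
        = D + (f (zb ω) - f xstar) := by rw [hD]; ring
    have h3 : 0 ≤ f (zb ω) - f xstar := sub_nonneg.mpr (hf.xstar_min _ (hdesc ω).1)
    have h4 : |D| ≤ (2 * η)⁻¹ * (D ^ 2 + η ^ 2) := by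
      rw [le_inv_mul_iff₀ (by positivity), ← sq_abs D]
      linarith [sq_nonneg (|D| - η)]
    rw [h2]
    refine (abs_add_le _ _).trans ?_
    rw [abs_of_nonneg h3]
    linarith
  · have h1 : (2 * η)⁻¹ * (Cs * η ^ 2 + η ^ 2) = (Cs + 1) / 2 * η := by field_simp
    rw [h1]
    have hlog0 : 0 ≤ Real.log n := Real.log_nonneg hn'
    have h2 : 0 ≤ α⁻¹ * (Real.log n / n) ^ γ := by positivity
    have h3 : 0 ≤ (Cs + 1) / 2 * η := by positivity
    have h4 : 0 ≤ Co * η := by positivity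
    have h5 : 0 ≤ (Cs + 1) * (α⁻¹ * (Real.log n / n) ^ γ) := by positivity
    linarith

end PassiveDesign

end

theorem theorem4 (d : ℕ) (hd : 0 < d) (β L M pmin pmax σ : ℝ) (hβ : 2 ≤ β) (hL : 0 < L)
    (hpmin : 0 < pmin) (hσ : 0 < σ)
    (Θ : Set (E d)) (hΘcompact : IsCompact Θ) (hΘconvex : Convex ℝ Θ)
    (K : E d → ℝ) (hK : IsKernel K) :
    ∃ C : ℝ, 0 < C ∧
      ∀ (n : ℕ), 0 < n → Even n →
      ∀ (α : ℝ), 0 < α →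
      ∀ (f : E d → ℝ) (xstar : E d), RegressionClass Θ β L M α f xstar →
      ∀ (Ω : Type*) [MeasurableSpace Ω] (μ : Measure Ω) [IsProbabilityMeasure μ]
        (X : Fin n → Ω → E d) (ξ : Fin n → Ω → ℝ) (Y : Fin n → Ω → ℝ),
        IsDesign μ Θ pmin pmax X → IsNoise μ σ X ξ →
        (∀ i ω, Y i ω = f (X i ω) + ξ i ω) →
      ∀ z1 ∈ Θ, ∀ fhat : Ω → ℝ,
        (∀ ω, fhat ω = minValueEstimator Θ β α K z1 (fun i => X i ω) (fun i => Y i ω)) →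
        Integrable (fun ω => |fhat ω - f xstar|) μ ∧
        (β = 2 → ∫ ω, |fhat ω - f xstar| ∂μ ≤
          C * max 1 α⁻¹ * (Real.log n / n) ^ ((2 : ℝ) / (4 + d))) ∧
        (2 < β → ∫ ω, |fhat ω - f xstar| ∂μ ≤
          C * max 1 α⁻¹ * (n : ℝ) ^ (-(β / (2 * β + d)))) ∧
        ((n : ℝ) ^ (-((β - 2) / (2 * β + d))) *
            Real.log n ^ (2 * (β - 1) / (2 * β + d)) ≤ α →
          ∫ ω, |fhat ω - f xstar| ∂μ ≤ C * (n : ℝ) ^ (-(β / (2 * β + d)))) := by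
  obtain ⟨C0, hC0, hrisk⟩ := exists_risk_bound (M := M) (pmax := pmax) hβ hL hpmin hσ
    hΘcompact hΘconvex hK
  have hden : 0 < 2 * β + d := by positivity
  set γ : ℝ := 2 * (β - 1) / (2 * β + d) with hγ
  have hγ0 : 0 ≤ γ := div_nonneg (by linarith) hden.le
  have hγ1 : γ ≤ 1 := by
    rw [hγ, div_le_one hden]
    linarith [(Nat.cast_nonneg d : (0 : ℝ) ≤ d)]
  set e : ℝ := (β - 2) / (2 * β - 2) with he
  have he0 : 0 ≤ e := div_nonneg (by linarith) (by linarith)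
  -- `log n ≤ n ^ e / e` absorbs the logarithm when `β > 2`
  set Ce : ℝ := (e⁻¹) ^ γ with hCe
  have hCe0 : 0 ≤ Ce := by positivity
  refine ⟨C0 * (3 + Ce), by positivity, ?_⟩
  intro n hn heven α hα f xstar hf Ω _ μ _ X ξ Y hX hξ hY z1 hz1 fhat hfhat
  have hmain := hrisk n hn heven α hα f xstar hf Ω μ X ξ hX hξ z1 hz1
  have hYeq : ∀ ω, (fun i => Y i ω) = fun i => f (X i ω) + ξ i ω := fun ω =>
    funext fun i => hY i ω
  have hfeq : (fun ω => |fhat ω - f xstar|) = fun ω => |minValueEstimator Θ β α K z1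
      (fun i => X i ω) (fun i => f (X i ω) + ξ i ω) - f xstar| := by
    funext ω
    rw [hfhat ω, hYeq ω]
  rw [← hfeq] at hmain
  obtain ⟨hint, hle⟩ := hmain
  have hn2 : (2 : ℝ) ≤ n := by
    obtain ⟨m, hm⟩ := heven
    have : 2 ≤ n := by omega
    exact_mod_cast this
  have hn0 : (0 : ℝ) < n := by linarith
  have hlog : 1 / 2 ≤ Real.log n := half_le_log_two.trans (Real.log_le_log (by norm_num) hn2)
  have hlog0 : 0 < Real.log n := by linarith
  have hmax1 : 1 ≤ max 1 α⁻¹ := le_max_left _ _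
  have hmax2 : α⁻¹ ≤ max 1 α⁻¹ := le_max_right _ _
  have hα' : 0 < α⁻¹ := by positivity
  have hsplit : (Real.log n / n) ^ γ = Real.log n ^ γ * (n : ℝ) ^ (-γ) := by
    rw [Real.div_rpow hlog0.le hn0.le, Real.rpow_neg hn0.le, div_eq_mul_inv]
  have hgap : (n : ℝ) ^ (-γ)
      = (n : ℝ) ^ (-(β / (2 * β + d))) * (n : ℝ) ^ (-((β - 2) / (2 * β + d))) := by
    rw [← Real.rpow_add hn0]
    congr 1
    rw [hγ]
    ring
  set η : ℝ := (n : ℝ) ^ (-(β / (2 * β + d))) with hη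
  have hη0 : 0 < η := Real.rpow_pos_of_pos hn0 _
  refine ⟨hint, fun hβ2 => hle.trans ?_, fun hβ2 => hle.trans ?_, fun hαn => hle.trans ?_⟩
  · have hγ2 : γ = 2 / (4 + d) := by rw [hγ, hβ2]; norm_num
    rw [← hγ2]
    set r : ℝ := (Real.log n / n) ^ γ with hr
    have hr0 : 0 < r := by positivity
    have hηr : η ≤ 2 * r := by
      have h1 : η = (n : ℝ) ^ (-γ) := by rw [hη, hγ2, hβ2]; norm_num
      have h2 : (1 / 2 : ℝ) ^ γ ≤ Real.log n ^ γ := Real.rpow_le_rpow (by norm_num) hlog hγ0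
      have h3 : (1 / 2 : ℝ) ^ (1 : ℝ) ≤ (1 / 2 : ℝ) ^ γ :=
        Real.rpow_le_rpow_of_exponent_ge (by norm_num) (by norm_num) hγ1
      rw [Real.rpow_one] at h3
      rw [hsplit, ← h1]
      nlinarith
    calc C0 * (η + α⁻¹ * r) ≤ C0 * (2 * r + max 1 α⁻¹ * r) := by gcongr
      _ ≤ C0 * ((3 + Ce) * max 1 α⁻¹ * r) := by
          refine mul_le_mul_of_nonneg_left ?_ hC0.le
          have h1 : r ≤ max 1 α⁻¹ * r := le_mul_of_one_le_left hr0.le hmax1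
          have h2 : 0 ≤ Ce * (max 1 α⁻¹ * r) := by positivity
          linarith
      _ = _ := by ring
  · have he0' : 0 < e := div_pos (by linarith) (by linarith)
    have hr : (Real.log n / n) ^ γ ≤ Ce * η := by
      have h1 : Real.log n ^ γ ≤ Ce * (n : ℝ) ^ ((β - 2) / (2 * β + d)) := by
        have h2 := Real.log_le_rpow_div hn0.le he0'
        have h3 : (n : ℝ) ^ ((β - 2) / (2 * β + d)) = ((n : ℝ) ^ e) ^ γ := by
          rw [← Real.rpow_mul hn0.le]
          congr 1
          rw [he, hγ]
          have h4 : 2 * β - 2 ≠ 0 := by linarith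
          rw [show 2 * (β - 1) = 2 * β - 2 by ring, div_mul_div_cancel₀ h4]
        rw [h3, hCe, ← Real.mul_rpow (by positivity) (by positivity), inv_mul_eq_div]
        exact Real.rpow_le_rpow hlog0.le h2 hγ0
      have h4 : (n : ℝ) ^ ((β - 2) / (2 * β + d)) * (n : ℝ) ^ (-((β - 2) / (2 * β + d))) = 1 := by
        rw [← Real.rpow_add hn0, add_neg_cancel, Real.rpow_zero]
      rw [hsplit, hgap]
      calc Real.log n ^ γ * (η * (n : ℝ) ^ (-((β - 2) / (2 * β + d))))
          ≤ (Ce * (n : ℝ) ^ ((β - 2) / (2 * β + d)))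
            * (η * (n : ℝ) ^ (-((β - 2) / (2 * β + d)))) := by gcongr
        _ = Ce * η * ((n : ℝ) ^ ((β - 2) / (2 * β + d))
            * (n : ℝ) ^ (-((β - 2) / (2 * β + d)))) := by ring
        _ = Ce * η := by rw [h4, mul_one]
    calc C0 * (η + α⁻¹ * (Real.log n / n) ^ γ) ≤ C0 * (η + max 1 α⁻¹ * (Ce * η)) := by gcongr
      _ ≤ C0 * ((3 + Ce) * max 1 α⁻¹ * η) := by
          refine mul_le_mul_of_nonneg_left ?_ hC0.le
          have h1 : η ≤ max 1 α⁻¹ * η := le_mul_of_one_le_left hη0.le hmax1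
          linarith
      _ = _ := by ring
  · have hr : α⁻¹ * (Real.log n / n) ^ γ ≤ η := by
      rw [inv_mul_le_iff₀ hα, hsplit, hgap]
      calc Real.log n ^ γ * (η * (n : ℝ) ^ (-((β - 2) / (2 * β + d))))
          = (n : ℝ) ^ (-((β - 2) / (2 * β + d))) * Real.log n ^ γ * η := by ring
        _ ≤ α * η := by gcongr
    calc C0 * (η + α⁻¹ * (Real.log n / n) ^ γ) ≤ C0 * (η + η) := by gcongr
      _ ≤ C0 * (3 + Ce) * η := by
          have h1 : 0 ≤ C0 * η := by positivity
          have h2 : 0 ≤ C0 * Ce * η := by positivity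
          linarith
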